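/- **Definitions.** For $n\ge 1$, an *$n$-cut* is a set $S\subseteq\{-1,0,1\}^n$ with $\operatorname{span}_{\mathbb R}(S)\cap\{-1,0,1\}^n=S$ such that every nonzero $x\in S$ has $\mathrm{Plus}(x)=\{i: x_i=1\}\ne\emptyset$ and $\mathrm{Minus}(x)=\{i:x_i=-1\}\neq\emptyset$. Let $P(n)$ be the set of partitions of $[n]$. For an ordered partition $\pi=(\pi_1,\dots,\pi_m)$ of $[n]$, with underlying partition $\mathrm{un}(\pi)$, $\pi S$ is the $m$-cut of all $t\in\{-1,0,1\}^m$ such that the vector of $\mathbb R^n$ with value $t_j$ on $\pi_j$ lies in $S$. The *resonance category* $\mathcal R$ has as objects all $n$-cuts, $n\ge1$; a morphism from an $m$-cut $S$ to an $n$-cut $T$ is an ordered partition $\pi$ of $[n]$ into $m$ parts with $S\subseteq\pi T$; composition is composition of ordered partitions (merging blocks). Write $\pi S\hookrightarrow S$ for the morphism from $\pi S$ to $S$ given by $\pi$. For $\pi\in P(n)$ let $\pi\Downarrow S$ be the smallest set of finite collections of multisubsets of $[n]$ that contains $\pi$ and is closed under replacing two members of a collection by their sum (union with multiplicities), and under replacing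 a member $B\supseteq\mathrm{Plus}(x)$, where $x\in S$, by $(B\setminus\mathrm{Plus}(x))\cup\mathrm{Minus}(x)$ (with multiplicities). Put $\pi\downarrow S=(\pi\Downarrow S)\cap P(n)$. A set $\Pi\subseteq P(n)$ is *$S$-closed* if $\bigcup_{\pi\in\Pi}\pi\downarrow S=\Pi$; then $S\setminus\Pi$ is the set of $s\in S$ for which the partition with blocks $\mathrm{Minus}(s)$, $\mathrm{Plus}(s)$ and singletons is not in $\Pi$, and $Q(S,\Pi)=(S\setminus\Pi,\Pi)$. Let $[Q(S,\Pi)]$ be the orbit of this pair under $\mathcal S_n$. All spaces are pointed topological spaces with nondegenerate base point (the inclusion of the base point is a closed cofibration), and $\simeq$ is pointed homotopy equivalence. For a functor $\mathcal F$ from $\mathcal R$ to such spaces and $\Pi\subseteq P(n)$ let $\mathcal F(Q(S,\Pi))$ be the pointed quotient of $\mathcal F(S)$ by the union of the images of $\mathcal F(\pi S\hookrightarrow S)$ over all ordered partitions $\pi$ with $\mathrm{un}(\pi)\in\Pi$. $\mathcal F$ is a *resonance functor* if * (A1) for every $n$-cut $S$ and ordered partition $\pi$ of $[n]$, $\mathcal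 F(\pi S\hookrightarrow S)$ is the inclusion of a closed subspace with the homotopy extension property, and $\mathcal F(S)/\operatorname{Im}\mathcal F(\pi S\hookrightarrow S)\simeq\mathcal F(Q(S,\mathrm{un}(\pi)\downarrow S))$; * (A2) if $S,T$ are $n$-cuts, $\Pi$ is $S$-closed, $\Lambda$ is $T$-closed and $[Q(S,\Pi)]=[Q(T,\Lambda)]$, then $\mathcal F(Q(S,\Pi))\simeq\mathcal F(Q(T,\Lambda))$; * (A3) if $S$ is an $m$-cut, $T$ an $n$-cut, $\Pi$ is $S$-closed and $\Lambda$ is $T$-closed, then $\mathcal F(Q(S,\Pi))\wedge\mathcal F(Q(T,\Lambda))\simeq\mathcal F(Q(S\times T,\Theta))$, where $\Theta$ is the set of partitions of $[m+n]$ whose restriction to the first $m$ elements is in $\Pi$ or whose restriction to the last $n$ elements is in $\Lambda$. For a finite family $\lambda=(\lambda_1,\dots,\lambda_N)$, $N\ge1$, of positive integers, $\mathcal F(\lambda)$ denotes $\mathcal F(S)$ for the cut $S=\{x\in\{-1,0,1\}^N:\sum_i x_i\lambda_i=0\}$; $c^k$ stands for $k$ parts equal to $c$. **Theorem 4.15.**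 Let $\mathcal F$ be a resonance functor such that $\mathcal F(1^l)$ is contractible for all $l\ge2$. Let $n\ge1$, let $1\le b_1<b_2<\dots<b_n$ be integers with $b_i\mid b_{i+1}$ for $1\le i<n$, let $m_1,\dots,m_{n-1}\ge1$ and $m_n=1$, and let $\lambda=(b_n,b_{n-1}^{m_{n-1}},\dots,b_1^{m_1})$ (parts in any order). Put $m_0=1$. Let $\Gamma_\lambda$ be the directed weighted graph on the vertices $0,1,\dots,n$ with an edge from $x$ to $y$, where $x<y$, if and only if $b_y$ divides $$b_{y-1}m_{y-1}+\dots+b_{x+1}m_{x+1}+b_x(m_x-1)$$ (the last term being $0$ for $x=0$); the weight $w(x,y)$ of this edge is the quotient of this sum by $b_y$. For a complete path $\gamma$, that is, a directed path from $0$ to $n$, let $l(\gamma)$ be its number of edges and $w(\gamma)$ the sum of the weights of its edges. Then $$\mathcal F(\lambda)\simeq\bigvee_{\gamma}\bigl(\mathcal F(1)^{l(\gamma)+w(\gamma)}\wedge S^{w(\gamma)}\bigr),$$ where the wedge is over all complete paths $\gamma$ of $\Gamma_\lambda$ (a point if there are none) and $\mathcal F(1)^k$ is the $k$-fold smash product.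 -/

import Mathlib

open CategoryTheory Topology

universe u

noncomputable section

open scoped Classical in
/-- The indices of the coordinates of `x` equal to `1`. -/
def plusSet {n : ℕ} (x : Fin n → ℝ) : Finset (Fin n) := Finset.univ.filter fun i => x i = 1

open scoped Classical in
/-- The indices of the coordinates of `x` equal to `-1`. -/
def minusSet {n : ℕ} (x : Fin n → ℝ) : Finset (Fin n) := Finset.univ.filter fun i => x i = -1

/-- The set `{-1,0,1}^n` in `ℝ^n`. -/
def signCube (n : ℕ) : Set (Fin n → ℝ) := {x | ∀ i, x i = -1 ∨ x i = 0 ∨ x i = 1}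

/-- An `n`-cut, for positive `n`: a span-closed subset of `{-1,0,1}^n` each of whose nonzero
elements has a coordinate `1` and a coordinate `-1`. -/
@[ext]
structure Cut (n : ℕ) where
  pos : 0 < n
  elems : Set (Fin n → ℝ)
  span_closed : (Submodule.span ℝ elems : Set (Fin n → ℝ)) ∩ signCube n = elems
  signs : ∀ x ∈ elems, x ≠ 0 → (plusSet x).Nonempty ∧ (minusSet x).Nonempty

theorem mem_plusSet {n : ℕ} {x : Fin n → ℝ} {i : Fin n} : i ∈ plusSet x ↔ x i = 1 := by
  simp [plusSet]

theorem mem_minusSet {n : ℕ} {x : Fin n → ℝ} {i : Fin n} : i ∈ minusSet x ↔ x i = -1 := by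
  simp [minusSet]

theorem Cut.mem_signCube {n : ℕ} (S : Cut n) {x : Fin n → ℝ} (hx : x ∈ S.elems) :
    x ∈ signCube n := by
  rw [← S.span_closed] at hx
  exact hx.2

theorem Cut.mem_of_span {n : ℕ} (S : Cut n) {x : Fin n → ℝ}
    (hx : x ∈ Submodule.span ℝ S.elems) (hc : x ∈ signCube n) : x ∈ S.elems := by
  rw [← S.span_closed]
  exact ⟨hx, hc⟩

/-- Pulling back along `f` maps the span of `A` into the span of `B` if it maps `A` into `B`. -/
theorem comp_mem_span {n m : ℕ} (f : Fin n → Fin m) {A : Set (Fin m → ℝ)} {B : Set (Fin n → ℝ)}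
    (h : ∀ x ∈ A, x ∘ f ∈ B) {x : Fin m → ℝ} (hx : x ∈ Submodule.span ℝ A) :
    x ∘ f ∈ Submodule.span ℝ B := by
  have : Submodule.span ℝ A ≤ (Submodule.span ℝ B).comap (LinearMap.funLeft ℝ ℝ f) :=
    Submodule.span_le.2 fun y hy => Submodule.subset_span (h y hy)
  exact this hx

/-- The cut `π S`. An ordered set partition `(π_1, …, π_m)` of `[n]` is encoded as the surjection
`f : [n] → [m]` whose fibre over `j` is the block `π_j`; then `π S` consists of those
`t ∈ {-1,0,1}^m` for which the vector with value `t_j` on all of `π_j` lies in `S`. -/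
def Cut.act {n m : ℕ} (S : Cut n) (f : Fin n → Fin m) (hf : Function.Surjective f) : Cut m where
  pos := (f ⟨0, S.pos⟩).pos
  elems := {t | t ∈ signCube m ∧ t ∘ f ∈ S.elems}
  span_closed := by
    ext t
    constructor
    · rintro ⟨h1, h2⟩
      exact ⟨h2, S.mem_of_span (comp_mem_span f (fun x hx => hx.2) h1) fun i => h2 (f i)⟩
    · intro h
      exact ⟨Submodule.subset_span h, h.1⟩
  signs := by
    rintro t ⟨-, h⟩ h0
    have h0' : t ∘ f ≠ 0 := by
      intro h1
      apply h0
      funext j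
      obtain ⟨i, rfl⟩ := hf j
      exact congrFun h1 i
    obtain ⟨⟨i, hi⟩, ⟨j, hj⟩⟩ := S.signs _ h h0'
    have hi' := mem_plusSet.1 hi
    have hj' := mem_minusSet.1 hj
    exact ⟨⟨f i, mem_plusSet.2 hi'⟩, ⟨f j, mem_minusSet.2 hj'⟩⟩

/-- The direct product of two cuts. -/
def Cut.prod {m n : ℕ} (S : Cut m) (T : Cut n) : Cut (m + n) where
  pos := Nat.add_pos_left S.pos n
  elems := {x | x ∘ Fin.castAdd n ∈ S.elems ∧ x ∘ Fin.natAdd m ∈ T.elems}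
  span_closed := by
    ext x
    constructor
    · rintro ⟨h1, h2⟩
      exact ⟨S.mem_of_span (comp_mem_span _ (fun y hy => hy.1) h1) fun i => h2 _,
        T.mem_of_span (comp_mem_span _ (fun y hy => hy.2) h1) fun i => h2 _⟩
    · intro h
      refine ⟨Submodule.subset_span h, fun i => ?_⟩
      refine Fin.addCases (fun j => ?_) (fun j => ?_) i
      · exact S.mem_signCube h.1 j
      · exact T.mem_signCube h.2 j
  signs := by
    rintro x ⟨h1, h2⟩ h0
    by_cases hS : x ∘ Fin.castAdd n = 0
    · have hT : x ∘ Fin.natAdd m ≠ 0 := by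
        intro hT
        apply h0
        funext i
        refine Fin.addCases (fun j => ?_) (fun j => ?_) i
        · exact congrFun hS j
        · exact congrFun hT j
      obtain ⟨⟨i, hi⟩, ⟨j, hj⟩⟩ := T.signs _ h2 hT
      have hi' := mem_plusSet.1 hi
      have hj' := mem_minusSet.1 hj
      exact ⟨⟨Fin.natAdd m i, mem_plusSet.2 hi'⟩, ⟨Fin.natAdd m j, mem_minusSet.2 hj'⟩⟩
    · obtain ⟨⟨i, hi⟩, ⟨j, hj⟩⟩ := S.signs _ h1 hS
      have hi' := mem_plusSet.1 hi
      have hj' := mem_minusSet.1 hj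
      exact ⟨⟨Fin.castAdd n i, mem_plusSet.2 hi'⟩, ⟨Fin.castAdd n j, mem_minusSet.2 hj'⟩⟩

/-- The cut of a vector `v` of positive integers: all elements of `{-1,0,1}^n` orthogonal to
`v`. -/
def Cut.ofVec {n : ℕ} (hn : 0 < n) (v : Fin n → ℕ+) : Cut n where
  pos := hn
  elems := {x | x ∈ signCube n ∧ ∑ i, x i * ((v i : ℕ) : ℝ) = 0}
  span_closed := by
    ext x
    constructor
    · rintro ⟨h1, h2⟩
      refine ⟨h2, ?_⟩
      clear h2
      induction h1 using Submodule.span_induction with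
      | mem y hy => exact hy.2
      | zero => simp
      | add y z _ _ hy hz =>
        simp only [Pi.add_apply, add_mul, Finset.sum_add_distrib]
        rw [hy, hz, add_zero]
      | smul a y _ hy =>
        simp only [Pi.smul_apply, smul_eq_mul, mul_assoc, ← Finset.mul_sum]
        rw [hy, mul_zero]
    · intro h
      exact ⟨Submodule.subset_span h, h.1⟩
  signs := by
    rintro x ⟨hc, h⟩ h0
    have hv : ∀ i, (0 : ℝ) < ((v i : ℕ) : ℝ) := fun i => by exact_mod_cast (v i).pos
    obtain ⟨k, hk⟩ : ∃ k, x k ≠ 0 := by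
      by_contra hcon
      push Not at hcon
      exact h0 (funext hcon)
    constructor
    · by_contra hcon
      have hle : ∀ i, x i ≤ 0 := by
        intro i
        rcases hc i with h | h | h
        · linarith
        · linarith
        · exact absurd ⟨i, mem_plusSet.2 h⟩ hcon
      have hs := (Finset.sum_eq_zero_iff_of_nonpos fun i _ =>
        mul_nonpos_of_nonpos_of_nonneg (hle i) (hv i).le).1 h k (Finset.mem_univ k)
      rcases mul_eq_zero.1 hs with h | h
      · exact hk h
      · exact (hv k).ne' h
    · by_contra hcon
      have hge : ∀ i, 0 ≤ x i := by
        intro i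
        rcases hc i with h | h | h
        · exact absurd ⟨i, mem_minusSet.2 h⟩ hcon
        · linarith
        · linarith
      have hs := (Finset.sum_eq_zero_iff_of_nonneg fun i _ =>
        mul_nonneg (hge i) (hv i).le).1 h k (Finset.mem_univ k)
      rcases mul_eq_zero.1 hs with h | h
      · exact hk h
      · exact (hv k).ne' h

/-! ### The resonance category -/

/-- Objects of the resonance category: all `n`-cuts, for all positive `n`. -/
structure ResCat where
  size : ℕ
  cut : Cut size

/-- A morphism from `S` (an `m`-cut) to `T` (an `n`-cut): an ordered set partition `π` of `[n]`
with `m` parts (encoded as a surjection) such that `S ⊆ π T`. -/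
@[ext]
structure ResCat.Hom (S T : ResCat) where
  part : Fin T.size → Fin S.size
  surj : Function.Surjective part
  sub : S.cut.elems ⊆ (T.cut.act part surj).elems

instance : Category ResCat where
  Hom := ResCat.Hom
  id S := ⟨id, Function.surjective_id, fun _ hx => ⟨S.cut.mem_signCube hx, hx⟩⟩
  comp {S T Q} f g := ⟨f.part ∘ g.part, f.surj.comp g.surj, fun _ hx =>
    ⟨S.cut.mem_signCube hx, (g.sub (f.sub hx).2).2⟩⟩

/-- The morphism `π S ↪ S`. -/
def inclHom {n m : ℕ} (S : Cut n) (f : Fin n → Fin m) (hf : Function.Surjective f) :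
    (ResCat.mk m (S.act f hf)) ⟶ (ResCat.mk n S) :=
  ResCat.Hom.mk f hf (subset_refl _)

/-- The object of the resonance category given by the number partition with parts `v`, in the
chosen order. -/
def resOf {n : ℕ} (hn : 0 < n) (v : Fin n → ℕ+) : ResCat := ⟨n, Cut.ofVec hn v⟩

/-! ### Partitions at infinity -/

open scoped Classical in
/-- The collection of blocks of a set partition of `[n]` (given as an equivalence relation), as a
collection of multisubsets of `[n]`. -/
def blocks {n : ℕ} (π : Setoid (Fin n)) : Multiset (Multiset (Fin n)) :=
  (Finset.univ.image fun i => Finset.univ.filter fun j => π i j).val.map Finset.val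

/-- `Down S A` is the set `A ⇓ S`: the least set of collections of multisubsets of `[n]` that
contains `A` and is closed under merging two members of a collection, and under replacing, in a
member of a collection, the indices of the coordinates `1` of some `x ∈ S` by the indices of its
coordinates `-1`. Unions are unions with multiplicity. -/
inductive Down {n : ℕ} (S : Cut n) (A : Multiset (Multiset (Fin n))) :
    Multiset (Multiset (Fin n)) → Prop
  | refl : Down S A A
  | merge {B₁ B₂ : Multiset (Fin n)} {R : Multiset (Multiset (Fin n))} :
      Down S A (B₁ ::ₘ B₂ ::ₘ R) → Down S A ((B₁ + B₂) ::ₘ R)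
  | swap {B : Multiset (Fin n)} {R : Multiset (Multiset (Fin n))} {x : Fin n → ℝ} :
      Down S A (B ::ₘ R) → x ∈ S.elems → (plusSet x).val ≤ B →
      Down S A ((B - (plusSet x).val + (minusSet x).val) ::ₘ R)

/-- The set of partitions `π ↓ S`. -/
def downSet {n : ℕ} (π : Setoid (Fin n)) (S : Cut n) : Set (Setoid (Fin n)) :=
  {τ | Down S (blocks π) (blocks τ)}

/-- `Π` is `S`-closed, that is `Π ↓ S = Π`. -/
def SClosed {n : ℕ} (S : Cut n) (P : Set (Setoid (Fin n))) : Prop :=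
  ⋃ π ∈ P, downSet π S = P

/-- The partition of `[n]` with blocks `Minus(s)`, `Plus(s)`, and singletons. -/
def signPart {n : ℕ} (s : Fin n → ℝ) : Setoid (Fin n) where
  r i j := i = j ∨ (s i = 1 ∧ s j = 1) ∨ (s i = -1 ∧ s j = -1)
  iseqv :=
    { refl := fun _ => Or.inl rfl
      symm := by
        rintro i j (h | h | h)
        · exact Or.inl h.symm
        · exact Or.inr (Or.inl h.symm)
        · exact Or.inr (Or.inr h.symm)
      trans := by
        rintro i j k (rfl | h) (rfl | h')
        · exact Or.inl rfl
        · exact Or.inr h'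
        · exact Or.inr h
        · rcases h with h | h <;> rcases h' with h' | h'
          · exact Or.inr (Or.inl ⟨h.1, h'.2⟩)
          · linarith [h.2, h'.1]
          · linarith [h.2, h'.1]
          · exact Or.inr (Or.inr ⟨h.1, h'.2⟩) }

/-- The set `S \ Π` of surviving elements. The relative cut `Q(S, Π)` is the pair
`(S \ Π, Π)`, for `Π` an `S`-closed set of partitions. Every relative cut is of this form. -/
def surviving {n : ℕ} (S : Cut n) (P : Set (Setoid (Fin n))) : Set (Fin n → ℝ) :=
  S.elems \ {s | s ∈ S.elems ∧ signPart s ∈ P}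

/-- `[Q(S, Π)] = [Q(T, Λ)]`: the relative cuts lie in one orbit of the symmetric group. -/
def SameRelRes {n : ℕ} (S : Cut n) (P : Set (Setoid (Fin n))) (T : Cut n)
    (L : Set (Setoid (Fin n))) : Prop :=
  ∃ σ : Equiv.Perm (Fin n),
    (∀ x : Fin n → ℝ, x ∈ surviving S P ↔ x ∘ σ ∈ surviving T L) ∧
    (∀ π : Setoid (Fin n), π ∈ P ↔ π.comap σ ∈ L)

/-- The partitions at infinity `(Π × P(n)) ∪ (P(m) × Λ)` of a direct product of relative cuts, on
`m` and on `n` indices; `Setoid.comap` along an injection is restriction of partitions. -/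
def prodInf {m n : ℕ} (P : Set (Setoid (Fin m))) (L : Set (Setoid (Fin n))) :
    Set (Setoid (Fin (m + n))) :=
  {π | π.comap (Fin.castAdd n) ∈ P ∨ π.comap (Fin.natAdd m) ∈ L}

/-! ### Pointed spaces -/

/-- Pointed topological spaces. -/
structure PSpace : Type (u + 1) where
  carrier : Type u
  [top : TopologicalSpace carrier]
  pt : carrier

instance : CoeSort PSpace.{u} (Type u) := ⟨PSpace.carrier⟩

instance (X : PSpace.{u}) : TopologicalSpace X := X.top

/-- Base point preserving continuous maps. -/
@[ext]
structure PSpace.Hom (X Y : PSpace.{u}) where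
  map : C(X, Y)
  map_pt : map X.pt = Y.pt

instance : Category PSpace.{u} where
  Hom := PSpace.Hom
  id X := ⟨ContinuousMap.id X, rfl⟩
  comp f g := ⟨g.map.comp f.map, by
    rw [ContinuousMap.comp_apply, f.map_pt, g.map_pt]⟩

/-- Pointed homotopy equivalence. -/
def PHEquiv (X Y : PSpace.{u}) : Prop :=
  ∃ (f : PSpace.Hom X Y) (g : PSpace.Hom Y X),
    (g.map.comp f.map).HomotopicRel (ContinuousMap.id X) {X.pt} ∧
    (f.map.comp g.map).HomotopicRel (ContinuousMap.id Y) {Y.pt}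

/-- The equivalence relation on `X` that identifies all points of `A ∪ {pt}`. -/
def collapseSetoid (X : PSpace.{u}) (A : Set X) : Setoid X where
  r x y := x = y ∨ (x ∈ insert X.pt A ∧ y ∈ insert X.pt A)
  iseqv :=
    { refl := fun _ => Or.inl rfl
      symm := by
        rintro x y (h | h)
        · exact Or.inl h.symm
        · exact Or.inr h.symm
      trans := by
        rintro x y z (rfl | h) (rfl | h')
        · exact Or.inl rfl
        · exact Or.inr h'
        · exact Or.inr h
        · exact Or.inr ⟨h.1, h'.2⟩ }

/-- The pointed quotient `X / A`, with the quotient topology: `A` is shrunk to the base point. -/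
def collapse (X : PSpace.{u}) (A : Set X) : PSpace.{u} where
  carrier := Quotient (collapseSetoid X A)
  pt := Quotient.mk _ X.pt

/-- The smash product. -/
def smash (X Y : PSpace.{u}) : PSpace.{u} :=
  collapse ⟨X × Y, (X.pt, Y.pt)⟩ {p | p.1 = X.pt ∨ p.2 = Y.pt}

/-- The wedge of a family of pointed spaces (a point if the family is empty). -/
def wedge {ι : Type} (X : ι → PSpace.{u}) : PSpace.{u} :=
  collapse ⟨PUnit.{u + 1} ⊕ (Σ i, X i), Sum.inl PUnit.unit⟩
    (Set.range fun i => Sum.inr ⟨i, (X i).pt⟩)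

/-- The unit sphere of dimension `w`, with a base point. -/
def sphere (w : ℕ) : PSpace.{u} where
  carrier := ULift.{u} (Metric.sphere (0 : EuclideanSpace ℝ (Fin (w + 1))) 1)
  pt := ⟨EuclideanSpace.single 0 1, by simp⟩

/-- The `k`-fold smash product of `X` with itself (the `0`-sphere for `k = 0`). -/
def smashPow (X : PSpace.{u}) : ℕ → PSpace.{u}
  | 0 => sphere 0
  | k + 1 => smash X (smashPow X k)

/-- Closed cofibrations: closed embeddings with the homotopy extension property. -/
def IsClosedCofibration {A X : Type u} [TopologicalSpace A] [TopologicalSpace X]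
    (i : C(A, X)) : Prop :=
  IsClosedEmbedding i ∧
    ∀ (Y : Type u) [TopologicalSpace Y] (f : C(X, Y)) (H : C(A × unitInterval, Y)),
      (∀ a, H (a, 0) = f (i a)) →
      ∃ G : C(X × unitInterval, Y), (∀ x, G (x, 0) = f x) ∧ ∀ a t, G (i a, t) = H (a, t)

/-! ### Resonance functors -/

/-- The image of `F (π S ↪ S)` in `F S`. -/
def imIncl (F : ResCat ⥤ PSpace.{u}) {n m : ℕ} (S : Cut n) (f : Fin n → Fin m)
    (hf : Function.Surjective f) : Set (F.obj ⟨n, S⟩) :=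
  Set.range (PSpace.Hom.map (F.map (inclHom S f hf)))

/-- The space `F (Q(S, Π))`: the quotient of `F S` by the union of the images of
`F (π S ↪ S)`, over all ordered partitions `π` whose underlying partition is in `Π`. -/
def relSpace (F : ResCat ⥤ PSpace.{u}) {n : ℕ} (S : Cut n) (P : Set (Setoid (Fin n))) :
    PSpace.{u} :=
  collapse (F.obj ⟨n, S⟩)
    {y | ∃ (m : ℕ) (f : Fin n → Fin m) (hf : Function.Surjective f),
      Setoid.ker f ∈ P ∧ y ∈ imIncl F S f hf}

/-- Resonance functors, with values in pointed spaces with nondegenerate base points. -/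
structure IsResonanceFunctor (F : ResCat ⥤ PSpace.{u}) : Prop where
  /-- All base points are nondegenerate. -/
  wellPointed : ∀ S : ResCat,
    IsClosedCofibration (ContinuousMap.const PUnit.{u + 1} (F.obj S).pt)
  /-- Inclusion axiom, first part. -/
  incl : ∀ {n m : ℕ} (S : Cut n) (f : Fin n → Fin m) (hf : Function.Surjective f),
    IsClosedCofibration (PSpace.Hom.map (F.map (inclHom S f hf)))
  /-- Inclusion axiom, second part. -/
  quot : ∀ {n m : ℕ} (S : Cut n) (f : Fin n → Fin m) (hf : Function.Surjective f),
    PHEquiv (collapse (F.obj ⟨n, S⟩) (imIncl F S f hf)) (relSpace F S (downSet (Setoid.ker f) S))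
  /-- Relative resonance axiom. -/
  rel : ∀ {n : ℕ} (S T : Cut n) (P L : Set (Setoid (Fin n))), SClosed S P → SClosed T L →
    SameRelRes S P T L → PHEquiv (relSpace F S P) (relSpace F T L)
  /-- Direct product axiom. -/
  prod : ∀ {m n : ℕ} (S : Cut m) (T : Cut n) (P : Set (Setoid (Fin m)))
    (L : Set (Setoid (Fin n))), SClosed S P → SClosed T L →
    PHEquiv (smash (relSpace F S P) (relSpace F T L)) (relSpace F (S.prod T) (prodInf P L))

/-! ### The weighted graph -/

/-- The multiplicities, with the convention `m_0 = 1`. -/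
def mult (m : ℕ → ℕ) (x : ℕ) : ℕ := if x = 0 then 1 else m x

/-- The number `b_{y-1} m_{y-1} + … + b_{x+1} m_{x+1} + b_x (m_x - 1)`; for `x = 0` the last term
vanishes, whatever `b 0` is. -/
def edgeSum (b m : ℕ → ℕ) (x y : ℕ) : ℕ :=
  ∑ i ∈ Finset.Ioo x y, b i * mult m i + b x * (mult m x - 1)

/-- The vertices `0, …, n` of the graph. -/
structure Gam (b m : ℕ → ℕ) (n : ℕ) where
  idx : Fin (n + 1)

/-- There is an edge from `x` to `y` if and only if `x < y` and `b_y` divides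
`b_{y-1} m_{y-1} + … + b_{x+1} m_{x+1} + b_x (m_x - 1)`. -/
instance (b m : ℕ → ℕ) (n : ℕ) : Quiver (Gam b m n) where
  Hom x y := PLift (x.idx < y.idx ∧ b y.idx ∣ edgeSum b m x.idx y.idx)

/-- The weight of an edge from `x` to `y`; the division is exact if there is such an edge. -/
def edgeWeight (b m : ℕ → ℕ) (n : ℕ) (x y : Gam b m n) : ℕ :=
  edgeSum b m x.idx y.idx / b y.idx

/-- Complete directed paths: those from `0` to `n`. -/
abbrev CompletePath (b m : ℕ → ℕ) (n : ℕ) : Type :=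
  Quiver.Path (⟨0⟩ : Gam b m n) ⟨Fin.last n⟩

/-- The total weight of a path. -/
def pathWeight {b m : ℕ → ℕ} {n : ℕ} (γ : CompletePath b m n) : ℕ :=
  γ.addWeightOfEPs (edgeWeight b m n)

end

/-! Let a be the largest weight and let the other ("small") weights form a chain of divisors of a.
The main step compares two cuts on the same indices: the given one, and the one in which the copies
of a are balanced among themselves and the small weights among themselves. If the largest small
weights form a block of sum a, merging this block gives a closed subspace in both cases, and the two
quotients are equivalent (`ChainSplit.collapse_phequiv`). By (A1) and (A2) this is combinatorics. In
both cuts the partitions at infinity are those with a class containing small weights of sum a. A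
resonance that does not balance large and small weights separately has small weights of sum a among
its coordinates of one sign, so it does not survive.

Suppose first that a occurs k ≥ 2 times. Then the value of F is contractible
(`IsDvdChain.pcontractible`). The separated cut is a direct product with the cut of 1^k, so all
separated values are contractible; the merged subspace of the given cut has k + 1 copies of a and
fewer small weights, so induction applies to it.

Now let a occur once, with small weights μ. If their sum is less than a, then a enters no resonance
and F(a, μ) is F(1) ∧ F(μ). Otherwise μ = p ++ q with p of sum a. The merged subspace F(a, a, q) is
contractible, so F(a, p, q) is the quotient of F(1) ∧ F(p, q) by F(1) ∧ F(a, q). When the head c of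
p is less than a, the inclusion can be factored by first merging later entries of p of sum c; there
c is a repeated largest weight, so the inclusion is null-homotopic and F(a, p, q) ≃ F(1) ∧ F(p, q) ∨
Σ(F(1) ∧ F(a, q)).

Factors F(1) that have been split off are recorded by zero weights, whose coordinates are forced to
vanish. The recursion is that of `cutData`: the first summand closes an edge of the graph at the
current top weight, the second raises the weight of this edge by one. `hasDecomp_plain` solves the
recursion topologically, and `sum_path` identifies its solution with the complete paths: lists that
begin with a repeated entry contribute nothing, so the cuts that matter happen exactly at the
vertices. -/

noncomputable section

/-! ### Pointed maps and pointed homotopies -/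

/-- Composition of pointed maps. -/
def PSpace.Hom.comp {X Y Z : PSpace.{u}} (g : PSpace.Hom Y Z) (f : PSpace.Hom X Y) :
    PSpace.Hom X Z :=
  ⟨g.map.comp f.map, by rw [ContinuousMap.comp_apply, f.map_pt, g.map_pt]⟩

/-- The identity of a pointed space. -/
def PSpace.Hom.refl (X : PSpace.{u}) : PSpace.Hom X X := ⟨ContinuousMap.id X, rfl⟩

/-- The constant pointed map. -/
def PSpace.Hom.const (X Y : PSpace.{u}) : PSpace.Hom X Y := ⟨ContinuousMap.const X Y.pt, rfl⟩

/-- Pointed homotopy. -/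
def PHomotopic {X Y : PSpace.{u}} (f g : PSpace.Hom X Y) : Prop :=
  f.map.HomotopicRel g.map {X.pt}

namespace PHomotopic

variable {X Y Z : PSpace.{u}}

/-- Homotopies are handled as maps into the space of paths C(I, Y). On a quotient space such a map
comes from the universal property alone, with no need to multiply quotient maps by the interval. -/
theorem of_path {f g : PSpace.Hom X Y} (h : C(X, C(unitInterval, Y)))
    (h0 : ∀ x, h x 0 = f.map x) (h1 : ∀ x, h x 1 = g.map x) (hpt : ∀ t, h X.pt t = Y.pt) :
    PHomotopic f g := by
  refine ⟨{
    toFun := fun p => h p.2 p.1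
    continuous_toFun := (ContinuousMap.continuous_uncurry_of_continuous h).comp continuous_swap
    map_zero_left := h0
    map_one_left := h1
    prop' := ?_ }⟩
  rintro t x rfl
  exact (hpt t).trans f.map_pt.symm

theorem exists_path {f g : PSpace.Hom X Y} (h : PHomotopic f g) :
    ∃ H : C(X, C(unitInterval, Y)), (∀ x, H x 0 = f.map x) ∧ (∀ x, H x 1 = g.map x) ∧
      ∀ t, H X.pt t = Y.pt := by
  obtain ⟨H⟩ := h
  refine ⟨ContinuousMap.curry ⟨fun p => H (p.2, p.1), H.continuous.comp continuous_swap⟩,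
    fun x => H.apply_zero x, fun x => H.apply_one x, fun t => ?_⟩
  exact (H.eq_fst t (Set.mem_singleton _)).trans f.map_pt

theorem refl (f : PSpace.Hom X Y) : PHomotopic f f := ContinuousMap.HomotopicRel.refl _

theorem symm {f g : PSpace.Hom X Y} (h : PHomotopic f g) : PHomotopic g f :=
  ContinuousMap.HomotopicRel.symm h

theorem trans {f g k : PSpace.Hom X Y} (h : PHomotopic f g) (h' : PHomotopic g k) :
    PHomotopic f k :=
  ContinuousMap.HomotopicRel.trans h h'

theorem comp_left (k : PSpace.Hom Y Z) {f g : PSpace.Hom X Y} (h : PHomotopic f g) :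
    PHomotopic (k.comp f) (k.comp g) :=
  ContinuousMap.HomotopicRel.comp_continuousMap h k.map

theorem comp_right {f g : PSpace.Hom Y Z} (h : PHomotopic f g) (k : PSpace.Hom X Y) :
    PHomotopic (f.comp k) (g.comp k) := by
  obtain ⟨H, h0, h1, hp⟩ := h.exists_path
  refine of_path (H.comp k.map) (fun x => h0 _) (fun x => h1 _) fun t => ?_
  rw [ContinuousMap.comp_apply, k.map_pt, hp]

theorem of_eq {f g : PSpace.Hom X Y} (h : ∀ x, f.map x = g.map x) : PHomotopic f g := by
  obtain rfl : f = g := PSpace.Hom.ext (ContinuousMap.ext h)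
  exact refl f

end PHomotopic

namespace PHEquiv

variable {X Y Z : PSpace.{u}}

theorem intro (f : PSpace.Hom X Y) (g : PSpace.Hom Y X)
    (h : PHomotopic (g.comp f) (PSpace.Hom.refl X))
    (h' : PHomotopic (f.comp g) (PSpace.Hom.refl Y)) : PHEquiv X Y := ⟨f, g, h, h'⟩

theorem elim (h : PHEquiv X Y) : ∃ (f : PSpace.Hom X Y) (g : PSpace.Hom Y X),
    PHomotopic (g.comp f) (PSpace.Hom.refl X) ∧ PHomotopic (f.comp g) (PSpace.Hom.refl Y) := h

theorem of_inverse (f : PSpace.Hom X Y) (g : PSpace.Hom Y X) (h : ∀ x, g.map (f.map x) = x)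
    (h' : ∀ y, f.map (g.map y) = y) : PHEquiv X Y :=
  intro f g (PHomotopic.of_eq h) (PHomotopic.of_eq h')

theorem refl (X : PSpace.{u}) : PHEquiv X X :=
  of_inverse (PSpace.Hom.refl X) (PSpace.Hom.refl X) (fun _ => rfl) fun _ => rfl

theorem symm (h : PHEquiv X Y) : PHEquiv Y X := by
  obtain ⟨f, g, h1, h2⟩ := h
  exact ⟨g, f, h2, h1⟩

theorem trans (h : PHEquiv X Y) (h' : PHEquiv Y Z) : PHEquiv X Z := by
  obtain ⟨f, g, h1, h2⟩ := h.elim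
  obtain ⟨f', g', h1', h2'⟩ := h'.elim
  refine intro (f'.comp f) (g.comp g') ?_ ?_
  · exact ((h1'.comp_right f).comp_left g).trans h1
  · exact ((h2.comp_right g').comp_left f').trans h2'

end PHEquiv

/-! ### Pointed contractible spaces -/

/-- The one-point pointed space. -/
def pointSpace : PSpace.{u} := ⟨PUnit.{u + 1}, PUnit.unit⟩

/-- Pointed contractibility. -/
def PContractible (X : PSpace.{u}) : Prop :=
  PHomotopic (PSpace.Hom.refl X) (PSpace.Hom.const X X)

theorem PContractible.phequiv {X Y : PSpace.{u}} (h : PContractible X) (e : PHEquiv X Y) :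
    PContractible Y := by
  obtain ⟨f, g, h1, h2⟩ := e.elim
  refine h2.symm.trans (((h.comp_right g).comp_left f).trans (PHomotopic.of_eq fun y => ?_))
  exact f.map_pt

theorem PContractible.phequiv_of {X Y : PSpace.{u}} (h : PContractible X) (h' : PContractible Y) :
    PHEquiv X Y :=
  PHEquiv.intro (PSpace.Hom.const X Y) (PSpace.Hom.const Y X) (PHomotopic.symm h)
    (PHomotopic.symm h')

theorem PContractible.null {X Y Z : PSpace.{u}} (h : PContractible Y) (f : PSpace.Hom X Y)
    (g : PSpace.Hom Y Z) : PHomotopic (g.comp f) (PSpace.Hom.const X Z) :=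
  ((h.comp_right f).comp_left g).trans (PHomotopic.of_eq fun _ => g.map_pt)

/-- A contractible space with nondegenerate base point is contractible relative to its base
point. -/
theorem pcontractible_of_contractible {X : PSpace.{u}}
    (hw : IsClosedCofibration (ContinuousMap.const PUnit.{u + 1} X.pt)) [ContractibleSpace X] :
    PContractible X := by
  obtain ⟨c, ⟨C⟩⟩ := id_nullhomotopic X
  -- Homotopy extension gives a retraction R of X × I onto X × 0 ∪ {pt} × I.
  obtain ⟨R, hR0, hR1⟩ := hw.2 {p : X × unitInterval // p.2 = 0 ∨ p.1 = X.pt} ⟨fun x => ⟨(x, 0), Or.inl rfl⟩, by fun_prop⟩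
    ⟨fun p => ⟨(X.pt, p.2), Or.inr rfl⟩, by fun_prop⟩ (fun _ => rfl)
  have hpt : ∀ t, R (X.pt, t) = ⟨(X.pt, t), Or.inr rfl⟩ := fun t => hR1 PUnit.unit t
  let e : PSpace.Hom X X := ⟨⟨fun x => (R (x, 1)).1.1, by fun_prop⟩, by simp [hpt]⟩
  -- The free contraction C runs for its full time where R(x, 1) lies in X × 0, and for the time 1 -
  -- t where R(x, 1) lies at height t over the base point. The base point itself, at height 1, does
  -- not move.
  let e' : PSpace.Hom X X := ⟨⟨fun x => C (unitInterval.symm (R (x, 1)).1.2, (R (x, 1)).1.1),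
    by fun_prop⟩, by simp [hpt]⟩
  have h1 : PHomotopic (PSpace.Hom.refl X) e := by
    refine PHomotopic.of_path (ContinuousMap.curry ⟨fun p => (R p).1.1, by fun_prop⟩) ?_ ?_ ?_
    · intro x
      simp [hR0, PSpace.Hom.refl]
    · intro x
      simp [e]
    · intro t
      simp [hpt]
  have h2 : PHomotopic e e' := by
    refine PHomotopic.of_path (ContinuousMap.curry
      ⟨fun p => C (p.2 * unitInterval.symm (R (p.1, 1)).1.2, (R (p.1, 1)).1.1),
        by fun_prop⟩) ?_ ?_ ?_
    · intro x
      simp [e]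
    · intro x
      simp [e']
    · intro t
      simp [hpt]
  have h3 : PHomotopic e' (PSpace.Hom.const X X) := by
    refine PHomotopic.of_path (ContinuousMap.curry
      ⟨fun p => C (unitInterval.symm (R (p.1, 1)).1.2 * unitInterval.symm p.2, X.pt),
        by fun_prop⟩) ?_ ?_ ?_
    · intro x
      rcases (R (x, 1)).2 with h | h
      · simp [e', h]
      · simp [e', h]
    · intro x
      simp [PSpace.Hom.const]
    · intro t
      simp [hpt]
  exact h1.trans (h2.trans h3)

/-! ### Quotients collapsing a set to the base point -/

/-- A quotient map onto a pointed space that is injective away from the base point. -/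
structure IsCollapse {Z : Type u} [TopologicalSpace Z] {P : PSpace.{u}} (p : Z → P) : Prop where
  quot : IsQuotientMap p
  inj : ∀ z z', p z = p z' → p z ≠ P.pt → z = z'

namespace IsCollapse

variable {Z : Type u} [TopologicalSpace Z] {P Q : PSpace.{u}} {p : Z → P} {q : Z → Q}

theorem exists_continuousMap (hp : IsCollapse p) {Y : Type u} [TopologicalSpace Y] (g : C(Z, Y))
    (y : Y) (hg : ∀ z, p z = P.pt → g z = y) :
    ∃ f : C(P, Y), (∀ z, f (p z) = g z) ∧ f P.pt = y := by
  have hfac : ∀ z z', p z = p z' → g z = g z' := by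
    intro z z' h
    by_cases h0 : p z = P.pt
    · rw [hg z h0, hg z' (h ▸ h0)]
    · rw [hp.inj z z' h h0]
  let p' : C(Z, P) := ⟨p, hp.quot.continuous⟩
  have hp' : IsQuotientMap p' := hp.quot
  have hl : ∀ z, hp'.lift g (fun z z' h => hfac z z' h) (p z) = g z :=
    fun z => DFunLike.congr_fun (hp'.lift_comp g fun z z' h => hfac z z' h) z
  refine ⟨hp'.lift g (fun z z' h => hfac z z' h), hl, ?_⟩
  obtain ⟨z, hz⟩ := hp.quot.surjective P.pt
  rw [← hz, hl, hg z hz]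

theorem exists_lift (hp : IsCollapse p) (g : C(Z, Q)) (hg : ∀ z, p z = P.pt → g z = Q.pt) :
    ∃ f : PSpace.Hom P Q, ∀ z, f.map (p z) = g z := by
  obtain ⟨f, hf, hpt⟩ := hp.exists_continuousMap g Q.pt hg
  exact ⟨⟨f, hpt⟩, hf⟩

theorem hom_ext (hp : IsCollapse p) {f g : PSpace.Hom P Q}
    (h : ∀ z, f.map (p z) = g.map (p z)) (x : P) : f.map x = g.map x := by
  obtain ⟨z, rfl⟩ := hp.quot.surjective x
  exact h z

theorem phomotopic (hp : IsCollapse p) {f g : PSpace.Hom P Q} (H : C(Z, C(unitInterval, Q)))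
    (h0 : ∀ z, H z 0 = f.map (p z)) (h1 : ∀ z, H z 1 = g.map (p z))
    (hpt : ∀ z, p z = P.pt → ∀ t, H z t = Q.pt) : PHomotopic f g := by
  obtain ⟨K, hK, hpt'⟩ := hp.exists_continuousMap H (ContinuousMap.const _ Q.pt)
    fun z hz => ContinuousMap.ext fun t => hpt z hz t
  refine PHomotopic.of_path K ?_ ?_ ?_
  · intro x
    obtain ⟨z, rfl⟩ := hp.quot.surjective x
    rw [hK, h0]
  · intro x
    obtain ⟨z, rfl⟩ := hp.quot.surjective x
    rw [hK, h1]
  · intro t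
    rw [hpt']
    rfl

/-- Both targets are quotients of Z by the same relation, so each map descends along the other.
Iterated quotients are identified in this way, without explicit homeomorphisms. -/
theorem phequiv (hp : IsCollapse p) (hq : IsCollapse q) (h : ∀ z, p z = P.pt ↔ q z = Q.pt) :
    PHEquiv P Q := by
  obtain ⟨f, hf⟩ := hp.exists_lift ⟨q, hq.quot.continuous⟩ fun z hz => (h z).1 hz
  obtain ⟨g, hg⟩ := hq.exists_lift ⟨p, hp.quot.continuous⟩ fun z hz => (h z).2 hz
  refine PHEquiv.of_inverse f g (fun x => ?_) fun x => ?_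
  · obtain ⟨z, rfl⟩ := hp.quot.surjective x
    rw [hf]
    exact hg z
  · obtain ⟨z, rfl⟩ := hq.quot.surjective x
    rw [hg]
    exact hf z

end IsCollapse

/-- The quotient map onto `collapse X A`. -/
def collapseMk (X : PSpace.{u}) (A : Set X) (x : X) : collapse X A := Quotient.mk _ x

theorem isCollapse_collapseMk (X : PSpace.{u}) (A : Set X) : IsCollapse (collapseMk X A) where
  quot := isQuotientMap_quotient_mk'
  inj z z' h h0 := by
    rcases Quotient.exact h with h1 | h1
    · exact h1
    · exact absurd (Quotient.sound (Or.inr ⟨h1.1, Set.mem_insert _ _⟩)) h0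

theorem collapseMk_eq_pt {X : PSpace.{u}} {A : Set X} {x : X} :
    collapseMk X A x = (collapse X A).pt ↔ x = X.pt ∨ x ∈ A := by
  constructor
  · intro h
    rcases Quotient.exact h with h1 | h1
    · exact Or.inl h1
    · exact h1.1
  · intro h
    exact Quotient.sound (Or.inr ⟨h, Set.mem_insert _ _⟩)

theorem collapse_empty (X : PSpace.{u}) {A : Set X} (hA : A = ∅) : PHEquiv (collapse X A) X := by
  refine (isCollapse_collapseMk X A).phequiv (q := id) ⟨IsQuotientMap.id, fun _ _ h _ => h⟩
    fun z => collapseMk_eq_pt.trans ?_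
  simp [hA]

/-! ### Smash products and wedges -/

/-- The quotient map onto the smash product. -/
def smashMk (X Y : PSpace.{u}) (z : X × Y) : smash X Y :=
  collapseMk ⟨X × Y, (X.pt, Y.pt)⟩ {p | p.1 = X.pt ∨ p.2 = Y.pt} z

theorem isCollapse_smashMk (X Y : PSpace.{u}) : IsCollapse (smashMk X Y) :=
  isCollapse_collapseMk ⟨X × Y, (X.pt, Y.pt)⟩ {p | p.1 = X.pt ∨ p.2 = Y.pt}

theorem smashMk_eq_pt {X Y : PSpace.{u}} {z : X × Y} :
    smashMk X Y z = (smash X Y).pt ↔ z.1 = X.pt ∨ z.2 = Y.pt := by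
  refine collapseMk_eq_pt.trans ⟨?_, Or.inr⟩
  rintro (rfl | h)
  · exact Or.inl rfl
  · exact h

theorem exists_smash_map {X Y X' Y' : PSpace.{u}} (f : PSpace.Hom X X') (g : PSpace.Hom Y Y') :
    ∃ k : PSpace.Hom (smash X Y) (smash X' Y'),
      ∀ z, k.map (smashMk X Y z) = smashMk X' Y' (f.map z.1, g.map z.2) := by
  have hc := (isCollapse_smashMk X' Y').quot.continuous
  refine (isCollapse_smashMk X Y).exists_lift ⟨fun z => smashMk X' Y' (f.map z.1, g.map z.2),
    by fun_prop⟩ fun z hz => smashMk_eq_pt.2 ?_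
  rcases smashMk_eq_pt.1 hz with h | h
  · exact Or.inl (by rw [h, f.map_pt])
  · exact Or.inr (by rw [h, g.map_pt])

theorem phomotopic_smash {X Y X' Y' : PSpace.{u}} {f f' : PSpace.Hom X X'}
    {g g' : PSpace.Hom Y Y'} (hf : PHomotopic f f') (hg : PHomotopic g g')
    {k k' : PSpace.Hom (smash X Y) (smash X' Y')}
    (hk : ∀ z, k.map (smashMk X Y z) = smashMk X' Y' (f.map z.1, g.map z.2))
    (hk' : ∀ z, k'.map (smashMk X Y z) = smashMk X' Y' (f'.map z.1, g'.map z.2)) :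
    PHomotopic k k' := by
  obtain ⟨H, H0, H1, Hp⟩ := hf.exists_path
  obtain ⟨K, K0, K1, Kp⟩ := hg.exists_path
  have hc := (isCollapse_smashMk X' Y').quot.continuous
  refine (isCollapse_smashMk X Y).phomotopic
    (ContinuousMap.curry ⟨fun p => smashMk X' Y' (H p.1.1 p.2, K p.1.2 p.2), by fun_prop⟩) ?_ ?_ ?_
  · intro z
    simp [hk, H0, K0]
  · intro z
    simp [hk', H1, K1]
  · intro z hz t
    refine smashMk_eq_pt.2 ?_
    rcases smashMk_eq_pt.1 hz with h | h
    · exact Or.inl (by simp [h, Hp])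
    · exact Or.inr (by simp [h, Kp])

theorem PHEquiv.smash {X Y X' Y' : PSpace.{u}} (h : PHEquiv X X') (h' : PHEquiv Y Y') :
    PHEquiv (smash X Y) (smash X' Y') := by
  obtain ⟨f, g, h1, h2⟩ := h.elim
  obtain ⟨f', g', h1', h2'⟩ := h'.elim
  obtain ⟨k, hk⟩ := exists_smash_map f f'
  obtain ⟨k', hk'⟩ := exists_smash_map g g'
  refine PHEquiv.intro k k' ?_ ?_
  · refine phomotopic_smash h1 h1' (fun z => ?_) fun z => rfl
    exact (congrArg k'.map (hk z)).trans (hk' _)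
  · refine phomotopic_smash h2 h2' (fun z => ?_) fun z => rfl
    exact (congrArg k.map (hk' z)).trans (hk _)

theorem PContractible.smash_left {X : PSpace.{u}} (h : PContractible X) (Y : PSpace.{u}) :
    PContractible (smash X Y) := by
  refine phomotopic_smash h (PHomotopic.refl (PSpace.Hom.refl Y)) (fun z => rfl) fun z => ?_
  exact (smashMk_eq_pt.2 (Or.inl rfl)).symm

/-- The quotient map onto the wedge. -/
def wedgeMk {ι : Type} (X : ι → PSpace.{u}) (z : PUnit.{u + 1} ⊕ (Σ i, X i)) : wedge X :=
  collapseMk ⟨PUnit.{u + 1} ⊕ (Σ i, X i), Sum.inl PUnit.unit⟩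
    (Set.range fun i => Sum.inr ⟨i, (X i).pt⟩) z

theorem isCollapse_wedgeMk {ι : Type} (X : ι → PSpace.{u}) : IsCollapse (wedgeMk X) :=
  isCollapse_collapseMk ⟨PUnit.{u + 1} ⊕ (Σ i, X i), Sum.inl PUnit.unit⟩
    (Set.range fun i => Sum.inr ⟨i, (X i).pt⟩)

theorem wedgeMk_inr_eq_pt {ι : Type} {X : ι → PSpace.{u}} {i : ι} {x : X i} :
    wedgeMk X (Sum.inr ⟨i, x⟩) = (wedge X).pt ↔ x = (X i).pt := by
  refine collapseMk_eq_pt.trans ⟨?_, ?_⟩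
  · rintro (h | ⟨j, h⟩)
    · cases h
    · cases h
      rfl
  · rintro rfl
    exact Or.inr ⟨i, rfl⟩

/-- The point of the wedge given by a point of a summand. -/
def wedgeIn {ι : Type} (X : ι → PSpace.{u}) (i : ι) (x : X i) : wedge X :=
  wedgeMk X (Sum.inr ⟨i, x⟩)

theorem wedgeIn_pt {ι : Type} (X : ι → PSpace.{u}) (i : ι) :
    wedgeIn X i (X i).pt = (wedge X).pt :=
  wedgeMk_inr_eq_pt.2 rfl

theorem continuous_wedgeIn {ι : Type} (X : ι → PSpace.{u}) (i : ι) :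
    Continuous (wedgeIn X i) :=
  (isCollapse_wedgeMk X).quot.continuous.comp (continuous_inr.comp continuous_sigmaMk)

theorem wedge_cases {ι : Type} {X : ι → PSpace.{u}} (z : wedge X) :
    z = (wedge X).pt ∨ ∃ i x, z = wedgeIn X i x := by
  obtain ⟨z | ⟨i, x⟩, rfl⟩ := (isCollapse_wedgeMk X).quot.surjective z
  · exact Or.inl rfl
  · exact Or.inr ⟨i, x, rfl⟩

theorem exists_wedge_continuousMap {ι : Type} {X : ι → PSpace.{u}} {Y : Type u}
    [TopologicalSpace Y] (y : Y) (f : ∀ i, C(X i, Y)) (hf : ∀ i, f i (X i).pt = y) :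
    ∃ k : C(wedge X, Y), (∀ i x, k (wedgeIn X i x) = f i x) ∧ k (wedge X).pt = y := by
  obtain ⟨k, hk, hk'⟩ := (isCollapse_wedgeMk X).exists_continuousMap
    (⟨Sum.elim (fun _ => y) (fun p => f p.1 p.2), by
      refine continuous_sum_dom.2 ⟨continuous_const, ?_⟩
      exact continuous_sigma fun i => (f i).continuous⟩) y (by
      rintro (z | ⟨i, x⟩) hz
      · rfl
      · rw [wedgeMk_inr_eq_pt.1 hz]
        exact hf i)
  exact ⟨k, fun i x => hk (Sum.inr ⟨i, x⟩), hk'⟩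

theorem exists_wedge_lift {ι : Type} {X : ι → PSpace.{u}} {Q : PSpace.{u}}
    (f : ∀ i, PSpace.Hom (X i) Q) :
    ∃ k : PSpace.Hom (wedge X) Q, ∀ i x, k.map (wedgeIn X i x) = (f i).map x := by
  obtain ⟨k, hk, hk'⟩ := exists_wedge_continuousMap Q.pt (fun i => (f i).map)
    fun i => (f i).map_pt
  exact ⟨⟨k, hk'⟩, hk⟩

theorem wedge_ext {ι : Type} {X : ι → PSpace.{u}} {Q : PSpace.{u}}
    {f g : PSpace.Hom (wedge X) Q}
    (h : ∀ i x, f.map (wedgeIn X i x) = g.map (wedgeIn X i x)) (z : wedge X) :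
    f.map z = g.map z := by
  rcases wedge_cases z with rfl | ⟨i, x, rfl⟩
  · exact f.map_pt.trans g.map_pt.symm
  · exact h i x

theorem phomotopic_wedge {ι : Type} {X : ι → PSpace.{u}} {Q : PSpace.{u}}
    {f g : PSpace.Hom (wedge X) Q} {f' g' : ∀ i, PSpace.Hom (X i) Q}
    (hf : ∀ i x, f.map (wedgeIn X i x) = (f' i).map x)
    (hg : ∀ i x, g.map (wedgeIn X i x) = (g' i).map x)
    (h : ∀ i, PHomotopic (f' i) (g' i)) : PHomotopic f g := by
  choose H H0 H1 Hp using fun i => (h i).exists_path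
  obtain ⟨K, hK, hKt⟩ := exists_wedge_continuousMap (ContinuousMap.const unitInterval Q.pt) H
    fun i => ContinuousMap.ext (Hp i)
  refine PHomotopic.of_path K ?_ ?_ fun t => by rw [hKt]; rfl
  · intro z
    rcases wedge_cases z with rfl | ⟨i, x, rfl⟩
    · rw [hKt, f.map_pt]
      rfl
    · rw [hK, H0, hf]
  · intro z
    rcases wedge_cases z with rfl | ⟨i, x, rfl⟩
    · rw [hKt, g.map_pt]
      rfl
    · rw [hK, H1, hg]

/-- The inclusion of a summand of a wedge. -/
def wedgeInHom {ι : Type} (X : ι → PSpace.{u}) (i : ι) : PSpace.Hom (X i) (wedge X) :=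
  ⟨⟨wedgeIn X i, continuous_wedgeIn X i⟩, wedgeIn_pt X i⟩

theorem PHEquiv.wedge {ι : Type} {X Y : ι → PSpace.{u}} (h : ∀ i, PHEquiv (X i) (Y i)) :
    PHEquiv (wedge X) (wedge Y) := by
  choose f g h1 h2 using fun i => (h i).elim
  obtain ⟨k, hk⟩ := exists_wedge_lift fun i => (wedgeInHom Y i).comp (f i)
  obtain ⟨k', hk'⟩ := exists_wedge_lift fun i => (wedgeInHom X i).comp (g i)
  refine PHEquiv.intro k k' ?_ ?_
  · refine phomotopic_wedge (f' := fun i => (wedgeInHom X i).comp ((g i).comp (f i)))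
      (g' := fun i => wedgeInHom X i) (fun i x => ?_) (fun _ _ => rfl)
      fun i => ((h1 i).comp_left _)
    exact (congrArg k'.map (hk i x)).trans (hk' i _)
  · refine phomotopic_wedge (f' := fun i => (wedgeInHom Y i).comp ((f i).comp (g i)))
      (g' := fun i => wedgeInHom Y i) (fun i x => ?_) (fun _ _ => rfl)
      fun i => ((h2 i).comp_left _)
    exact (congrArg k.map (hk' i x)).trans (hk i _)

theorem wedge_reindex {ι κ : Type} (e : ι ≃ κ) (X : κ → PSpace.{u}) :
    PHEquiv (wedge fun i => X (e i)) (wedge X) := by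
  obtain ⟨k, hk⟩ := exists_wedge_lift fun i => wedgeInHom X (e i)
  -- The inverse sends the summand `j` to the summand `e.symm j`, whose space equals `X j` only
  -- propositionally; heterogeneous equality takes the place of casts.
  have hc : ∀ j (i : ι) (h : e i = j), ∃ f : PSpace.Hom (X j) (wedge fun i => X (e i)),
      ∀ x, k.map (f.map x) = wedgeIn X j x ∧
        ∀ y : X (e i), HEq y x → f.map x = wedgeIn (fun i => X (e i)) i y := by
    rintro j i rfl
    refine ⟨wedgeInHom (fun i => X (e i)) i, fun x => ⟨hk i x, fun y h => ?_⟩⟩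
    rw [eq_of_heq h]
    rfl
  choose f hf using fun j => hc j (e.symm j) (e.apply_symm_apply j)
  obtain ⟨k', hk'⟩ := exists_wedge_lift f
  refine PHEquiv.of_inverse k k' (wedge_ext (f := k'.comp k) (g := PSpace.Hom.refl _) ?_)
    (wedge_ext (f := k.comp k') (g := PSpace.Hom.refl _) ?_)
  · intro i x
    refine (congrArg k'.map (hk i x)).trans ((hk' _ _).trans ?_)
    have key : ∀ (i' : ι) (h : i' = i) (y : X (e i')), HEq y x →
        wedgeIn (fun i => X (e i)) i' y = wedgeIn (fun i => X (e i)) i x := by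
      rintro i' rfl y hy
      rw [eq_of_heq hy]
    obtain ⟨y, hy⟩ : ∃ y : X (e (e.symm (e i))), HEq y x := by
      rw [e.symm_apply_apply]
      exact ⟨x, HEq.rfl⟩
    exact ((hf (e i) x).2 y hy).trans (key _ (e.symm_apply_apply i) y hy)
  · intro j x
    exact (congrArg k.map (hk' j x)).trans (hf j x).1

theorem pcontractible_wedge_of_isEmpty {ι : Type} [IsEmpty ι] (X : ι → PSpace.{u}) :
    PContractible (wedge X) :=
  PHomotopic.of_eq (wedge_ext (g := PSpace.Hom.const _ _) fun i => isEmptyElim i)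

theorem wedge_unit (X : PSpace.{u}) : PHEquiv (wedge fun _ : Unit => X) X := by
  obtain ⟨k, hk⟩ := exists_wedge_lift fun _ : Unit => PSpace.Hom.refl X
  exact PHEquiv.of_inverse k (wedgeInHom (fun _ : Unit => X) ())
    (wedge_ext (f := (wedgeInHom (fun _ : Unit => X) ()).comp k) (g := PSpace.Hom.refl _)
      fun i x => congrArg (wedgeIn _ ()) (hk i x)) fun x => hk () x

/-! ### Binary wedges and reduced suspensions -/

/-- The binary wedge. -/
def bwedge (X V : PSpace.{u}) : PSpace.{u} :=
  collapse ⟨X ⊕ V, Sum.inl X.pt⟩ {Sum.inr V.pt}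

/-- The quotient map onto the binary wedge. -/
def bwedgeMk (X V : PSpace.{u}) (z : X ⊕ V) : bwedge X V :=
  collapseMk ⟨X ⊕ V, Sum.inl X.pt⟩ {Sum.inr V.pt} z

theorem isCollapse_bwedgeMk (X V : PSpace.{u}) : IsCollapse (bwedgeMk X V) :=
  isCollapse_collapseMk ⟨X ⊕ V, Sum.inl X.pt⟩ {Sum.inr V.pt}

theorem bwedgeMk_eq_pt {X V : PSpace.{u}} {z : X ⊕ V} :
    bwedgeMk X V z = (bwedge X V).pt ↔ z = Sum.inl X.pt ∨ z = Sum.inr V.pt :=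
  collapseMk_eq_pt

theorem exists_bwedge_continuousMap {X V : PSpace.{u}} {Y : Type u} [TopologicalSpace Y]
    (f : C(X, Y)) (g : C(V, Y)) (h : f X.pt = g V.pt) :
    ∃ k : C(bwedge X V, Y), (∀ x, k (bwedgeMk X V (Sum.inl x)) = f x) ∧
      (∀ x, k (bwedgeMk X V (Sum.inr x)) = g x) ∧ k (bwedge X V).pt = f X.pt := by
  obtain ⟨k, hk, hk'⟩ := (isCollapse_bwedgeMk X V).exists_continuousMap
    (⟨Sum.elim f g, by fun_prop⟩) (f X.pt) (by
      intro z hz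
      rcases bwedgeMk_eq_pt.1 hz with rfl | rfl
      · rfl
      · exact h.symm)
  exact ⟨k, fun x => hk _, fun x => hk _, hk'⟩

theorem exists_bwedge_lift {X V Q : PSpace.{u}} (f : PSpace.Hom X Q) (g : PSpace.Hom V Q) :
    ∃ k : PSpace.Hom (bwedge X V) Q, (∀ x, k.map (bwedgeMk X V (Sum.inl x)) = f.map x) ∧
      ∀ x, k.map (bwedgeMk X V (Sum.inr x)) = g.map x := by
  obtain ⟨k, h1, h2, h3⟩ := exists_bwedge_continuousMap f.map g.map (f.map_pt.trans g.map_pt.symm)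
  exact ⟨⟨k, h3.trans f.map_pt⟩, h1, h2⟩

/-- The inclusion of the first summand. -/
def bwedgeInl (X V : PSpace.{u}) : PSpace.Hom X (bwedge X V) :=
  ⟨⟨fun x => bwedgeMk X V (Sum.inl x),
    (isCollapse_bwedgeMk X V).quot.continuous.comp continuous_inl⟩, rfl⟩

/-- The inclusion of the second summand. -/
def bwedgeInr (X V : PSpace.{u}) : PSpace.Hom V (bwedge X V) :=
  ⟨⟨fun x => bwedgeMk X V (Sum.inr x),
    (isCollapse_bwedgeMk X V).quot.continuous.comp continuous_inr⟩, bwedgeMk_eq_pt.2 (Or.inr rfl)⟩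

theorem bwedge_ext {X V Q : PSpace.{u}} {f g : PSpace.Hom (bwedge X V) Q}
    (h : ∀ x, f.map (bwedgeMk X V (Sum.inl x)) = g.map (bwedgeMk X V (Sum.inl x)))
    (h' : ∀ x, f.map (bwedgeMk X V (Sum.inr x)) = g.map (bwedgeMk X V (Sum.inr x)))
    (z : bwedge X V) : f.map z = g.map z := by
  refine (isCollapse_bwedgeMk X V).hom_ext ?_ z
  rintro (x | x)
  · exact h x
  · exact h' x

theorem phomotopic_bwedge {X V Q : PSpace.{u}} {f g : PSpace.Hom (bwedge X V) Q}
    (h : PHomotopic (f.comp (bwedgeInl X V)) (g.comp (bwedgeInl X V)))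
    (h' : PHomotopic (f.comp (bwedgeInr X V)) (g.comp (bwedgeInr X V))) : PHomotopic f g := by
  obtain ⟨H, H0, H1, Hp⟩ := h.exists_path
  obtain ⟨K, K0, K1, Kp⟩ := h'.exists_path
  refine (isCollapse_bwedgeMk X V).phomotopic ⟨Sum.elim H K, by fun_prop⟩ ?_ ?_ ?_
  · rintro (x | x)
    · exact H0 x
    · exact K0 x
  · rintro (x | x)
    · exact H1 x
    · exact K1 x
  · intro z hz t
    rcases bwedgeMk_eq_pt.1 hz with rfl | rfl
    · exact Hp t
    · exact Kp t

theorem PHEquiv.bwedge {X V X' V' : PSpace.{u}} (h : PHEquiv X X') (h' : PHEquiv V V') :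
    PHEquiv (bwedge X V) (bwedge X' V') := by
  obtain ⟨f, g, h1, h2⟩ := h.elim
  obtain ⟨f', g', h1', h2'⟩ := h'.elim
  obtain ⟨k, hk, hk'⟩ := exists_bwedge_lift ((bwedgeInl X' V').comp f) ((bwedgeInr X' V').comp f')
  obtain ⟨l, hl, hl'⟩ := exists_bwedge_lift ((bwedgeInl X V).comp g) ((bwedgeInr X V).comp g')
  refine PHEquiv.intro k l (phomotopic_bwedge ?_ ?_) (phomotopic_bwedge ?_ ?_)
  · exact (PHomotopic.of_eq fun x => (congrArg l.map (hk x)).trans (hl _)).trans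
      (h1.comp_left (bwedgeInl X V))
  · exact (PHomotopic.of_eq fun x => (congrArg l.map (hk' x)).trans (hl' _)).trans
      (h1'.comp_left (bwedgeInr X V))
  · exact (PHomotopic.of_eq fun x => (congrArg k.map (hl x)).trans (hk _)).trans
      (h2.comp_left (bwedgeInl X' V'))
  · exact (PHomotopic.of_eq fun x => (congrArg k.map (hl' x)).trans (hk' _)).trans
      (h2'.comp_left (bwedgeInr X' V'))

theorem bwedge_of_pcontractible (X : PSpace.{u}) {V : PSpace.{u}} (h : PContractible V) :
    PHEquiv (bwedge X V) X := by
  obtain ⟨k, hk, hk'⟩ := exists_bwedge_lift (PSpace.Hom.refl X) (PSpace.Hom.const V X)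
  refine PHEquiv.intro k (bwedgeInl X V) (phomotopic_bwedge ?_ ?_) (PHomotopic.of_eq hk)
  · exact PHomotopic.of_eq fun x => congrArg (bwedgeInl X V).map (hk x)
  · refine (PHomotopic.of_eq fun x => ?_).trans (h.symm.comp_left (bwedgeInr X V))
    exact (congrArg (bwedgeInl X V).map (hk' x)).trans (bwedgeInr X V).map_pt.symm

theorem bwedge_wedge {ι κ : Type} (X : ι → PSpace.{u}) (Y : κ → PSpace.{u}) :
    PHEquiv (bwedge (wedge X) (wedge Y)) (wedge (Sum.elim X Y)) := by
  obtain ⟨f, hf⟩ := exists_wedge_lift fun i => wedgeInHom (Sum.elim X Y) (Sum.inl i)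
  obtain ⟨g, hg⟩ := exists_wedge_lift fun i => wedgeInHom (Sum.elim X Y) (Sum.inr i)
  obtain ⟨k, hk, hk'⟩ := exists_bwedge_lift f g
  obtain ⟨l, hl⟩ := exists_wedge_lift (X := Sum.elim X Y) (Q := bwedge (wedge X) (wedge Y))
    (Sum.rec (fun i => (bwedgeInl _ _).comp (wedgeInHom X i))
      fun i => (bwedgeInr _ _).comp (wedgeInHom Y i))
  refine PHEquiv.of_inverse k l
    (bwedge_ext (f := l.comp k) (g := PSpace.Hom.refl _) (fun x => ?_) fun x => ?_)
    (wedge_ext (f := k.comp l) (g := PSpace.Hom.refl _) ?_)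
  · refine (congrArg l.map (hk x)).trans (wedge_ext (f := l.comp f) (g := bwedgeInl _ _) ?_ x)
    exact fun i x => (congrArg l.map (hf i x)).trans (hl (Sum.inl i) x)
  · refine (congrArg l.map (hk' x)).trans (wedge_ext (f := l.comp g) (g := bwedgeInr _ _) ?_ x)
    exact fun i x => (congrArg l.map (hg i x)).trans (hl (Sum.inr i) x)
  · rintro (i | i) x
    · exact (congrArg k.map (hl (Sum.inl i) x)).trans ((hk _).trans (hf i x))
    · exact (congrArg k.map (hl (Sum.inr i) x)).trans ((hk' _).trans (hg i x))

/-- The reduced suspension. -/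
def susp (A : PSpace.{u}) : PSpace.{u} :=
  collapse ⟨A × unitInterval, (A.pt, 0)⟩ {p | p.1 = A.pt ∨ p.2 = 0 ∨ p.2 = 1}

/-- The quotient map onto the reduced suspension. -/
def suspMk (A : PSpace.{u}) (z : A × unitInterval) : susp A :=
  collapseMk ⟨A × unitInterval, (A.pt, 0)⟩ {p | p.1 = A.pt ∨ p.2 = 0 ∨ p.2 = 1} z

theorem isCollapse_suspMk (A : PSpace.{u}) : IsCollapse (suspMk A) :=
  isCollapse_collapseMk ⟨A × unitInterval, (A.pt, 0)⟩ {p | p.1 = A.pt ∨ p.2 = 0 ∨ p.2 = 1}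

theorem suspMk_eq_pt {A : PSpace.{u}} {z : A × unitInterval} :
    suspMk A z = (susp A).pt ↔ z.1 = A.pt ∨ z.2 = 0 ∨ z.2 = 1 := by
  refine collapseMk_eq_pt.trans ⟨?_, Or.inr⟩
  rintro (rfl | h)
  · exact Or.inl rfl
  · exact h

theorem exists_susp_map {A B : PSpace.{u}} (f : PSpace.Hom A B) :
    ∃ k : PSpace.Hom (susp A) (susp B), ∀ z, k.map (suspMk A z) = suspMk B (f.map z.1, z.2) := by
  have hc := (isCollapse_suspMk B).quot.continuous
  refine (isCollapse_suspMk A).exists_lift ⟨fun z => suspMk B (f.map z.1, z.2), by fun_prop⟩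
    fun z hz => suspMk_eq_pt.2 ?_
  rcases suspMk_eq_pt.1 hz with h | h
  · exact Or.inl (by rw [h, f.map_pt])
  · exact Or.inr h

theorem phomotopic_susp {A B : PSpace.{u}} {f g : PSpace.Hom A B} (h : PHomotopic f g)
    {k l : PSpace.Hom (susp A) (susp B)}
    (hk : ∀ z, k.map (suspMk A z) = suspMk B (f.map z.1, z.2))
    (hl : ∀ z, l.map (suspMk A z) = suspMk B (g.map z.1, z.2)) : PHomotopic k l := by
  obtain ⟨H, H0, H1, Hp⟩ := h.exists_path
  have hc := (isCollapse_suspMk B).quot.continuous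
  refine (isCollapse_suspMk A).phomotopic
    (ContinuousMap.curry ⟨fun p => suspMk B (H p.1.1 p.2, p.1.2), by fun_prop⟩) ?_ ?_ ?_
  · intro z
    simp [hk, H0]
  · intro z
    simp [hl, H1]
  · intro z hz t
    refine suspMk_eq_pt.2 ?_
    rcases suspMk_eq_pt.1 hz with h | h
    · exact Or.inl (by simp [h, Hp])
    · exact Or.inr h

theorem PHEquiv.susp {A B : PSpace.{u}} (h : PHEquiv A B) : PHEquiv (susp A) (susp B) := by
  obtain ⟨f, g, h1, h2⟩ := h.elim
  obtain ⟨k, hk⟩ := exists_susp_map f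
  obtain ⟨l, hl⟩ := exists_susp_map g
  refine PHEquiv.intro k l (phomotopic_susp h1 (fun z => ?_) fun z => rfl)
    (phomotopic_susp h2 (fun z => ?_) fun z => rfl)
  · exact (congrArg l.map (hk z)).trans (hl _)
  · exact (congrArg k.map (hl z)).trans (hk _)

theorem PContractible.susp {A : PSpace.{u}} (h : PContractible A) : PContractible (susp A) :=
  phomotopic_susp h (fun _ => rfl) fun _ => (suspMk_eq_pt.2 (Or.inl rfl)).symm

/-- A set is open if and only if its membership predicate is continuous into `Prop`. As `K` is
locally compact, continuity of this predicate descends along the product of `f` with the identity.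
-/
theorem IsQuotientMap.prod_left {X Y : Type u} [TopologicalSpace X] [TopologicalSpace Y]
    {f : X → Y} (hf : IsQuotientMap f) (K : Type*) [TopologicalSpace K] [LocallyCompactSpace K] :
    IsQuotientMap (fun p : X × K => (f p.1, p.2)) := by
  have hc : Continuous (fun p : X × K => (f p.1, p.2)) := by
    have := hf.continuous
    fun_prop
  refine (isQuotientMap_iff _).2 ⟨isCoinducing_iff.2 fun s =>
    ⟨fun h => ?_, fun h => h.preimage hc⟩, fun ⟨y, k⟩ => ?_⟩
  rotate_left
  · obtain ⟨x, rfl⟩ := hf.surjective y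
    exact ⟨(x, k), rfl⟩
  · have : Continuous (fun p : Y × K => (p ∈ s : Prop)) := by
      refine hf.continuous_lift_prod_left ?_
      exact continuous_Prop.2 h
    exact continuous_Prop.1 this

theorem susp_wedge {ι : Type} (X : ι → PSpace.{u}) :
    PHEquiv (susp (wedge X)) (wedge fun i => susp (X i)) := by
  choose f hf using fun i => exists_susp_map (wedgeInHom X i)
  obtain ⟨k, hk⟩ := exists_wedge_lift f
  obtain ⟨l, hl, hl'⟩ := exists_wedge_continuousMap
    (Y := C(unitInterval, wedge fun i => susp (X i))) (ContinuousMap.const _ (wedge _).pt)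
    (fun i => ContinuousMap.curry ⟨fun z => wedgeIn (fun i => susp (X i)) i (suspMk (X i) z),
      (continuous_wedgeIn _ i).comp (isCollapse_suspMk (X i)).quot.continuous⟩) (fun i => by
      ext t
      exact (congrArg (wedgeIn _ i) (suspMk_eq_pt.2 (Or.inl rfl))).trans (wedgeIn_pt _ i))
  have hc : Continuous fun z : wedge X × unitInterval => l z.1 z.2 :=
    ContinuousMap.continuous_uncurry_of_continuous l
  obtain ⟨m, hm⟩ := (isCollapse_suspMk (wedge X)).exists_lift ⟨_, hc⟩ (by
    rintro ⟨z, t⟩ hz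
    rcases wedge_cases z with rfl | ⟨i, x, rfl⟩
    · exact DFunLike.congr_fun hl' t
    · refine (DFunLike.congr_fun (hl i x) t).trans ?_
      have : suspMk (X i) (x, t) = (susp (X i)).pt := by
        refine suspMk_eq_pt.2 ?_
        rcases suspMk_eq_pt.1 hz with h | h
        · exact Or.inl (wedgeMk_inr_eq_pt.1 h)
        · exact Or.inr h
      exact (congrArg (wedgeIn _ i) this).trans (wedgeIn_pt _ i))
  have hml : ∀ i x t, m.map (suspMk _ (wedgeIn X i x, t)) =
      wedgeIn (fun i => susp (X i)) i (suspMk (X i) (x, t)) :=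
    fun i x t => (hm _).trans (DFunLike.congr_fun (hl i x) t)
  refine PHEquiv.of_inverse m k
    ((isCollapse_suspMk _).hom_ext (f := k.comp m) (g := PSpace.Hom.refl _) ?_)
    (wedge_ext (f := m.comp k) (g := PSpace.Hom.refl _) fun i => ?_)
  · rintro ⟨z, t⟩
    rcases wedge_cases z with rfl | ⟨i, x, rfl⟩
    · have : suspMk (wedge X) ((wedge X).pt, t) = (susp (wedge X)).pt :=
        suspMk_eq_pt.2 (Or.inl rfl)
      rw [this]
      exact (k.comp m).map_pt
    · exact (congrArg k.map (hml i x t)).trans ((hk i _).trans (hf i _))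
  · refine (isCollapse_suspMk _).hom_ext
      (f := (m.comp k).comp (wedgeInHom (fun i => susp (X i)) i))
      (g := wedgeInHom (fun i => susp (X i)) i) fun z => ?_
    exact (congrArg m.map ((hk i _).trans (hf i z))).trans (hml i z.1 z.2)

/-! ### Reduced mapping cones -/

/-- The identifications of the reduced mapping cone. -/
inductive ConeRel {A X : PSpace.{u}} (i : PSpace.Hom A X) :
    X ⊕ A × unitInterval → X ⊕ A × unitInterval → Prop
  | glue (a : A) : ConeRel i (Sum.inr (a, 0)) (Sum.inl (i.map a))
  | apex (a : A) : ConeRel i (Sum.inr (a, 1)) (Sum.inl X.pt)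
  | base (t : unitInterval) : ConeRel i (Sum.inr (A.pt, t)) (Sum.inl X.pt)

/-- The reduced mapping cone. -/
def cone {A X : PSpace.{u}} (i : PSpace.Hom A X) : PSpace.{u} :=
  ⟨Quot (ConeRel i), Quot.mk _ (Sum.inl X.pt)⟩

section Cone

variable {A X : PSpace.{u}} (i : PSpace.Hom A X)

/-- The inclusion of the target in the mapping cone. -/
def coneInl : PSpace.Hom X (cone i) :=
  ⟨⟨fun x => Quot.mk _ (Sum.inl x), continuous_quot_mk.comp continuous_inl⟩, rfl⟩

/-- The points of the mapping cone on the cone of the source. -/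
def coneInr : C(A × unitInterval, cone i) :=
  ⟨fun z => Quot.mk _ (Sum.inr z), continuous_quot_mk.comp continuous_inr⟩

theorem coneInr_zero (a : A) : coneInr i (a, 0) = (coneInl i).map (i.map a) :=
  Quot.sound (ConeRel.glue a)

theorem coneInr_one (a : A) : coneInr i (a, 1) = (cone i).pt := Quot.sound (ConeRel.apex a)

theorem coneInr_pt (t : unitInterval) : coneInr i (A.pt, t) = (cone i).pt :=
  Quot.sound (ConeRel.base t)

variable {i}

theorem cone_cases (z : cone i) :
    (∃ x, z = (coneInl i).map x) ∨ ∃ a t, z = coneInr i (a, t) := by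
  induction z using Quot.inductionOn with
  | h z =>
    rcases z with x | ⟨a, t⟩
    · exact Or.inl ⟨x, rfl⟩
    · exact Or.inr ⟨a, t, rfl⟩

theorem exists_cone_continuousMap {Y : Type u} [TopologicalSpace Y] (f : C(X, Y))
    (g : C(A × unitInterval, Y)) (h0 : ∀ a, g (a, 0) = f (i.map a))
    (h1 : ∀ a, g (a, 1) = f X.pt) (hp : ∀ t, g (A.pt, t) = f X.pt) :
    ∃ k : C(cone i, Y), (∀ x, k ((coneInl i).map x) = f x) ∧ ∀ z, k (coneInr i z) = g z := by
  refine ⟨⟨Quot.lift (Sum.elim f g) ?_, continuous_quot_lift _ (by fun_prop)⟩,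
    fun x => rfl, fun z => rfl⟩
  rintro _ _ (a | a | t)
  · exact h0 a
  · exact h1 a
  · exact hp t

theorem exists_cone_lift {Q : PSpace.{u}} (f : PSpace.Hom X Q)
    (g : C(A × unitInterval, Q)) (h0 : ∀ a, g (a, 0) = f.map (i.map a))
    (h1 : ∀ a, g (a, 1) = Q.pt) (hp : ∀ t, g (A.pt, t) = Q.pt) :
    ∃ k : PSpace.Hom (cone i) Q, (∀ x, k.map ((coneInl i).map x) = f.map x) ∧
      ∀ z, k.map (coneInr i z) = g z := by
  obtain ⟨k, hk, hk'⟩ := exists_cone_continuousMap f.map g h0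
    (fun a => (h1 a).trans f.map_pt.symm) fun t => (hp t).trans f.map_pt.symm
  exact ⟨⟨k, (hk X.pt).trans f.map_pt⟩, hk, hk'⟩

theorem phomotopic_cone {Q : PSpace.{u}} {f g : PSpace.Hom (cone i) Q}
    (H : C(X, C(unitInterval, Q))) (K : C(A × unitInterval, C(unitInterval, Q)))
    (H0 : ∀ x, H x 0 = f.map ((coneInl i).map x)) (H1 : ∀ x, H x 1 = g.map ((coneInl i).map x))
    (Hp : ∀ t, H X.pt t = Q.pt)
    (K0 : ∀ z, K z 0 = f.map (coneInr i z)) (K1 : ∀ z, K z 1 = g.map (coneInr i z))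
    (h0 : ∀ a t, K (a, 0) t = H (i.map a) t) (h1 : ∀ a t, K (a, 1) t = Q.pt)
    (hp : ∀ s t, K (A.pt, s) t = Q.pt) : PHomotopic f g := by
  obtain ⟨k, hk, hk'⟩ := exists_cone_continuousMap (i := i) H K
    (fun a => ContinuousMap.ext (h0 a))
    (fun a => ContinuousMap.ext fun t => (h1 a t).trans (Hp t).symm)
    (fun s => ContinuousMap.ext fun t => (hp s t).trans (Hp t).symm)
  refine PHomotopic.of_path k ?_ ?_ fun t => ?_
  · intro z
    rcases cone_cases z with ⟨x, rfl⟩ | ⟨a, s, rfl⟩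
    · rw [hk, H0]
    · rw [hk', K0]
  · intro z
    rcases cone_cases z with ⟨x, rfl⟩ | ⟨a, s, rfl⟩
    · rw [hk, H1]
    · rw [hk', K1]
  · exact (DFunLike.congr_fun (hk X.pt) t).trans (Hp t)

end Cone

/-- The quotient map onto `collapse X A` as a pointed map. -/
def collapseHom (X : PSpace.{u}) (A : Set X) : PSpace.Hom X (collapse X A) :=
  ⟨⟨collapseMk X A, (isCollapse_collapseMk X A).quot.continuous⟩, rfl⟩

/-- The quotient by the image of a closed cofibration is the mapping cone. -/
theorem collapse_phequiv_cone {A X : PSpace.{u}} (i : PSpace.Hom A X)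
    (hi : IsClosedCofibration i.map) : PHEquiv (collapse X (Set.range i.map)) (cone i) := by
  -- The homotopy G starts at the inclusion of X in the cone and moves the points of A up their cone
  -- lines, so at time 1 it maps A to the apex and factors through the quotient.
  obtain ⟨G, G0, G1⟩ := hi.2 (cone i) (coneInl i).map (coneInr i) (coneInr_zero i)
  have hcq := isCollapse_collapseMk X (Set.range i.map)
  obtain ⟨q, hq, hq'⟩ := exists_cone_lift (i := i) (Q := collapse X (Set.range i.map))
    (collapseHom X _) (ContinuousMap.const _ (collapse X _).pt)
    (fun a => ((collapseMk_eq_pt (X := X) (A := Set.range i.map)).2 (Or.inr ⟨a, rfl⟩)).symm)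
    (fun _ => rfl) fun _ => rfl
  have hGpt : ∀ t, G (X.pt, t) = (cone i).pt := by
    intro t
    rw [← i.map_pt, G1, coneInr_pt]
  obtain ⟨g, hg⟩ := hcq.exists_lift (Q := cone i)
    ⟨fun x => G (x, 1), by fun_prop⟩ (by
      intro x hx
      rcases collapseMk_eq_pt.1 hx with rfl | ⟨a, rfl⟩
      · exact hGpt 1
      · exact (G1 a 1).trans (coneInr_one i a))
  refine PHEquiv.intro g q (PHomotopic.symm ?_) (PHomotopic.symm ?_)
  · refine hcq.phomotopic (ContinuousMap.curry (q.map.comp G)) (fun x => ?_) (fun x => ?_) ?_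
    · exact (congrArg q.map (G0 x)).trans (hq x)
    · exact congrArg q.map (hg x).symm
    · intro x hx t
      refine Eq.trans (?_ : _ = q.map (G (x, t))) ?_
      · rfl
      rcases collapseMk_eq_pt.1 hx with rfl | ⟨a, rfl⟩
      · rw [hGpt, q.map_pt]
      · rw [G1, hq']
        rfl
  -- On the cone lines the height is raised to the maximum of height and time. At height 0 this is
  -- the motion of A under G, and at time 1 everything is at the apex.
  · refine phomotopic_cone (ContinuousMap.curry G)
      (ContinuousMap.curry ⟨fun z : (A × unitInterval) × unitInterval =>
        coneInr i (z.1.1, max z.1.2 z.2), by fun_prop⟩) G0 (fun x => ?_) hGpt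
      (fun z => ?_) (fun z => ?_) (fun a t => ?_) (fun a t => ?_) fun s t => ?_
    · exact ((congrArg g.map (hq x)).trans (hg x)).symm
    · exact congrArg (fun s => coneInr i (z.1, s)) (max_eq_left z.2.2.1)
    · refine (congrArg (fun s => coneInr i (z.1, s)) (max_eq_right z.2.2.2)).trans ?_
      refine (coneInr_one i z.1).trans ((congrArg g.map (hq' z)).trans g.map_pt).symm
    · exact (congrArg (fun s => coneInr i (a, s)) (max_eq_right t.2.1)).trans (G1 a t).symm
    · exact (congrArg (fun s => coneInr i (a, s)) (max_eq_left t.2.2)).trans (coneInr_one i a)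
    · exact coneInr_pt i _

/-! ### Homotopy invariance of the mapping cone -/

section ConeHomotopy

variable {A X : PSpace.{u}} {i j : PSpace.Hom A X}

/-- The line in the mapping cone of the end of a homotopy that first runs along the homotopy and
then up the cone. -/
def coneLine (j : PSpace.Hom A X) (H : C(A, C(unitInterval, X))) (z : A × ℝ) : cone j :=
  if z.2 ≤ 0 then (coneInl j).map (H z.1 (Set.projIcc 0 1 zero_le_one (1 + z.2)))
  else coneInr j (z.1, Set.projIcc 0 1 zero_le_one z.2)

theorem coneLine_of_nonpos (H : C(A, C(unitInterval, X))) {a : A} {s : ℝ} (hs : s ≤ 0) :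
    coneLine j H (a, s) = (coneInl j).map (H a (Set.projIcc 0 1 zero_le_one (1 + s))) :=
  if_pos hs

theorem coneLine_of_nonneg (H : C(A, C(unitInterval, X))) (H1 : ∀ a, H a 1 = j.map a) {a : A}
    {s : ℝ} (hs : 0 ≤ s) :
    coneLine j H (a, s) = coneInr j (a, Set.projIcc 0 1 zero_le_one s) := by
  rcases hs.eq_or_lt with rfl | h
  · rw [coneLine_of_nonpos H le_rfl, add_zero, Set.projIcc_right, Set.projIcc_left]
    exact (congrArg (coneInl j).map (H1 a)).trans (coneInr_zero j a).symm
  · exact if_neg (not_le.2 h)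

theorem continuous_coneLine (H : C(A, C(unitInterval, X))) (H1 : ∀ a, H a 1 = j.map a) :
    Continuous (coneLine j H) := by
  have hH : Continuous fun z : A × unitInterval => H z.1 z.2 :=
    ContinuousMap.continuous_uncurry_of_continuous H
  have hpr : Continuous (Set.projIcc (0 : ℝ) 1 zero_le_one) := continuous_projIcc
  refine Continuous.if_le ?_ ?_ continuous_snd continuous_const ?_
  · exact (coneInl j).map.continuous.comp (hH.comp (continuous_fst.prodMk
      (hpr.comp (continuous_const.add continuous_snd))))
  · exact (coneInr j).continuous.comp (continuous_fst.prodMk (hpr.comp continuous_snd))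
  · rintro ⟨a, s⟩ (rfl : s = 0)
    exact (coneLine_of_nonpos H le_rfl).symm.trans (coneLine_of_nonneg H H1 le_rfl)

theorem coneLine_pt (H : C(A, C(unitInterval, X))) (Hp : ∀ t, H A.pt t = X.pt) (s : ℝ) :
    coneLine j H (A.pt, s) = (cone j).pt := by
  unfold coneLine
  split_ifs
  · rw [Hp, (coneInl j).map_pt]
  · exact coneInr_pt j _

theorem coneLine_one (H : C(A, C(unitInterval, X))) (H1 : ∀ a, H a 1 = j.map a) (a : A) :
    coneLine j H (a, 1) = (cone j).pt := by
  rw [coneLine_of_nonneg H H1 zero_le_one, Set.projIcc_right]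
  exact coneInr_one j a

/-- The height in [0, 1] is stretched to [-1, 1]: the negative half runs along the homotopy from `i`
to `j`, the positive half up the cone of `j`. -/
theorem exists_cone_map (H : C(A, C(unitInterval, X))) (H0 : ∀ a, H a 0 = i.map a)
    (H1 : ∀ a, H a 1 = j.map a) (Hp : ∀ t, H A.pt t = X.pt) :
    ∃ k : PSpace.Hom (cone i) (cone j), (∀ x, k.map ((coneInl i).map x) = (coneInl j).map x) ∧
      ∀ z, k.map (coneInr i z) = coneLine j H (z.1, 2 * z.2 - 1) := by
  have hc := continuous_coneLine H H1
  refine exists_cone_lift (coneInl j)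
    ⟨fun z => coneLine j H (z.1, 2 * z.2 - 1), by fun_prop⟩ (fun a => ?_) (fun a => ?_) fun t => ?_
  · refine (coneLine_of_nonpos H (by norm_num)).trans ?_
    norm_num
    exact congrArg (coneInl j).map (H0 a)
  · refine Eq.trans ?_ (coneLine_one H H1 a)
    norm_num
  · exact coneLine_pt H Hp _

/-- With v = 2 s - 1, the composite on a cone line at height s is `coneLine` at max(-1 - v, 2 v -
1): forward along H, back along K, then up the cone. This function of s takes the values 0 and 1 at
the ends, like s itself, so the straight-line homotopy between the two respects the identifications
of the cone. -/
theorem cone_map_comp_phomotopic (H : C(A, C(unitInterval, X))) (H0 : ∀ a, H a 0 = i.map a)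
    (H1 : ∀ a, H a 1 = j.map a) (Hp : ∀ t, H A.pt t = X.pt)
    (K : C(A, C(unitInterval, X))) (hK : ∀ a t, K a t = H a (unitInterval.symm t))
    {k : PSpace.Hom (cone i) (cone j)} {l : PSpace.Hom (cone j) (cone i)}
    (hk : ∀ x, k.map ((coneInl i).map x) = (coneInl j).map x)
    (hk' : ∀ z, k.map (coneInr i z) = coneLine j H (z.1, 2 * z.2 - 1))
    (hl : ∀ x, l.map ((coneInl j).map x) = (coneInl i).map x)
    (hl' : ∀ z, l.map (coneInr j z) = coneLine i K (z.1, 2 * z.2 - 1)) :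
    PHomotopic (l.comp k) (PSpace.Hom.refl (cone i)) := by
  have K1 : ∀ a, K a 1 = i.map a := fun a => by rw [hK, unitInterval.symm_one, H0]
  have Kp : ∀ t, K A.pt t = X.pt := fun t => by rw [hK, Hp]
  have hc := continuous_coneLine K K1
  have hρ : ∀ z : A × unitInterval, l.map (k.map (coneInr i z)) =
      coneLine i K (z.1, max (-1 - (2 * z.2 - 1)) (2 * (2 * z.2 - 1) - 1)) := by
    rintro ⟨a, s, hs0, hs1⟩
    rw [hk']
    dsimp only
    rcases le_total (2 * s - 1) 0 with h | h
    · rw [coneLine_of_nonpos H h, hl, max_eq_left (by linarith),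
        coneLine_of_nonpos K (by linarith), hK]
      congr 2
      rw [Set.projIcc_of_mem zero_le_one (show 1 + (2 * s - 1) ∈ Set.Icc (0 : ℝ) 1 from
          ⟨by linarith, by linarith⟩),
        Set.projIcc_of_mem zero_le_one (show 1 + (-1 - (2 * s - 1)) ∈ Set.Icc (0 : ℝ) 1 from
          ⟨by linarith, by linarith⟩)]
      ext
      simp
    · rw [coneLine_of_nonneg H H1 h, hl', max_eq_right (by linarith)]
      rw [Set.projIcc_of_mem zero_le_one (show (2 * s - 1) ∈ Set.Icc (0 : ℝ) 1 from
          ⟨by linarith, by linarith⟩)]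
  refine phomotopic_cone (ContinuousMap.curry ⟨fun p => (coneInl i).map p.1, by fun_prop⟩)
    (ContinuousMap.curry ⟨fun p : (A × unitInterval) × unitInterval =>
      coneLine i K (p.1.1, (1 - (p.2 : ℝ)) *
        max (-1 - (2 * (p.1.2 : ℝ) - 1)) (2 * (2 * (p.1.2 : ℝ) - 1) - 1) + p.2 * p.1.2), by fun_prop⟩) (fun x => ?_) (fun x => rfl) (fun t => rfl) (fun z => ?_)
    (fun z => ?_) (fun a t => ?_) (fun a t => ?_) fun s t => ?_
  · exact ((congrArg l.map (hk x)).trans (hl x)).symm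
  · refine Eq.trans ?_ (hρ z).symm
    simp
  · refine Eq.trans ?_ ((coneLine_of_nonneg K (a := z.1) K1 z.2.2.1).trans ?_)
    · simp
    · rw [Set.projIcc_of_mem zero_le_one z.2.2]
      rfl
  · refine Eq.trans (b := coneLine i K (a, 0)) ?_ ((coneLine_of_nonneg K K1 le_rfl).trans ?_)
    · norm_num
    · rw [Set.projIcc_left]
      exact coneInr_zero i a
  · refine Eq.trans ?_ (coneLine_one K K1 a)
    norm_num
  · exact coneLine_pt K Kp _

theorem cone_congr (h : PHomotopic i j) : PHEquiv (cone i) (cone j) := by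
  obtain ⟨H, H0, H1, Hp⟩ := h.exists_path
  have hH : Continuous fun z : A × unitInterval => H z.1 z.2 :=
    ContinuousMap.continuous_uncurry_of_continuous H
  obtain ⟨K, hK⟩ : ∃ K : C(A, C(unitInterval, X)), ∀ a t, K a t = H a (unitInterval.symm t) :=
    ⟨ContinuousMap.curry ⟨fun z => H z.1 (unitInterval.symm z.2),
      hH.comp (continuous_fst.prodMk (unitInterval.continuous_symm.comp continuous_snd))⟩,
      fun _ _ => rfl⟩
  have hK' : ∀ a t, H a t = K a (unitInterval.symm t) := fun a t => by
    rw [hK, unitInterval.symm_symm]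
  have K0 : ∀ a, K a 0 = j.map a := fun a => by rw [hK, unitInterval.symm_zero, H1]
  have K1 : ∀ a, K a 1 = i.map a := fun a => by rw [hK, unitInterval.symm_one, H0]
  have Kp : ∀ t, K A.pt t = X.pt := fun t => by rw [hK, Hp]
  obtain ⟨k, hk, hk'⟩ := exists_cone_map H H0 H1 Hp
  obtain ⟨l, hl, hl'⟩ := exists_cone_map K K0 K1 Kp
  exact PHEquiv.intro k l (cone_map_comp_phomotopic H H0 H1 Hp K hK hk hk' hl hl')
    (cone_map_comp_phomotopic K K0 K1 Kp H hK' hl hl' hk hk')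

theorem cone_const (A X : PSpace.{u}) :
    PHEquiv (cone (PSpace.Hom.const A X)) (bwedge X (susp A)) := by
  have hs := (isCollapse_suspMk A).quot.continuous
  obtain ⟨k, hk, hk'⟩ := exists_cone_lift (i := PSpace.Hom.const A X) (bwedgeInl X (susp A))
    ((bwedgeInr X (susp A)).map.comp ⟨suspMk A, hs⟩)
    (fun a => (congrArg (bwedgeInr X (susp A)).map (suspMk_eq_pt.2 (Or.inr (Or.inl rfl)))).trans
      (bwedgeInr X (susp A)).map_pt)
    (fun a => (congrArg (bwedgeInr X (susp A)).map (suspMk_eq_pt.2 (Or.inr (Or.inr rfl)))).trans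
      (bwedgeInr X (susp A)).map_pt)
    (fun t => (congrArg (bwedgeInr X (susp A)).map (suspMk_eq_pt.2 (Or.inl rfl))).trans
      (bwedgeInr X (susp A)).map_pt)
  obtain ⟨m, hm⟩ := (isCollapse_suspMk A).exists_lift (Q := cone (PSpace.Hom.const A X))
    (coneInr _) (by
      rintro ⟨a, t⟩ h
      rcases suspMk_eq_pt.1 h with h | h | h <;> dsimp only at h <;> subst h
      · exact coneInr_pt _ t
      · exact coneInr_zero _ a
      · exact coneInr_one _ a)
  obtain ⟨l, hl, hl'⟩ := exists_bwedge_lift (coneInl (PSpace.Hom.const A X)) m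
  refine PHEquiv.of_inverse k l (fun z => ?_)
    (bwedge_ext (f := k.comp l) (g := PSpace.Hom.refl _) (fun x => ?_) fun x => ?_)
  · rcases cone_cases z with ⟨x, rfl⟩ | ⟨a, s, rfl⟩
    · rw [hk]
      exact hl x
    · rw [hk']
      exact (hl' _).trans (hm _)
  · exact (congrArg k.map (hl x)).trans (hk x)
  · refine (congrArg k.map (hl' x)).trans ?_
    exact (isCollapse_suspMk A).hom_ext (f := k.comp m) (g := bwedgeInr X (susp A))
      (fun z => (congrArg k.map (hm z)).trans (hk' z)) x

end ConeHomotopy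

/-- The quotient by the image of a null-homotopic closed cofibration splits. -/
theorem collapse_phequiv_of_null {A X : PSpace.{u}} {i : PSpace.Hom A X}
    (hi : IsClosedCofibration i.map) (h : PHomotopic i (PSpace.Hom.const A X)) :
    PHEquiv (collapse X (Set.range i.map)) (bwedge X (susp A)) :=
  ((collapse_phequiv_cone i hi).trans (cone_congr h)).trans (cone_const A X)

/-- The inclusion of a contractible subspace is null-homotopic, and the suspension it contributes to
the wedge is contractible. -/
theorem collapse_phequiv_of_pcontractible {A X : PSpace.{u}} {i : PSpace.Hom A X}
    (hi : IsClosedCofibration i.map) (h : PContractible A) :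
    PHEquiv (collapse X (Set.range i.map)) X :=
  (collapse_phequiv_of_null hi
    ((PHomotopic.of_eq fun _ => rfl : PHomotopic i (i.comp (PSpace.Hom.refl A))).trans
      (h.null (PSpace.Hom.refl A) i))).trans (bwedge_of_pcontractible X h.susp)

/-! ### Smash products with spheres -/

/-- Both sides are quotients of (A × K) × I with the same preimage of the base point. Since `K` is
compact and `L` Hausdorff, `h` is proper; hence its product with the identity of an arbitrary `A` is
closed and is a quotient map. -/
theorem smash_phequiv_susp {K L : PSpace.{u}} [CompactSpace K] [T2Space L] (A : PSpace.{u})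
    (h : C(K × unitInterval, L)) (hs : Function.Surjective h)
    (hpt : ∀ z, h z = L.pt ↔ z.1 = K.pt ∨ z.2 = 0 ∨ z.2 = 1)
    (hinj : ∀ z z', h z = h z' → h z ≠ L.pt → z = z') :
    PHEquiv (smash A L) (susp (smash A K)) := by
  have hp : IsCollapse (fun z : (A × K) × unitInterval =>
      suspMk (smash A K) (smashMk A K z.1, z.2)) := by
    constructor
    · exact (isCollapse_suspMk _).quot.comp
        (IsQuotientMap.prod_left (isCollapse_smashMk A K).quot unitInterval)
    · rintro ⟨z, t⟩ ⟨z', t'⟩ h1 h2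
      have h3 := (isCollapse_suspMk _).inj _ _ h1 h2
      obtain ⟨h4, rfl⟩ := Prod.mk.inj h3
      obtain rfl := (isCollapse_smashMk A K).inj _ _ h4
        fun h5 => h2 (suspMk_eq_pt.2 (Or.inl h5))
      rfl
  have hq : IsCollapse (fun z : (A × K) × unitInterval =>
      smashMk A L (z.1.1, h (z.1.2, z.2))) := by
    constructor
    · have h1 : IsProperMap (Prod.map (id : A → A) h) :=
        isProperMap_id.prodMap h.continuous.isProperMap
      have h2 : IsQuotientMap (Prod.map (id : A → A) h) :=
        h1.isClosedMap.isQuotientMap h1.continuous (Function.surjective_id.prodMap hs)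
      exact (isCollapse_smashMk A L).quot.comp
        (h2.comp (Homeomorph.prodAssoc A K unitInterval).isQuotientMap)
    · rintro ⟨⟨a, x⟩, t⟩ ⟨⟨a', x'⟩, t'⟩ h1 h2
      have h3 := (isCollapse_smashMk A L).inj _ _ h1 h2
      obtain ⟨rfl, h4⟩ := Prod.mk.inj h3
      obtain ⟨rfl, rfl⟩ := Prod.mk.inj
        (hinj _ _ h4 fun h5 => h2 (smashMk_eq_pt.2 (Or.inr h5)))
      rfl
  refine hq.phequiv hp ?_
  rintro ⟨⟨a, x⟩, t⟩
  rw [smashMk_eq_pt, suspMk_eq_pt, smashMk_eq_pt, hpt]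
  tauto

/-- A nonnegative function on the unit interval, with maximum `1`, that vanishes at the ends. -/
def bump (s : ℝ) : ℝ := 4 * s * (1 - s)

/-- The formula for the map from the suspension of a sphere to the next sphere. -/
def suspCoord (w : ℕ) (x : EuclideanSpace ℝ (Fin (w + 1))) (s : ℝ) :
    EuclideanSpace ℝ (Fin (w + 1 + 1)) :=
  WithLp.toLp 2 (Fin.snoc (α := fun _ => ℝ)
    (fun i => EuclideanSpace.single (0 : Fin (w + 1)) (1 : ℝ) i -
      bump s * (EuclideanSpace.single (0 : Fin (w + 1)) (1 : ℝ) i - x i))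
    ((1 - 2 * s) * √(bump s) * √(2 - 2 * x 0)))

theorem suspCoord_castSucc (w : ℕ) (x : EuclideanSpace ℝ (Fin (w + 1))) (s : ℝ) (i : Fin (w + 1)) :
    suspCoord w x s i.castSucc = EuclideanSpace.single (0 : Fin (w + 1)) (1 : ℝ) i -
      bump s * (EuclideanSpace.single (0 : Fin (w + 1)) (1 : ℝ) i - x i) := by
  simp [suspCoord]

theorem suspCoord_last (w : ℕ) (x : EuclideanSpace ℝ (Fin (w + 1))) (s : ℝ) :
    suspCoord w x s (Fin.last _) = (1 - 2 * s) * √(bump s) * √(2 - 2 * x 0) := by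
  simp [suspCoord]

theorem mem_unitSphere_iff {n : ℕ} {x : EuclideanSpace ℝ (Fin n)} :
    x ∈ Metric.sphere (0 : EuclideanSpace ℝ (Fin n)) 1 ↔ ∑ i, x i ^ 2 = 1 := by
  rw [EuclideanSpace.sphere_zero_eq 1 zero_le_one]
  simp

theorem sum_single_sub_sq {w : ℕ} {x : EuclideanSpace ℝ (Fin (w + 1))} (hx : ∑ i, x i ^ 2 = 1) :
    ∑ i, (EuclideanSpace.single (0 : Fin (w + 1)) (1 : ℝ) i - x i) ^ 2 = 2 - 2 * x 0 := by
  rw [Fin.sum_univ_succ] at hx ⊢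
  simp [Fin.succ_ne_zero]
  linarith

theorem two_sub_nonneg {w : ℕ} {x : EuclideanSpace ℝ (Fin (w + 1))} (hx : ∑ i, x i ^ 2 = 1) :
    0 ≤ 2 - 2 * x 0 := by
  rw [← sum_single_sub_sq hx]
  positivity

theorem eq_single_iff {w : ℕ} {x : EuclideanSpace ℝ (Fin (w + 1))} (hx : ∑ i, x i ^ 2 = 1) :
    x = EuclideanSpace.single 0 1 ↔ x 0 = 1 := by
  constructor
  · rintro rfl
    simp
  · intro h
    have h1 := sum_single_sub_sq hx
    rw [h, mul_one, sub_self, Finset.sum_eq_zero_iff_of_nonneg fun i _ => sq_nonneg _] at h1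
    ext i
    have := pow_eq_zero_iff (two_ne_zero) |>.1 (h1 i (Finset.mem_univ i))
    linarith

/-- For fixed x, the parameter s runs through the circle with diameter from the basis vector e_0 to
x, in the plane through both that contains the direction of the last axis: s = 0 and s = 1 give e_0,
and s = 1/2 gives x. That plane meets the unit sphere in this circle. -/
theorem suspCoord_mem {w : ℕ} {x : EuclideanSpace ℝ (Fin (w + 1))} (hx : ∑ i, x i ^ 2 = 1)
    {s : ℝ} (hs : s ∈ unitInterval) : ∑ i, suspCoord w x s i ^ 2 = 1 := by
  have hb : 0 ≤ bump s := by
    have := hs.1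
    have := sub_nonneg.2 hs.2
    unfold bump
    positivity
  rw [Fin.sum_univ_castSucc, suspCoord_last, mul_pow, mul_pow, Real.sq_sqrt hb,
    Real.sq_sqrt (two_sub_nonneg hx)]
  simp only [suspCoord_castSucc]
  rw [Fin.sum_univ_succ] at hx ⊢
  have h1 : ∀ i : Fin w, (EuclideanSpace.single (0 : Fin (w + 1)) (1 : ℝ) i.succ - bump s *
      (EuclideanSpace.single (0 : Fin (w + 1)) (1 : ℝ) i.succ - x i.succ)) ^ 2 =
      bump s ^ 2 * x i.succ ^ 2 := by
    intro i
    simp [Fin.succ_ne_zero]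
    ring
  rw [Finset.sum_congr rfl fun i _ => h1 i, ← Finset.mul_sum, eq_sub_of_add_eq' hx]
  simp [bump]
  ring

theorem suspCoord_eq_single_iff {w : ℕ} {x : EuclideanSpace ℝ (Fin (w + 1))}
    (hx : ∑ i, x i ^ 2 = 1) {s : ℝ} (hs : s ∈ unitInterval) :
    suspCoord w x s = EuclideanSpace.single 0 1 ↔
      x = EuclideanSpace.single 0 1 ∨ s = 0 ∨ s = 1 := by
  rw [eq_single_iff (suspCoord_mem hx hs), eq_single_iff hx]
  have := suspCoord_castSucc w x s 0
  rw [Fin.castSucc_zero] at this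
  rw [this]
  simp only [PiLp.single_apply, if_true, sub_eq_self, mul_eq_zero, bump,
    OfNat.ofNat_ne_zero, false_or]
  constructor
  · rintro ((h | h) | h)
    · right; left; exact h
    · right; right; linarith
    · left; linarith
  · rintro (h | h | h)
    · right; linarith
    · left; left; exact h
    · left; right; linarith

/-- The vector bump s • (e_0 - x) is determined by the image. Its first entry is bump s (1 - x_0)
and its squared norm is 2 (bump s)² (1 - x_0), so it determines bump s and x; the last coordinate
then determines s. -/
theorem suspCoord_inj {w : ℕ} {x x' : EuclideanSpace ℝ (Fin (w + 1))}
    (hx : ∑ i, x i ^ 2 = 1) (hx' : ∑ i, x' i ^ 2 = 1) {s s' : ℝ} (hs : s ∈ unitInterval)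
    (hs' : s' ∈ unitInterval) (h : suspCoord w x s = suspCoord w x' s')
    (h0 : suspCoord w x s ≠ EuclideanSpace.single 0 1) : x = x' ∧ s = s' := by
  have h0' : suspCoord w x' s' ≠ EuclideanSpace.single 0 1 := h ▸ h0
  rw [Ne, suspCoord_eq_single_iff hx hs, eq_single_iff hx] at h0
  rw [Ne, suspCoord_eq_single_iff hx' hs', eq_single_iff hx'] at h0'
  push Not at h0 h0'
  have hpos : ∀ {s : ℝ}, s ∈ unitInterval → s ≠ 0 → s ≠ 1 → 0 < bump s := by
    intro s hs h1 h2
    have h3 := lt_of_le_of_ne hs.1 h1.symm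
    have h4 := sub_pos.2 (lt_of_le_of_ne hs.2 h2)
    unfold bump
    positivity
  have hb := hpos hs h0.2.1 h0.2.2
  have hb' := hpos hs' h0'.2.1 h0'.2.2
  have hN : 0 < 2 - 2 * x 0 := lt_of_le_of_ne (two_sub_nonneg hx) fun h => h0.1 (by linarith)
  have hi : ∀ i, bump s * (EuclideanSpace.single (0 : Fin (w + 1)) (1 : ℝ) i - x i) =
      bump s' * (EuclideanSpace.single (0 : Fin (w + 1)) (1 : ℝ) i - x' i) := by
    intro i
    have h1 := suspCoord_castSucc w x s i
    have h2 := suspCoord_castSucc w x' s' i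
    rw [h] at h1
    linarith
  have hsq : bump s ^ 2 * (2 - 2 * x 0) = bump s' ^ 2 * (2 - 2 * x' 0) := by
    rw [← sum_single_sub_sq hx, ← sum_single_sub_sq hx', Finset.mul_sum, Finset.mul_sum]
    refine Finset.sum_congr rfl fun i _ => ?_
    rw [← mul_pow, hi i, mul_pow]
  have h00 := hi 0
  simp only [PiLp.single_apply, if_true] at h00
  have hbb : bump s = bump s' := by
    have h1 : bump s * (1 - x 0) ≠ 0 := (mul_pos hb (by linarith)).ne'
    refine mul_right_cancel₀ h1 ?_
    nlinarith
  have hxx : x = x' := by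
    ext i
    have := hi i
    rw [← hbb] at this
    have := mul_left_cancel₀ hb.ne' this
    linarith
  refine ⟨hxx, ?_⟩
  have h1 := suspCoord_last w x s
  have h2 := suspCoord_last w x' s'
  rw [h] at h1
  rw [h1, ← hxx, ← hbb] at h2
  have h3 := mul_right_cancel₀ (Real.sqrt_pos.2 hN).ne' h2
  have h4 := mul_right_cancel₀ (Real.sqrt_pos.2 hb).ne' h3
  linarith

/-- Let D = |e_0 - y|² = 2 - 2 y_0 and let z be the last coordinate of y. The formula forces 1 - 2 s
= z / √D and so bump s = 1 - z² / D; dividing the other coordinates of e_0 - y by bump s gives e_0 -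
x. -/
theorem exists_suspCoord_eq {w : ℕ} {y : EuclideanSpace ℝ (Fin (w + 1 + 1))}
    (hy : ∑ i, y i ^ 2 = 1) : ∃ (x : EuclideanSpace ℝ (Fin (w + 1))) (s : ℝ),
      ∑ i, x i ^ 2 = 1 ∧ s ∈ unitInterval ∧ suspCoord w x s = y := by
  by_cases hy1 : y 0 = 1
  · refine ⟨EuclideanSpace.single 0 1, 0, ?_, ⟨le_rfl, zero_le_one⟩, ?_⟩
    · rw [Fin.sum_univ_succ]
      simp [Fin.succ_ne_zero]
    · have h1 : ∑ i, (EuclideanSpace.single (0 : Fin (w + 1)) (1 : ℝ)) i ^ 2 = 1 := by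
        rw [Fin.sum_univ_succ]
        simp [Fin.succ_ne_zero]
      rw [(eq_single_iff hy).2 hy1]
      exact (suspCoord_eq_single_iff h1 ⟨le_rfl, zero_le_one⟩).2 (Or.inl rfl)
  set z := y (Fin.last _) with hz
  have hD' := two_sub_nonneg hy
  have hD : 0 < 2 - 2 * y 0 := lt_of_le_of_ne hD' fun h => hy1 (by linarith)
  set D := 2 - 2 * y 0 with hDdef
  have hd : ∑ i : Fin (w + 1), (EuclideanSpace.single (0 : Fin (w + 1)) (1 : ℝ) i -
      y i.castSucc) ^ 2 = D - z ^ 2 := by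
    rw [Fin.sum_univ_castSucc, Fin.sum_univ_succ] at hy
    rw [Fin.sum_univ_succ]
    simp only [PiLp.single_apply, Fin.succ_ne_zero, if_true, if_false, zero_sub, neg_sq]
    rw [Fin.castSucc_zero] at hy ⊢
    rw [hDdef]
    nlinarith
  have hdpos : 0 < D - z ^ 2 := by
    refine lt_of_le_of_ne (hd ▸ Finset.sum_nonneg fun i _ => sq_nonneg _) fun h => ?_
    rw [← h, Finset.sum_eq_zero_iff_of_nonneg fun i _ => sq_nonneg _] at hd
    have h1 := pow_eq_zero_iff (two_ne_zero) |>.1 (hd 0 (Finset.mem_univ 0))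
    simp only [PiLp.single_apply, if_true, Fin.castSucc_zero] at h1
    exact hy1 (by linarith)
  set t := 1 - z ^ 2 / D with ht
  have htD : t * D = D - z ^ 2 := by
    rw [ht]
    field_simp
  have htpos : 0 < t := by
    have : 0 < t * D := by rw [htD]; exact hdpos
    exact (pos_iff_pos_of_mul_pos this).2 hD
  set r := z / √D with hr
  have hr2 : r ^ 2 = 1 - t := by
    rw [hr, div_pow, Real.sq_sqrt hD.le, ht]
    ring
  have hrle : |r| ≤ 1 := by
    rw [← sq_le_one_iff_abs_le_one, hr2]
    linarith
  have hr1 := (abs_le.1 hrle)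
  have hbump : bump ((1 - r) / 2) = t := by
    unfold bump
    linarith
  have hx : ∑ i : Fin (w + 1), ((WithLp.toLp 2 fun i : Fin (w + 1) =>
      EuclideanSpace.single (0 : Fin (w + 1)) (1 : ℝ) i -
      (EuclideanSpace.single (0 : Fin (w + 1)) (1 : ℝ) i - y i.castSucc) / t :
        EuclideanSpace ℝ (Fin (w + 1))) i) ^ 2 = 1 := by
    have e : ∀ i : Fin (w + 1), ((WithLp.toLp 2 fun i : Fin (w + 1) =>
      EuclideanSpace.single (0 : Fin (w + 1)) (1 : ℝ) i -
      (EuclideanSpace.single (0 : Fin (w + 1)) (1 : ℝ) i - y i.castSucc) / t :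
        EuclideanSpace ℝ (Fin (w + 1))) i) ^ 2 =
        (if i = 0 then 1 - 2 * (1 - y i.castSucc) / t else 0) +
          (EuclideanSpace.single (0 : Fin (w + 1)) (1 : ℝ) i - y i.castSucc) ^ 2 / t ^ 2 := by
      intro i
      simp only [PiLp.single_apply]
      split_ifs <;> field_simp <;> ring
    rw [Finset.sum_congr rfl fun i _ => e i, Finset.sum_add_distrib, ← Finset.sum_div, hd, ← htD,
      Finset.sum_ite_eq' Finset.univ (0 : Fin (w + 1))]
    simp only [Finset.mem_univ, if_true, Fin.castSucc_zero, hDdef]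
    field_simp
    ring
  refine ⟨_, (1 - r) / 2, hx, ⟨by linarith, by linarith⟩, ?_⟩
  ext i
  refine Fin.lastCases ?_ (fun i => ?_) i
  · rw [suspCoord_last, hbump, mul_assoc, ← Real.sqrt_mul htpos.le]
    simp only [PiLp.single_apply, if_true, Fin.castSucc_zero]
    have e : t * (2 - 2 * (1 - (1 - y 0) / t)) = D := by
      rw [hDdef]
      field_simp
      ring
    rw [e, ← hz, hr]
    have := (Real.sqrt_pos.2 hD).ne'
    field_simp
    ring
  · rw [suspCoord_castSucc, hbump]
    simp only []
    field_simp
    ring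

theorem continuous_suspCoord (w : ℕ) :
    Continuous fun p : EuclideanSpace ℝ (Fin (w + 1)) × ℝ => suspCoord w p.1 p.2 := by
  have h0 : Continuous fun p : EuclideanSpace ℝ (Fin (w + 1)) × ℝ => bump p.2 := by
    unfold bump
    fun_prop
  have h : Continuous fun p : EuclideanSpace ℝ (Fin (w + 1)) × ℝ =>
      (fun i => suspCoord w p.1 p.2 i : Fin (w + 1 + 1) → ℝ) := by
    refine continuous_pi fun i => ?_
    refine Fin.lastCases ?_ (fun i => ?_) i
    · simp only [suspCoord_last]
      fun_prop
    · simp only [suspCoord_castSucc]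
      fun_prop
  exact (PiLp.continuous_toLp 2 _).comp h

instance (w : ℕ) : CompactSpace (sphere.{u} w) :=
  inferInstanceAs (CompactSpace (ULift.{u} (Metric.sphere (0 : EuclideanSpace ℝ (Fin (w + 1))) 1)))

instance (w : ℕ) : T2Space (sphere.{u} w) :=
  inferInstanceAs (T2Space (ULift.{u} (Metric.sphere (0 : EuclideanSpace ℝ (Fin (w + 1))) 1)))

theorem smash_sphere_succ (A : PSpace.{u}) (w : ℕ) :
    PHEquiv (smash A (sphere (w + 1))) (susp (smash A (sphere w))) := by
  have hmem : ∀ x : sphere.{u} w, ∑ i, x.down.1 i ^ 2 = 1 := fun x =>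
    mem_unitSphere_iff.1 x.down.2
  have hval : ∀ {w : ℕ} (x y : sphere.{u} w), x = y ↔ x.down.1 = y.down.1 := by
    intro w x y
    exact ULift.ext_iff.trans Subtype.ext_iff
  have hc : Continuous fun z : sphere.{u} w × unitInterval => suspCoord w z.1.down.1 z.2 :=
    (continuous_suspCoord w).comp
      (((continuous_subtype_val.comp continuous_uliftDown).comp continuous_fst).prodMk
        (continuous_subtype_val.comp continuous_snd))
  let h : C(sphere.{u} w × unitInterval, sphere.{u} (w + 1)) :=
    ⟨fun z => ⟨⟨suspCoord w z.1.down.1 z.2,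
      mem_unitSphere_iff.2 (suspCoord_mem (hmem z.1) z.2.2)⟩⟩,
      continuous_uliftUp.comp (hc.subtype_mk _)⟩
  refine smash_phequiv_susp A h ?_ ?_ ?_
  · rintro ⟨⟨y, hy⟩⟩
    obtain ⟨x, s, hx, hs, hxy⟩ := exists_suspCoord_eq (mem_unitSphere_iff.1 hy)
    exact ⟨(⟨⟨x, mem_unitSphere_iff.2 hx⟩⟩, ⟨s, hs⟩), (hval _ _).2 hxy⟩
  · rintro ⟨x, s⟩
    refine (hval _ _).trans ((suspCoord_eq_single_iff (hmem x) s.2).trans ?_)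
    rw [hval, Subtype.ext_iff, Subtype.ext_iff]
    rfl
  · rintro ⟨x, s⟩ ⟨x', s'⟩ h1 h2
    obtain ⟨h3, h4⟩ := suspCoord_inj (hmem x) (hmem x') s.2 s'.2 ((hval _ _).1 h1)
      fun h5 => h2 ((hval _ _).2 h5)
    exact Prod.ext ((hval _ _).2 h3) (Subtype.ext h4)

theorem smash_sphere_zero (X : PSpace.{u}) : PHEquiv (smash X (sphere 0)) X := by
  have hval : ∀ x y : sphere.{u} 0, x = y ↔ x.down.1 0 = y.down.1 0 := by
    intro x y
    refine (ULift.ext_iff.trans Subtype.ext_iff).trans ⟨fun h => by rw [h], fun h => ?_⟩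
    ext i
    rw [Fin.fin_one_eq_zero i]
    exact h
  have hor : ∀ x : sphere.{u} 0, x.down.1 0 = 1 ∨ x.down.1 0 = -1 := by
    intro x
    have h := mem_unitSphere_iff.1 x.down.2
    rw [Fin.sum_univ_one] at h
    exact sq_eq_one_iff.1 h
  have hpt : ((sphere.{u} 0).pt).down.1 0 = 1 := by simp [sphere]
  -- The copy of X over the base point 1 of the two-point sphere is collapsed, and the copy over -1
  -- is kept.
  let f : X × sphere.{u} 0 → X := fun z => if z.2.down.1 0 ≤ 0 then z.1 else X.pt
  have hneg : ∀ s : sphere.{u} 0, s.down.1 0 ≤ 0 ↔ s.down.1 0 = -1 := by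
    intro s
    rcases hor s with h | h <;> rw [h] <;> norm_num
  have hc : Continuous f := by
    have h1 : Continuous fun s : sphere.{u} 0 => s.down.1 0 :=
      ((PiLp.continuous_apply 2 _ (0 : Fin 1)).comp continuous_subtype_val).comp
        continuous_uliftDown
    refine Continuous.if_le continuous_fst continuous_const (h1.comp continuous_snd)
      continuous_const ?_
    rintro ⟨x, s⟩ (h : s.down.1 0 = 0)
    rcases hor s with h' | h' <;> rw [h] at h' <;> norm_num at h'
  obtain ⟨e, he⟩ : ∃ e : sphere.{u} 0, e.down.1 0 = -1 :=
    ⟨⟨⟨EuclideanSpace.single 0 (-1), by simp⟩⟩, by simp⟩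
  have hf : IsCollapse f := by
    constructor
    · refine IsQuotientMap.of_inverse (f := fun x => (x, e)) (by fun_prop) hc fun x => ?_
      exact if_pos ((hneg e).2 he)
    · rintro ⟨x, s⟩ ⟨x', s'⟩ h h0
      have hs : s.down.1 0 ≤ 0 := by
        by_contra h1
        exact h0 (if_neg h1)
      have hs' : s'.down.1 0 ≤ 0 := by
        by_contra h1
        exact h0 (h.trans (if_neg h1))
      have h1 : x = x' := by
        simpa [f, hs, hs'] using h
      have h2 : s = s' := by
        rw [hval, (hneg s).1 hs, (hneg s').1 hs']
      rw [h1, h2]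
  refine (isCollapse_smashMk X (sphere 0)).phequiv hf fun z => ?_
  rw [smashMk_eq_pt, hval, hpt]
  rcases hor z.2 with h | h
  · simp [f, h]
  · simp [f, h]
    norm_num

/-! ### Cuts of weights with values in `ℕ × ℕ` -/

/-- Two finite families with the same multiset of values differ by a bijection of the indices. -/
theorem exists_equiv_of_map_eq {ι κ α : Type} [Fintype ι] [Fintype κ] {p : ι → α} {q : κ → α}
    (h : Finset.univ.val.map p = Finset.univ.val.map q) : ∃ e : ι ≃ κ, ∀ i, q (e i) = p i := by
  classical
  have hc : ∀ a, Fintype.card {i // p i = a} = Fintype.card {i // q i = a} := by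
    intro a
    have h1 := congrArg (Multiset.count a) h
    rw [Multiset.count_map, Multiset.count_map] at h1
    rw [Fintype.card_subtype, Fintype.card_subtype]
    simp only [eq_comm (a := a)] at h1
    exact h1
  refine ⟨(Equiv.sigmaFiberEquiv p).symm.trans ((Equiv.sigmaCongrRight
    fun a => Fintype.equivOfCardEq (hc a)).trans (Equiv.sigmaFiberEquiv q)), fun i => ?_⟩
  exact (Fintype.equivOfCardEq (hc (p i)) ⟨i, rfl⟩).2

theorem exists_fin_map_eq {α : Type} (M : Multiset α) :
    ∃ (n : ℕ) (w : Fin n → α), Finset.univ.val.map w = M := by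
  refine ⟨M.toList.length, M.toList.get, ?_⟩
  rw [Fin.univ_val_map, List.ofFn_get, Multiset.coe_toList]

theorem univ_map_append {α : Type} {m n : ℕ} (a : Fin m → α) (b : Fin n → α) :
    Finset.univ.val.map (Fin.append a b) = Finset.univ.val.map a + Finset.univ.val.map b := by
  rw [Fin.univ_val_map, Fin.univ_val_map, Fin.univ_val_map, List.ofFn_fin_append,
    Multiset.coe_add]

theorem univ_map_const {α : Type} (n : ℕ) (a : α) :
    (Finset.univ : Finset (Fin n)).val.map (fun _ => a) = Multiset.replicate n a := by
  rw [Multiset.map_const', Finset.card_val, Finset.card_univ, Fintype.card_fin]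

/-- The cut of a family of weights in `ℕ × ℕ`: the sign vectors that are orthogonal to both
coordinates of the weights and vanish where the weight does. -/
def wCut {n : ℕ} (hn : 0 < n) (w : Fin n → ℕ × ℕ) : Cut n where
  pos := hn
  elems := {x | x ∈ signCube n ∧ ∑ i, x i * ((w i).1 : ℝ) = 0 ∧ ∑ i, x i * ((w i).2 : ℝ) = 0 ∧
    ∀ i, w i = 0 → x i = 0}
  span_closed := by
    ext x
    constructor
    · rintro ⟨h1, h2⟩
      refine ⟨h2, ?_⟩
      clear h2
      induction h1 using Submodule.span_induction with
      | mem y hy => exact hy.2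
      | zero => simp
      | add y z _ _ hy hz =>
        simp only [Pi.add_apply, add_mul, Finset.sum_add_distrib]
        rw [hy.1, hz.1, hy.2.1, hz.2.1]
        exact ⟨add_zero _, add_zero _, fun i hi => by rw [hy.2.2 i hi, hz.2.2 i hi, add_zero]⟩
      | smul a y _ hy =>
        simp only [Pi.smul_apply, smul_eq_mul, mul_assoc, ← Finset.mul_sum]
        rw [hy.1, hy.2.1]
        exact ⟨mul_zero _, mul_zero _, fun i hi => by rw [hy.2.2 i hi, mul_zero]⟩
    · intro h
      exact ⟨Submodule.subset_span h, h.1⟩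
  signs := by
    rintro x ⟨hc, h, h', hz⟩ h0
    have hs : ∑ i, x i * ((w i).1 + (w i).2 : ℝ) = 0 := by
      simp only [mul_add, Finset.sum_add_distrib, h, h', add_zero]
    have hv : ∀ i, (0 : ℝ) ≤ (w i).1 + (w i).2 := fun i => by positivity
    obtain ⟨k, hk⟩ : ∃ k, x k ≠ 0 := by
      by_contra hcon
      push Not at hcon
      exact h0 (funext hcon)
    have hk' : ((w k).1 + (w k).2 : ℝ) ≠ 0 := by
      intro h1
      refine hk (hz k ?_)
      have h2 : (w k).1 + (w k).2 = 0 := by exact_mod_cast h1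
      exact Prod.ext (by simp only [Prod.fst_zero]; omega) (by simp only [Prod.snd_zero]; omega)
    constructor
    · by_contra hcon
      have hle : ∀ i, x i ≤ 0 := by
        intro i
        rcases hc i with h | h | h
        · linarith
        · linarith
        · exact absurd ⟨i, mem_plusSet.2 h⟩ hcon
      have h1 := (Finset.sum_eq_zero_iff_of_nonpos fun i _ =>
        mul_nonpos_of_nonpos_of_nonneg (hle i) (hv i)).1 hs k (Finset.mem_univ k)
      exact (mul_ne_zero hk hk') h1
    · by_contra hcon
      have hge : ∀ i, 0 ≤ x i := by
        intro i
        rcases hc i with h | h | h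
        · exact absurd ⟨i, mem_minusSet.2 h⟩ hcon
        · linarith
        · linarith
      have h1 := (Finset.sum_eq_zero_iff_of_nonneg fun i _ =>
        mul_nonneg (hge i) (hv i)).1 hs k (Finset.mem_univ k)
      exact (mul_ne_zero hk hk') h1

/-! ### Number partitions, direct products and merged blocks as cuts of weights -/

theorem Cut.ext_elems {n : ℕ} {S T : Cut n} (h : ∀ x, x ∈ S.elems ↔ x ∈ T.elems) : S = T :=
  Cut.ext (Set.ext h)

theorem ofVec_eq_wCut {n : ℕ} (hn : 0 < n) (v : Fin n → ℕ+) :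
    Cut.ofVec hn v = wCut hn fun i => (v i, 0) := by
  refine Cut.ext_elems fun x => ⟨fun h => ⟨h.1, h.2, by simp, fun i hi => ?_⟩,
    fun h => ⟨h.1, h.2.1⟩⟩
  exact absurd (congrArg Prod.fst hi) (v i).ne_zero

theorem wCut_one_eq (n : ℕ) (hn : 0 < n) :
    wCut hn (fun _ => (0, 1)) = Cut.ofVec hn fun _ => 1 := by
  refine Cut.ext_elems fun x => ⟨fun h => ⟨h.1, ?_⟩, fun h => ⟨h.1, by simp, ?_, fun i hi => ?_⟩⟩
  · simpa using h.2.2.1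
  · simpa using h.2
  · simp at hi

/-- Both cuts contain only the zero vector. This is why a zero weight contributes a factor F(1). -/
theorem wCut_zero_eq : wCut Nat.one_pos (fun _ : Fin 1 => 0) = Cut.ofVec Nat.one_pos fun _ => 1 := by
  refine Cut.ext_elems fun x => ⟨fun h => ⟨h.1, ?_⟩, fun h => ⟨h.1, by simp, by simp, ?_⟩⟩
  · simpa using h.2.2.2 0 rfl
  · intro i _
    have h1 := h.2
    rw [Fin.fin_one_eq_zero i]
    simpa using h1

/-- Weights in different coordinates satisfy independent equations; the second coordinate of the
weights exists in order to express such products. -/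
theorem wCut_append {m n : ℕ} (hm : 0 < m) (hn : 0 < n) (w : Fin m → ℕ × ℕ) (w' : Fin n → ℕ × ℕ)
    (hw : ∀ i, (w i).1 = 0) (hw' : ∀ i, (w' i).2 = 0) :
    (wCut hm w).prod (wCut hn w') = wCut (Nat.add_pos_left hm n) (Fin.append w w') := by
  refine Cut.ext_elems fun x => ?_
  have h1 : ∑ i, x i * ((Fin.append w w' i).1 : ℝ) = ∑ i, x (Fin.natAdd m i) * ((w' i).1 : ℝ) := by
    rw [Fin.sum_univ_add]
    simp [hw]
  have h2 : ∑ i, x i * ((Fin.append w w' i).2 : ℝ) =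
      ∑ i, x (Fin.castAdd n i) * ((w i).2 : ℝ) := by
    rw [Fin.sum_univ_add]
    simp [hw']
  constructor
  · rintro ⟨h, h'⟩
    refine ⟨fun i => ?_, h1.trans h'.2.1, h2.trans h.2.2.1, fun i => ?_⟩
    · refine Fin.addCases (fun j => ?_) (fun j => ?_) i
      · exact h.1 j
      · exact h'.1 j
    · refine Fin.addCases (fun j => ?_) (fun j => ?_) i
      · rw [Fin.append_left]
        exact h.2.2.2 j
      · rw [Fin.append_right]
        exact h'.2.2.2 j
  · rintro ⟨hc, h, h', hz⟩
    refine ⟨⟨fun i => hc _, ?_, h2.symm.trans h', fun i hi => ?_⟩,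
      ⟨fun i => hc _, h1.symm.trans h, ?_, fun i hi => ?_⟩⟩
    · simp [hw]
    · exact hz _ (by rw [Fin.append_left, hi])
    · simp [hw']
    · exact hz _ (by rw [Fin.append_right, hi])

/-- The weights in a block add up. An index of weight zero has to form a block of its own: in a
larger block it would force the coordinate to vanish, which the sum of the weights does not show. -/
theorem wCut_act {n m : ℕ} (hn : 0 < n) (hm : 0 < m) (w : Fin n → ℕ × ℕ) (f : Fin n → Fin m)
    (hf : Function.Surjective f) (hw : ∀ i j, w i = 0 → f i = f j → i = j) :
    (wCut hn w).act f hf = wCut hm fun j => ∑ i with f i = j, w i := by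
  have hsum : ∀ (t : Fin m → ℝ) (c : Fin n → ℕ),
      ∑ i, (t ∘ f) i * (c i : ℝ) = ∑ j, t j * ((∑ i with f i = j, c i : ℕ) : ℝ) := by
    intro t c
    rw [← Finset.sum_fiberwise Finset.univ f]
    refine Finset.sum_congr rfl fun j _ => ?_
    rw [Nat.cast_sum, Finset.mul_sum]
    refine Finset.sum_congr rfl fun i hi => ?_
    rw [Function.comp_apply, (Finset.mem_filter.1 hi).2]
  refine Cut.ext_elems fun t => ?_
  have h1 := hsum t fun i => (w i).1
  have h2 := hsum t fun i => (w i).2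
  have h3 : ∀ j, (∑ i with f i = j, w i).1 = ∑ i with f i = j, (w i).1 := fun j => Prod.fst_sum
  have h4 : ∀ j, (∑ i with f i = j, w i).2 = ∑ i with f i = j, (w i).2 := fun j => Prod.snd_sum
  constructor
  · rintro ⟨hc, -, h, h', hz⟩
    refine ⟨hc, ?_, ?_, fun j hj => ?_⟩
    · simp only [h3]
      rw [← h1, h]
    · simp only [h4]
      rw [← h2, h']
    · dsimp only at hj
      obtain ⟨i, rfl⟩ := hf j
      refine hz i ?_
      have h5 : (w i).1 ≤ 0 := by
        have h6 : ∑ k with f k = f i, (w k).1 = 0 := by rw [← h3, hj]; rfl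
        rw [← h6]
        exact Finset.single_le_sum (f := fun k => (w k).1) (fun _ _ => Nat.zero_le _)
          (Finset.mem_filter.2 ⟨Finset.mem_univ i, rfl⟩)
      have h5' : (w i).2 ≤ 0 := by
        have h6 : ∑ k with f k = f i, (w k).2 = 0 := by rw [← h4, hj]; rfl
        rw [← h6]
        exact Finset.single_le_sum (f := fun k => (w k).2) (fun _ _ => Nat.zero_le _)
          (Finset.mem_filter.2 ⟨Finset.mem_univ i, rfl⟩)
      exact Prod.ext (Nat.le_zero.1 h5) (Nat.le_zero.1 h5')
  · rintro ⟨hc, h, h', hz⟩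
    refine ⟨hc, fun i => hc _, ?_, ?_, fun i hi => ?_⟩
    · rw [h1]
      simpa only [h3] using h
    · rw [h2]
      simpa only [h4] using h'
    · refine hz (f i) ?_
      dsimp only
      have h5 : (Finset.univ.filter fun k => f k = f i) = {i} := by
        ext k
        simp only [Finset.mem_filter, Finset.mem_univ, true_and, Finset.mem_singleton]
        exact ⟨fun hk => (hw i k hi hk.symm).symm, fun hk => by rw [hk]⟩
      rw [h5, Finset.sum_singleton, hi]

/-! ### Values of a resonance functor up to homotopy equivalence -/

theorem sClosed_empty {n : ℕ} (S : Cut n) : SClosed S ∅ := by simp [SClosed]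

theorem relSpace_empty (F : ResCat ⥤ PSpace.{u}) {n : ℕ} (S : Cut n) :
    PHEquiv (relSpace F S ∅) (F.obj ⟨n, S⟩) :=
  collapse_empty _ (by simp)

/-- The value of `F` at the cut of a multiset of weights, in an arbitrary order. -/
def FW (F : ResCat ⥤ PSpace.{u}) (M : Multiset (ℕ × ℕ)) : PSpace.{u} :=
  if h : 0 < M.toList.length then F.obj ⟨M.toList.length, wCut h M.toList.get⟩ else pointSpace

namespace IsResonanceFunctor

variable {F : ResCat ⥤ PSpace.{u}}

/-- This is (A2) with no partitions at infinity. It makes the value at a multiset of weights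
independent of their order. -/
theorem obj_phequiv_of_equiv (hF : IsResonanceFunctor F) {n n' : ℕ} {S : Cut n} {T : Cut n'}
    (e : Fin n' ≃ Fin n)
    (h : ∀ x, x ∈ S.elems ↔ x ∘ e ∈ T.elems) : PHEquiv (F.obj ⟨n, S⟩) (F.obj ⟨n', T⟩) := by
  obtain rfl : n' = n := by simpa using Fintype.card_congr e
  refine ((relSpace_empty F S).symm.trans ?_).trans (relSpace_empty F T)
  refine hF.rel S T ∅ ∅ (sClosed_empty S) (sClosed_empty T) ⟨e, fun x => ?_, fun π => Iff.rfl⟩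
  simpa [surviving] using h x

theorem wCut_phequiv (hF : IsResonanceFunctor F) {n n' : ℕ} (hn : 0 < n) (hn' : 0 < n')
    {w : Fin n → ℕ × ℕ} {w' : Fin n' → ℕ × ℕ}
    (h : Finset.univ.val.map w = Finset.univ.val.map w') :
    PHEquiv (F.obj ⟨n, wCut hn w⟩) (F.obj ⟨n', wCut hn' w'⟩) := by
  obtain ⟨e, he⟩ := exists_equiv_of_map_eq h.symm
  refine hF.obj_phequiv_of_equiv e fun x => ?_
  have h1 : ∀ c : Fin n → ℕ, ∑ i, (x ∘ e) i * (c (e i) : ℝ) = ∑ i, x i * (c i : ℝ) :=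
    fun c => Equiv.sum_comp e fun i => x i * (c i : ℝ)
  have h2 := h1 fun i => (w i).1
  have h3 := h1 fun i => (w i).2
  simp only [he] at h2 h3
  constructor
  · rintro ⟨hc, ha, hb, hz⟩
    exact ⟨fun i => hc _, h2.trans ha, h3.trans hb, fun i hi => hz _ ((he i).trans hi)⟩
  · rintro ⟨hc, ha, hb, hz⟩
    refine ⟨fun i => ?_, h2.symm.trans ha, h3.symm.trans hb, fun i hi => ?_⟩
    · obtain ⟨k, rfl⟩ := e.surjective i
      exact hc k
    · obtain ⟨k, rfl⟩ := e.surjective i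
      exact hz k ((he k).symm.trans hi)

theorem phequiv_FW (hF : IsResonanceFunctor F) {n : ℕ} (hn : 0 < n) {w : Fin n → ℕ × ℕ}
    {M : Multiset (ℕ × ℕ)} (h : Finset.univ.val.map w = M) :
    PHEquiv (F.obj ⟨n, wCut hn w⟩) (FW F M) := by
  have hl : M.toList.length = n := by
    rw [Multiset.length_toList, ← h]
    simp
  have hpos : 0 < M.toList.length := hl ▸ hn
  rw [FW, dif_pos hpos]
  refine hF.wCut_phequiv hn hpos ?_
  rw [h, Fin.univ_val_map, List.ofFn_get, Multiset.coe_toList]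

theorem phequiv_FW_of_eq (hF : IsResonanceFunctor F) {n : ℕ} (hn : 0 < n) {w : Fin n → ℕ × ℕ}
    {S : Cut n} {M : Multiset (ℕ × ℕ)} (hS : S = wCut hn w) (h : Finset.univ.val.map w = M) :
    PHEquiv (F.obj ⟨n, S⟩) (FW F M) := by
  subst hS
  exact hF.phequiv_FW hn h

/-- Both multisets are images of one labelled multiset, so a single enumeration indexes both cuts
and they can be compared as sets of vectors. -/
theorem FW_congr (hF : IsResonanceFunctor F) {α : Type} {L : Multiset α} (hL : L ≠ 0)
    {p q : α → ℕ × ℕ}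
    (h : ∀ (n : ℕ) (hn : 0 < n) (w : Fin n → α), Finset.univ.val.map w = L →
      wCut hn (p ∘ w) = wCut hn (q ∘ w)) : PHEquiv (FW F (L.map p)) (FW F (L.map q)) := by
  obtain ⟨n, w, hw⟩ := exists_fin_map_eq L
  have hn : 0 < n := by
    rcases Nat.eq_zero_or_pos n with rfl | hn
    · exact absurd hw.symm (by simpa using hL)
    · exact hn
  have h1 := hF.phequiv_FW hn (w := p ∘ w) (M := L.map p) (by rw [← hw, Multiset.map_map])
  have h2 := hF.phequiv_FW hn (w := q ∘ w) (M := L.map q) (by rw [← hw, Multiset.map_map])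
  rw [h n hn w hw] at h1
  exact h1.symm.trans h2

theorem smash_phequiv (hF : IsResonanceFunctor F) {m n : ℕ} (S : Cut m) (T : Cut n) :
    PHEquiv (smash (F.obj ⟨m, S⟩) (F.obj ⟨n, T⟩)) (F.obj ⟨m + n, S.prod T⟩) := by
  have h0 : prodInf (∅ : Set (Setoid (Fin m))) (∅ : Set (Setoid (Fin n))) = ∅ := by
    simp [prodInf]
  have h := hF.prod S T ∅ ∅ (sClosed_empty S) (sClosed_empty T)
  rw [h0] at h
  exact ((PHEquiv.smash (relSpace_empty F S) (relSpace_empty F T)).symm.trans h).trans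
    (relSpace_empty F _)

theorem smash_phequiv_FW (hF : IsResonanceFunctor F) {m n : ℕ} (hm : 0 < m) (hn : 0 < n)
    (w : Fin m → ℕ × ℕ) (w' : Fin n → ℕ × ℕ)
    (hw : ∀ i, (w i).1 = 0) (hw' : ∀ i, (w' i).2 = 0) :
    PHEquiv (smash (F.obj ⟨m, wCut hm w⟩) (F.obj ⟨n, wCut hn w'⟩))
      (FW F (Finset.univ.val.map w + Finset.univ.val.map w')) :=
  (hF.smash_phequiv _ _).trans
    (hF.phequiv_FW_of_eq _ (wCut_append hm hn w w' hw hw') (univ_map_append w w'))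

theorem FW_zero_phequiv (hF : IsResonanceFunctor F) (j : ℕ) :
    PHEquiv (FW F (Multiset.replicate (j + 1) 0))
      (smashPow (F.obj (resOf Nat.one_pos fun _ : Fin 1 => 1)) (j + 1)) := by
  have h1 : PHEquiv (F.obj (resOf Nat.one_pos fun _ : Fin 1 => 1)) (FW F {0}) :=
    hF.phequiv_FW_of_eq Nat.one_pos wCut_zero_eq.symm (univ_map_const 1 0)
  induction j with
  | zero => exact h1.symm.trans (smash_sphere_zero _).symm
  | succ j ih =>
    have h2 := hF.smash_phequiv_FW Nat.one_pos j.succ_pos (fun _ => 0) (fun _ => 0)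
      (fun _ => rfl) (fun _ => rfl)
    rw [univ_map_const, univ_map_const, ← Multiset.replicate_add, add_comm 1] at h2
    refine h2.symm.trans (PHEquiv.smash ?_ ?_)
    · exact (hF.phequiv_FW Nat.one_pos (univ_map_const 1 0)).trans h1.symm
    · exact (hF.phequiv_FW j.succ_pos (univ_map_const _ 0)).trans ih

/-- By (A3) the value has the contractible space F(1^k) as a smash factor. -/
theorem pcontractible_FW_of_ones (hF : IsResonanceFunctor F)
    (hcontr : ∀ (l : ℕ) (hl : 0 < l), 2 ≤ l →
      ContractibleSpace (F.obj (resOf hl fun _ : Fin l => 1))) {k : ℕ} (hk : 2 ≤ k)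
    (ν : Multiset ℕ) :
    PContractible (FW F (Multiset.replicate k (0, 1) + ν.map fun s => (s, 0))) := by
  have hk0 : 0 < k := by omega
  have h1 : PContractible (F.obj ⟨k, wCut hk0 fun _ => (0, 1)⟩) := by
    rw [wCut_one_eq]
    exact @pcontractible_of_contractible _ (hF.wellPointed _) (hcontr k hk0 hk)
  obtain ⟨n, s, rfl⟩ := exists_fin_map_eq ν
  -- A cut has at least one index, so for empty `ν` there is no second factor.
  rcases Nat.eq_zero_or_pos n with rfl | hn
  · refine h1.phequiv (hF.phequiv_FW hk0 ?_)
    rw [univ_map_const]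
    simp
  · refine (h1.smash_left _).phequiv ((hF.smash_phequiv_FW hk0 hn (fun _ => (0, 1))
      (fun i => (s i, 0)) (fun _ => rfl) fun _ => rfl).trans ?_)
    rw [univ_map_const, Multiset.map_map]
    exact PHEquiv.refl _

end IsResonanceFunctor

/-! ### Collections of multisubsets reachable from a partition -/

section Collections

variable {n : ℕ}

/-- The collection of singletons of the elements of a set. -/
def singles (U : Finset (Fin n)) : Multiset (Multiset (Fin n)) := U.val.map fun i => {i}

theorem singles_eq_sum (U : Finset (Fin n)) : singles U = ∑ i ∈ U, {{i}} := by
  have h := Multiset.sum_map_singleton (U.val.map fun i => ({i} : Multiset (Fin n)))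
  rw [Multiset.map_map] at h
  exact h.symm

theorem singles_sum (U : Finset (Fin n)) : (singles U).sum = U.val :=
  Multiset.sum_map_singleton _

theorem singles_union {U V : Finset (Fin n)} (h : Disjoint U V) :
    singles (U ∪ V) = singles U + singles V := by
  rw [singles_eq_sum, singles_eq_sum, singles_eq_sum, Finset.sum_union h]

theorem Down.trans {S : Cut n} {A B C : Multiset (Multiset (Fin n))} (h : Down S A B)
    (h' : Down S B C) : Down S A C := by
  induction h' with
  | refl => exact h
  | merge _ ih => exact ih.merge
  | swap _ hx hp ih => exact ih.swap hx hp

theorem Down.mono {S T : Cut n} (hTS : T.elems ⊆ S.elems) {A B : Multiset (Multiset (Fin n))}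
    (h : Down T A B) : Down S A B := by
  induction h with
  | refl => exact Down.refl
  | merge _ ih => exact ih.merge
  | swap _ hx hp ih => exact ih.swap (hTS hx) hp

theorem sClosed_downSet (π : Setoid (Fin n)) (S : Cut n) : SClosed S (downSet π S) := by
  ext τ
  simp only [Set.mem_iUnion]
  constructor
  · rintro ⟨ρ, h1, h2⟩
    exact Down.trans h1 h2
  · intro h
    exact ⟨τ, h, Down.refl⟩

theorem Down.merge_sum {S : Cut n} {A : Multiset (Multiset (Fin n))}
    (Q : Multiset (Multiset (Fin n))) (hQ : Q ≠ 0) (R : Multiset (Multiset (Fin n)))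
    (h : Down S A (Q + R)) : Down S A (Q.sum ::ₘ R) := by
  induction Q using Multiset.induction generalizing R with
  | empty => exact absurd rfl hQ
  | cons B Q ih =>
    by_cases hQ0 : Q = 0
    · subst hQ0
      simpa using h
    · have h1 := ih hQ0 (B ::ₘ R) (by rwa [Multiset.add_cons, ← Multiset.cons_add])
      rw [Multiset.sum_cons, add_comm B]
      exact h1.merge

theorem Down.merge_family {S : Cut n} {A : Multiset (Multiset (Fin n))} {γ : Type}
    (𝒞 : Finset γ) (q : γ → Multiset (Multiset (Fin n))) (hq : ∀ c ∈ 𝒞, q c ≠ 0)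
    (R : Multiset (Multiset (Fin n))) (h : Down S A (∑ c ∈ 𝒞, q c + R)) :
    Down S A (𝒞.val.map (fun c => (q c).sum) + R) := by
  classical
  induction 𝒞 using Finset.induction generalizing R with
  | empty => simpa using h
  | insert c 𝒞 hc ih =>
    rw [Finset.sum_insert hc, add_assoc] at h
    have h1 := h.merge_sum (q c) (hq c (Finset.mem_insert_self _ _))
    rw [← Multiset.add_cons] at h1
    have h2 := ih (fun c' hc' => hq c' (Finset.mem_insert_of_mem hc')) _ h1
    rwa [Finset.insert_val_of_notMem hc, Multiset.map_cons, Multiset.cons_add,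
      ← Multiset.add_cons]

/-- The sign vector with plus set `P` and minus set `Q`. -/
def signVec (P Q : Finset (Fin n)) (i : Fin n) : ℝ := if i ∈ P then 1 else if i ∈ Q then -1 else 0

theorem plusSet_signVec (P Q : Finset (Fin n)) : plusSet (signVec P Q) = P := by
  ext i
  rw [mem_plusSet, signVec]
  split_ifs with h1 h2
  · simp [h1]
  · simp [h1]; norm_num
  · simp [h1]

theorem minusSet_signVec {P Q : Finset (Fin n)} (h : Disjoint P Q) :
    minusSet (signVec P Q) = Q := by
  ext i
  rw [mem_minusSet, signVec]
  split_ifs with h1 h2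
  · have := Finset.disjoint_left.1 h h1
    simp [this]; norm_num
  · simp [h2]
  · simp [h2]

theorem signVec_mem_signCube (P Q : Finset (Fin n)) : signVec P Q ∈ signCube n := by
  intro i
  unfold signVec
  split_ifs <;> simp

theorem sum_signVec {P Q : Finset (Fin n)} (h : Disjoint P Q) (c : Fin n → ℝ) :
    ∑ i, signVec P Q i * c i = ∑ i ∈ P, c i - ∑ i ∈ Q, c i := by
  have h1 : ∀ i, signVec P Q i * c i = (if i ∈ P then c i else 0) - if i ∈ Q then c i else 0 := by
    intro i
    unfold signVec
    split_ifs with h1 h2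
    · exact absurd h2 (Finset.disjoint_left.1 h h1)
    · simp
    · simp
    · simp
  simp [h1, Finset.sum_sub_distrib]

/-- A finite set of pairwise divisible numbers that all divide `d` and have sum at least `d` has a
subset with sum `d`. -/
theorem exists_subset_sum_eq {ι : Type} (s : ι → ℕ) (U : Finset ι) (d : ℕ)
    (hpos : ∀ u ∈ U, 0 < s u) (hchain : ∀ u ∈ U, ∀ v ∈ U, s u ∣ s v ∨ s v ∣ s u)
    (hd : ∀ u ∈ U, s u ∣ d) (hle : d ≤ ∑ u ∈ U, s u) : ∃ V ⊆ U, ∑ u ∈ V, s u = d := by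
  classical
  induction hc : U.card generalizing U d with
  | zero =>
    rw [Finset.card_eq_zero] at hc
    subst hc
    exact ⟨∅, subset_rfl, (Nat.le_zero.1 hle).symm⟩
  | succ c ih =>
    rcases Nat.eq_zero_or_pos d with rfl | hd0
    · exact ⟨∅, Finset.empty_subset _, rfl⟩
    -- The largest number is used first. All others divide it as well as `d`, hence also the
    -- difference that remains to be filled.
    obtain ⟨u, hu, hmax⟩ := Finset.exists_max_image U s (Finset.card_pos.1 (by omega))
    have hud : s u ≤ d := Nat.le_of_dvd hd0 (hd u hu)
    have hdvd : ∀ v ∈ U, s v ∣ s u := by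
      intro v hv
      rcases hchain v hv u hu with h | h
      · exact h
      · rw [le_antisymm (hmax v hv) (Nat.le_of_dvd (hpos v hv) h)]
    have hsum := Finset.add_sum_erase U s hu
    obtain ⟨V, hV, hVs⟩ := ih (U.erase u) (d - s u)
      (fun v hv => hpos v (Finset.mem_of_mem_erase hv))
      (fun v hv v' hv' => hchain v (Finset.mem_of_mem_erase hv) v' (Finset.mem_of_mem_erase hv'))
      (fun v hv => Nat.dvd_sub (hd v (Finset.mem_of_mem_erase hv))
        (hdvd v (Finset.mem_of_mem_erase hv))) (by omega)
      (by rw [Finset.card_erase_of_mem hu, hc]; rfl)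
    refine ⟨insert u V, Finset.insert_subset hu (hV.trans (Finset.erase_subset _ _)), ?_⟩
    rw [Finset.sum_insert fun h => (Finset.mem_erase.1 (hV h)).1 rfl, hVs]
    omega

/-- Only the symmetric difference is exchanged, since the plus and minus sets of a sign vector are
disjoint; the intersection stays in the block. -/
theorem Down.swap_block {T : Cut n} {A R : Multiset (Multiset (Fin n))} {B B' : Finset (Fin n)}
    (hT : signVec (B \ B') (B' \ B) ∈ T.elems) (h : Down T A (B.val ::ₘ R)) :
    Down T A (B'.val ::ₘ R) := by
  have hdis : Disjoint (B \ B') (B' \ B) := disjoint_sdiff_sdiff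
  have h1 := h.swap hT (by
    rw [plusSet_signVec]
    exact Finset.val_le_iff.2 Finset.sdiff_subset)
  rw [plusSet_signVec, minusSet_signVec hdis, ← Finset.sdiff_val, Finset.sdiff_sdiff_self_left] at h1
  have h2 : (B ∩ B').val + (B' \ B).val = B'.val := by
    have h3 : Disjoint (B ∩ B') (B' \ B) :=
      Finset.disjoint_left.2 fun i hi hi' => (Finset.mem_sdiff.1 hi').2 (Finset.mem_inter.1 hi).1
    rw [← Finset.disjUnion_val _ _ h3, Finset.disjUnion_eq_union]
    congr 1
    ext i
    simp only [Finset.mem_union, Finset.mem_inter, Finset.mem_sdiff]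
    tauto
  rwa [h2] at h1

/-- The elements of `V` are produced one at a time. The weights in `U` divide the weight of `v`, so
some part of `U` has exactly this weight; it is merged into one block and exchanged for `v`. -/
theorem Down.swap_singles {T : Cut n} {A : Multiset (Multiset (Fin n))} {s : Fin n → ℕ}
    {N : Finset (Fin n)} (hpos : ∀ i ∈ N, 0 < s i)
    (hchain : ∀ i ∈ N, ∀ j ∈ N, s i ∣ s j ∨ s j ∣ s i)
    (hT : ∀ P ⊆ N, ∀ Q ⊆ N, Disjoint P Q → ∑ i ∈ P, s i = ∑ i ∈ Q, s i →
      signVec P Q ∈ T.elems) (V : Finset (Fin n)) :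
    ∀ (U : Finset (Fin n)) (R : Multiset (Multiset (Fin n))), U ⊆ N → V ⊆ N → Disjoint U V →
      ∑ i ∈ U, s i = ∑ i ∈ V, s i → (∀ u ∈ U, ∀ v ∈ V, s u ∣ s v) →
      Down T A (singles U + R) → Down T A (singles V + R) := by
  induction V using Finset.induction with
  | empty =>
    intro U R hU _ _ hsum _ h
    have : U = ∅ := by
      refine Finset.eq_empty_of_forall_notMem fun u hu => ?_
      rw [Finset.sum_empty, Finset.sum_eq_zero_iff] at hsum
      exact (hpos u (hU hu)).ne' (hsum u hu)
    rwa [this] at h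
  | insert v V hv ih =>
    intro U R hU hV hdis hsum hdvd h
    have hvN := hV (Finset.mem_insert_self v V)
    rw [Finset.sum_insert hv] at hsum
    obtain ⟨U', hU', hs⟩ := exists_subset_sum_eq s U (s v) (fun u hu => hpos u (hU hu))
      (fun u hu u' hu' => hchain u (hU hu) u' (hU hu'))
      (fun u hu => hdvd u hu v (Finset.mem_insert_self v V)) (by omega)
    have hvU : v ∉ U := fun h => Finset.disjoint_left.1 hdis h (Finset.mem_insert_self v V)
    have hU'0 : singles U' ≠ 0 := by
      intro h0
      rw [singles, Multiset.map_eq_zero, Finset.val_eq_zero] at h0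
      rw [h0, Finset.sum_empty] at hs
      exact (hpos v hvN).ne hs
    have e : singles U = singles U' + singles (U \ U') := by
      rw [← singles_union Finset.disjoint_sdiff, Finset.union_sdiff_of_subset hU']
    rw [e, add_assoc] at h
    have h1 := h.merge_sum _ hU'0
    rw [singles_sum] at h1
    have hvU' : Disjoint U' {v} := Finset.disjoint_singleton_right.2 fun h => hvU (hU' h)
    have h2 : Down T A (({v} : Finset (Fin n)).val ::ₘ (singles (U \ U') + R)) := by
      refine h1.swap_block ?_
      rw [Finset.sdiff_eq_self_of_disjoint hvU', Finset.sdiff_eq_self_of_disjoint hvU'.symm]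
      exact hT _ (hU'.trans hU) _ (Finset.singleton_subset_iff.2 hvN) hvU'
        (by rw [hs, Finset.sum_singleton])
    rw [← Multiset.add_cons] at h2
    have hsd := Finset.sum_sdiff (f := s) hU'
    have h3 := ih (U \ U') _ (Finset.sdiff_subset.trans hU)
      ((Finset.subset_insert _ _).trans hV)
      (hdis.mono Finset.sdiff_subset (Finset.subset_insert _ _)) (by omega)
      (fun u hu v' hv' => hdvd u (Finset.sdiff_subset hu) v' (Finset.mem_insert_of_mem hv')) h2
    rw [singles, Finset.insert_val_of_notMem hv, Multiset.map_cons, Multiset.cons_add,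
      ← Multiset.add_cons]
    exact h3

/-! ### Classes of a partition, and the partitions reached by merging -/

open scoped Classical in
/-- The blocks of a partition as finite sets. -/
def classes (π : Setoid (Fin n)) : Finset (Finset (Fin n)) :=
  Finset.univ.image fun i => Finset.univ.filter fun j => π i j

theorem blocks_eq (π : Setoid (Fin n)) : blocks π = (classes π).val.map Finset.val := rfl

theorem exists_of_mem_classes {π : Setoid (Fin n)} {C : Finset (Fin n)} (h : C ∈ classes π) :
    ∃ i, ∀ j, j ∈ C ↔ π i j := by
  classical
  obtain ⟨i, -, rfl⟩ := Finset.mem_image.1 h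
  exact ⟨i, fun j => by simp⟩

theorem exists_mem_classes (π : Setoid (Fin n)) (i : Fin n) :
    ∃ C ∈ classes π, ∀ j, j ∈ C ↔ π i j := by
  classical
  exact ⟨_, Finset.mem_image_of_mem _ (Finset.mem_univ i), fun j => by simp⟩

theorem classes_eq_of_mem {π : Setoid (Fin n)} {C C' : Finset (Fin n)} (h : C ∈ classes π)
    (h' : C' ∈ classes π) {i : Fin n} (hi : i ∈ C) (hi' : i ∈ C') : C = C' := by
  obtain ⟨k, hk⟩ := exists_of_mem_classes h
  obtain ⟨k', hk'⟩ := exists_of_mem_classes h'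
  have e : π k k' := π.trans ((hk i).1 hi) (π.symm ((hk' i).1 hi'))
  ext j
  rw [hk, hk']
  exact ⟨fun h => π.trans (π.symm e) h, fun h => π.trans e h⟩

theorem nonempty_of_mem_classes {π : Setoid (Fin n)} {C : Finset (Fin n)} (h : C ∈ classes π) :
    C.Nonempty := by
  obtain ⟨k, hk⟩ := exists_of_mem_classes h
  exact ⟨k, (hk k).2 (π.refl k)⟩

theorem sum_classes {M : Type} [AddCommMonoid M] (π : Setoid (Fin n)) (g : Fin n → M) :
    ∑ C ∈ classes π, ∑ i ∈ C, g i = ∑ i, g i := by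
  classical
  have hu : (classes π).biUnion id = Finset.univ := by
    ext i
    obtain ⟨C, hC, h⟩ := exists_mem_classes π i
    simp only [Finset.mem_biUnion, Finset.mem_univ, iff_true]
    exact ⟨C, hC, (h i).2 (π.refl i)⟩
  rw [← hu, Finset.sum_biUnion]
  · rfl
  · intro C hC C' hC' hne
    exact Finset.disjoint_left.2 fun i hi hi' => hne (classes_eq_of_mem hC hC' hi hi')

theorem blocks_of_block {π : Setoid (Fin n)} {B : Finset (Fin n)} (hB : B.Nonempty)
    (hπ : ∀ i j, π i j ↔ i = j ∨ i ∈ B ∧ j ∈ B) : blocks π = B.val ::ₘ singles Bᶜ := by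
  classical
  have h1 : classes π = insert B (Bᶜ.image fun i => {i}) := by
    ext C
    rw [Finset.mem_insert, Finset.mem_image]
    constructor
    · intro h
      obtain ⟨i, hi⟩ := exists_of_mem_classes h
      by_cases hiB : i ∈ B
      · left
        ext j
        rw [hi, hπ]
        exact ⟨by rintro (rfl | h); exacts [hiB, h.2], fun h => Or.inr ⟨hiB, h⟩⟩
      · right
        refine ⟨i, Finset.mem_compl.2 hiB, ?_⟩
        ext j
        rw [hi, hπ, Finset.mem_singleton]
        exact ⟨fun h => Or.inl h.symm, by rintro (rfl | h); exacts [rfl, absurd h.1 hiB]⟩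
    · rintro (rfl | ⟨i, hi, rfl⟩)
      · obtain ⟨i, hi⟩ := hB
        obtain ⟨C', hC', h⟩ := exists_mem_classes π i
        have : C = C' := by
          ext j
          rw [h, hπ]
          exact ⟨fun h => Or.inr ⟨hi, h⟩, by rintro (rfl | h); exacts [hi, h.2]⟩
        rwa [this]
      · obtain ⟨C', hC', h⟩ := exists_mem_classes π i
        have : {i} = C' := by
          ext j
          rw [h, hπ, Finset.mem_singleton]
          exact ⟨fun h => Or.inl h.symm,
            by rintro (rfl | h); exacts [rfl, absurd h.1 (Finset.mem_compl.1 hi)]⟩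
        rwa [this]
  have h2 : B ∉ Bᶜ.image fun i => ({i} : Finset (Fin n)) := by
    intro h
    obtain ⟨i, hi, h3⟩ := Finset.mem_image.1 h
    refine Finset.mem_compl.1 hi ?_
    rw [← h3]
    exact Finset.mem_singleton_self i
  rw [blocks_eq, h1, Finset.insert_val_of_notMem h2, Multiset.map_cons,
    Finset.image_val_of_injOn fun i _ j _ h => Finset.singleton_injective h, Multiset.map_map]
  rfl

/-- Each class of `τ` is assembled from singletons outside `B`, together with `B` for the class that
contains it; no swaps are needed. -/
theorem Down.of_block {T : Cut n} {A : Multiset (Multiset (Fin n))} {τ : Setoid (Fin n)}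
    {B : Finset (Fin n)} (hB : B.Nonempty) (hτ : ∀ i ∈ B, ∀ j ∈ B, τ i j)
    (h : Down T A (B.val ::ₘ singles Bᶜ)) : Down T A (blocks τ) := by
  classical
  obtain ⟨b, hb⟩ := hB
  obtain ⟨C₀, hC₀, hmem⟩ := exists_mem_classes τ b
  have hBC : B ⊆ C₀ := fun i hi => (hmem i).2 (hτ b hb i hi)
  have hdis : ∀ C ∈ classes τ, C ≠ C₀ → C \ B = C := by
    intro C hC hne
    refine Finset.sdiff_eq_self_of_disjoint (Finset.disjoint_left.2 fun i hi hi' => ?_)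
    exact hne (classes_eq_of_mem hC hC₀ hi (hBC hi'))
  let q : Finset (Fin n) → Multiset (Multiset (Fin n)) := fun C =>
    singles (C \ B) + if C = C₀ then {B.val} else 0
  have hq : ∑ C ∈ classes τ, q C = B.val ::ₘ singles Bᶜ := by
    have h1 : ∀ C, singles (C \ B) = ∑ i ∈ C, if i ∈ B then 0 else {{i}} := by
      intro C
      rw [singles_eq_sum, ← Finset.filter_notMem_eq_sdiff, Finset.sum_filter]
      refine Finset.sum_congr rfl fun i _ => ?_
      split_ifs <;> rfl
    simp only [q]
    rw [Finset.sum_add_distrib, Finset.sum_ite_eq' (classes τ) C₀, if_pos hC₀,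
      Finset.sum_congr rfl fun C _ => h1 C, sum_classes, ← h1, add_comm, Multiset.singleton_add,
      Finset.compl_eq_univ_sdiff]
  rw [← hq, ← add_zero (∑ C ∈ classes τ, q C)] at h
  have h2 := h.merge_family (classes τ) q (fun C hC h0 => ?_) 0
  · rw [add_zero] at h2
    convert h2 using 1
    rw [blocks_eq]
    refine Multiset.map_congr rfl fun C hC => ?_
    simp only [q]
    rw [Multiset.sum_add, singles_sum]
    split_ifs with h3
    · rw [Multiset.sum_singleton, Finset.sdiff_val, h3,
        tsub_add_cancel_of_le (Finset.val_le_iff.2 hBC)]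
    · rw [hdis C hC h3, Multiset.sum_zero, add_zero]
  · simp only [q] at h0
    split_ifs at h0 with h3
    · simp at h0
    · rw [add_zero, hdis C hC h3, singles, Multiset.map_eq_zero, Finset.val_eq_zero] at h0
      exact (nonempty_of_mem_classes hC).ne_empty h0

/-- A monovariant. A swap preserves the weight of each member, and a merge cannot lower the sum
because ⌊x/a⌋ + ⌊y/a⌋ ≤ ⌊(x + y)/a⌋. -/
theorem Down.le_sum_div {S : Cut n} {A Z : Multiset (Multiset (Fin n))} (s : Fin n → ℕ) (a : ℕ)
    (hS : ∀ x ∈ S.elems, ∑ i ∈ plusSet x, s i = ∑ i ∈ minusSet x, s i) (h : Down S A Z) :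
    (A.map fun β => (β.map s).sum / a).sum ≤ (Z.map fun β => (β.map s).sum / a).sum := by
  induction h with
  | refl => exact le_rfl
  | merge _ ih =>
    refine ih.trans ?_
    simp only [Multiset.map_cons, Multiset.sum_cons, Multiset.map_add, Multiset.sum_add]
    rw [← add_assoc]
    exact Nat.add_le_add_right (Nat.div_add_div_le_add_div) _
  | @swap B R x _ hx hp ih =>
    refine ih.trans (le_of_eq ?_)
    have h1 : ((B - (plusSet x).val + (minusSet x).val).map s).sum = (B.map s).sum := by
      conv_rhs => rw [← tsub_add_cancel_of_le hp]
      rw [Multiset.map_add, Multiset.map_add, Multiset.sum_add, Multiset.sum_add]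
      exact congrArg _ (hS x hx).symm
    rw [Multiset.map_cons, Multiset.map_cons, h1]

end Collections

/-! ### Quotients by merging a block of small weights -/

/-- The weights `s` on the indices in `D` are all equal to `a`, those on the indices in `N` form a
chain of positive divisors of `a`, and all others vanish. -/
structure ChainSplit {n : ℕ} (s : Fin n → ℕ) (a : ℕ) (D N : Finset (Fin n)) : Prop where
  pos : 0 < a
  disj : Disjoint D N
  big : ∀ i ∈ D, s i = a
  small_pos : ∀ i ∈ N, 0 < s i
  small_dvd : ∀ i ∈ N, s i ∣ a
  zero : ∀ i, i ∉ D → i ∉ N → s i = 0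
  chain : ∀ i ∈ N, ∀ j ∈ N, s i ∣ s j ∨ s j ∣ s i

/-- The cut of a vector of weights, where weight zero forces the coordinate to vanish. -/
def sCut {n : ℕ} (hn : 0 < n) (s : Fin n → ℕ) : Cut n := wCut hn fun i => (s i, 0)

/-- The cut of a vector of weights in which the indices in `D` are separated from the others and
are given equal weights. -/
def tCut {n : ℕ} (hn : 0 < n) (s : Fin n → ℕ) (D : Finset (Fin n)) : Cut n :=
  wCut hn fun i => if i ∈ D then (0, 1) else (s i, 0)

theorem sum_mul_of_mem_signCube {n : ℕ} {x : Fin n → ℝ} (hx : x ∈ signCube n) (c : Fin n → ℝ) :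
    ∑ i, x i * c i = ∑ i ∈ plusSet x, c i - ∑ i ∈ minusSet x, c i := by
  have hd : Disjoint (plusSet x) (minusSet x) := by
    refine Finset.disjoint_left.2 fun i h h' => ?_
    have h1 := mem_plusSet.1 h
    have h2 := mem_minusSet.1 h'
    linarith
  rw [← sum_signVec hd]
  refine Finset.sum_congr rfl fun i _ => ?_
  congr 1
  unfold signVec
  rcases hx i with h | h | h <;> simp [mem_plusSet, mem_minusSet, h]

namespace ChainSplit

variable {n : ℕ} {s : Fin n → ℕ} {a : ℕ} {D N B : Finset (Fin n)}

theorem sum_eq (h : ChainSplit s a D N) (x : Fin n → ℝ) :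
    ∑ i, x i * (s i : ℝ) = a * ∑ i ∈ D, x i + ∑ i ∈ N, x i * (s i : ℝ) := by
  rw [Finset.mul_sum, ← Finset.sum_congr rfl fun i hi => show x i * (s i : ℝ) = a * x i by
    rw [h.big i hi, mul_comm], ← Finset.sum_union h.disj]
  refine (Finset.sum_subset (Finset.subset_univ _) fun i _ hi => ?_).symm
  rw [Finset.mem_union, not_or] at hi
  rw [h.zero i hi.1 hi.2, Nat.cast_zero, mul_zero]

theorem mem_sCut_iff (h : ChainSplit s a D N) (hn : 0 < n) {x : Fin n → ℝ} :
    x ∈ (sCut hn s).elems ↔ x ∈ signCube n ∧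
      a * ∑ i ∈ D, x i + ∑ i ∈ N, x i * (s i : ℝ) = 0 ∧ ∀ i, i ∉ D → i ∉ N → x i = 0 := by
  rw [← h.sum_eq]
  constructor
  · rintro ⟨h1, h2, -, h3⟩
    exact ⟨h1, h2, fun i hi hi' => h3 i (by dsimp only; rw [h.zero i hi hi']; rfl)⟩
  · rintro ⟨h1, h2, h3⟩
    refine ⟨h1, h2, by simp, fun i hi => h3 i (fun hD => ?_) fun hN => ?_⟩
    · exact h.pos.ne' ((h.big i hD).symm.trans (congrArg Prod.fst hi))
    · exact (h.small_pos i hN).ne' (congrArg Prod.fst hi)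

theorem mem_tCut_iff (h : ChainSplit s a D N) (hn : 0 < n) {x : Fin n → ℝ} :
    x ∈ (tCut hn s D).elems ↔ x ∈ signCube n ∧ ∑ i ∈ D, x i = 0 ∧
      ∑ i ∈ N, x i * (s i : ℝ) = 0 ∧ ∀ i, i ∉ D → i ∉ N → x i = 0 := by
  have h1 : ∑ i, x i * (((if i ∈ D then ((0, 1) : ℕ × ℕ) else (s i, 0)).1 : ℕ) : ℝ) =
      ∑ i ∈ N, x i * (s i : ℝ) := by
    refine Eq.symm ((Finset.sum_congr rfl fun i hi => ?_).trans
      (Finset.sum_subset (Finset.subset_univ N) fun i _ hi => ?_))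
    · rw [if_neg (Finset.disjoint_right.1 h.disj hi)]
    · split_ifs with hD
      · simp
      · simp [h.zero i hD hi]
  have h2 : ∑ i, x i * (((if i ∈ D then ((0, 1) : ℕ × ℕ) else (s i, 0)).2 : ℕ) : ℝ) =
      ∑ i ∈ D, x i := by
    refine Eq.symm ((Finset.sum_congr rfl fun i hi => ?_).trans
      (Finset.sum_subset (Finset.subset_univ D) fun i _ hi => ?_))
    · simp [hi]
    · simp [hi]
  constructor
  · rintro ⟨h3, h4, h5, h6⟩
    exact ⟨h3, h2 ▸ h5, h1 ▸ h4, fun i hi hi' => h6 i (by dsimp only; rw [if_neg hi, h.zero i hi hi']; rfl)⟩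
  · rintro ⟨h3, h4, h5, h6⟩
    refine ⟨h3, h1.trans h5, h2.trans h4, fun i hi => h6 i (fun hD => ?_) fun hN => ?_⟩
    · dsimp only at hi
      rw [if_pos hD] at hi
      exact one_ne_zero (congrArg Prod.snd hi)
    · dsimp only at hi
      rw [if_neg (Finset.disjoint_right.1 h.disj hN)] at hi
      exact (h.small_pos i hN).ne' (congrArg Prod.fst hi)

theorem tCut_subset (h : ChainSplit s a D N) (hn : 0 < n) :
    (tCut hn s D).elems ⊆ (sCut hn s).elems := by
  intro x hx
  obtain ⟨h1, h2, h3, h4⟩ := (h.mem_tCut_iff hn).1 hx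
  exact (h.mem_sCut_iff hn).2 ⟨h1, by rw [h2, h3, mul_zero, add_zero], h4⟩

theorem signVec_mem (h : ChainSplit s a D N) (hn : 0 < n) {P Q : Finset (Fin n)} (hP : P ⊆ N)
    (hQ : Q ⊆ N) (hd : Disjoint P Q) (hs : ∑ i ∈ P, s i = ∑ i ∈ Q, s i) :
    signVec P Q ∈ (tCut hn s D).elems := by
  have h0 : ∀ i, i ∉ N → signVec P Q i = 0 := by
    intro i hi
    rw [signVec, if_neg fun hi' => hi (hP hi'), if_neg fun hi' => hi (hQ hi')]
  refine (h.mem_tCut_iff hn).2 ⟨signVec_mem_signCube _ _, ?_, ?_, fun i _ hi => h0 i hi⟩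
  · exact Finset.sum_eq_zero fun i hi => h0 i (Finset.disjoint_left.1 h.disj hi)
  · rw [Finset.sum_subset (Finset.subset_univ N) fun i _ hi => by rw [h0 i hi, zero_mul],
      sum_signVec hd, sub_eq_zero]
    exact_mod_cast hs

theorem exists_subset (h : ChainSplit s a D N) {U : Finset (Fin n)} (hU : U ⊆ N)
    (hle : a ≤ ∑ i ∈ U, s i) : ∃ B ⊆ U, ∑ i ∈ B, s i = a :=
  exists_subset_sum_eq s U a (fun i hi => h.small_pos i (hU hi))
    (fun i hi j hj => h.chain i (hU hi) j (hU hj)) (fun i hi => h.small_dvd i (hU hi)) hle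

theorem nonempty_of_sum (h : ChainSplit s a D N) (hB : ∑ i ∈ B, s i = a) : B.Nonempty := by
  rw [Finset.nonempty_iff_ne_empty]
  rintro rfl
  exact h.pos.ne hB

/-- If the large coordinates do not cancel, their sum is a nonzero integer, so the small coordinates
contribute at least `a` with the opposite sign. Those of that sign weigh at least `a`, and since the
weights form a chain of divisors of `a`, some of them weigh exactly `a`. -/
theorem exists_subset_of_notMem (h : ChainSplit s a D N) (hn : 0 < n) {x : Fin n → ℝ}
    (hx : x ∈ (sCut hn s).elems) (hx' : x ∉ (tCut hn s D).elems) :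
    ∃ B ⊆ N, ∑ i ∈ B, s i = a ∧ ∀ i ∈ B, ∀ j ∈ B, signPart x i j := by
  classical
  obtain ⟨h1, h2, h3⟩ := (h.mem_sCut_iff hn).1 hx
  have hD : ∑ i ∈ D, x i ≠ 0 := fun h4 =>
    hx' ((h.mem_tCut_iff hn).2 ⟨h1, h4, by rwa [h4, mul_zero, zero_add] at h2, h3⟩)
  have hz : ∀ i, ∃ z : ℤ, x i = z := by
    intro i
    rcases h1 i with h | h | h
    · exact ⟨-1, by simp [h]⟩
    · exact ⟨0, by simp [h]⟩
    · exact ⟨1, by simp [h]⟩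
  choose z hz using hz
  have hDz : ∑ i ∈ D, x i = ((∑ i ∈ D, z i : ℤ) : ℝ) := by
    rw [Int.cast_sum]
    exact Finset.sum_congr rfl fun i _ => hz i
  have ha : (0 : ℝ) < a := by exact_mod_cast h.pos
  -- Used for e = 1 and e = -1, the sign of the small coordinates that are collected.
  have hle : ∀ e : ℝ, e ≠ 0 → (∀ i ∈ N, x i * e ≤ 1 ∧ (x i ≠ e⁻¹ → x i * e ≤ 0)) →
      (a : ℝ) ≤ ∑ i ∈ N, x i * e * s i → a ≤ ∑ i ∈ N.filter fun i => x i = e⁻¹, s i := by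
    intro e he h4 h5
    have h6 : ∑ i ∈ N, x i * e * s i ≤ ((∑ i ∈ N.filter fun i => x i = e⁻¹, s i : ℕ) : ℝ) := by
      rw [Nat.cast_sum, Finset.sum_filter]
      refine Finset.sum_le_sum fun i hi => ?_
      split_ifs with h7
      · rw [h7, inv_mul_cancel₀ he, one_mul]
      · exact mul_nonpos_of_nonpos_of_nonneg ((h4 i hi).2 h7) (Nat.cast_nonneg _)
    exact_mod_cast h5.trans h6
  rw [hDz] at h2 hD
  have hD' : (∑ i ∈ D, z i) ≠ 0 := by exact_mod_cast hD
  rcases lt_or_gt_of_ne hD' with hlt | hgt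
  · have h4 : ((∑ i ∈ D, z i : ℤ) : ℝ) ≤ -1 := by exact_mod_cast Int.le_sub_one_of_lt hlt
    have h5 : (a : ℝ) ≤ ∑ i ∈ N, x i * 1 * s i := by
      simp only [mul_one]
      nlinarith
    obtain ⟨B, hB, hs⟩ := h.exists_subset (Finset.filter_subset _ _)
      (hle 1 one_ne_zero (fun i _ => by rcases h1 i with h | h | h <;> simp [h]) h5)
    refine ⟨B, hB.trans (Finset.filter_subset _ _), hs, fun i hi j hj => Or.inr (Or.inl ⟨?_, ?_⟩)⟩
    · simpa using (Finset.mem_filter.1 (hB hi)).2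
    · simpa using (Finset.mem_filter.1 (hB hj)).2
  · have h4 : 1 ≤ ((∑ i ∈ D, z i : ℤ) : ℝ) := by exact_mod_cast hgt
    have h5 : (a : ℝ) ≤ ∑ i ∈ N, x i * (-1) * s i := by
      have h6 : ∑ i ∈ N, x i * (-1) * (s i : ℝ) = - ∑ i ∈ N, x i * (s i : ℝ) := by
        rw [← Finset.sum_neg_distrib]
        exact Finset.sum_congr rfl fun i _ => by ring
      rw [h6]
      nlinarith
    obtain ⟨B, hB, hs⟩ := h.exists_subset (Finset.filter_subset _ _)
      (hle (-1) (by norm_num) (fun i _ => by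
        rcases h1 i with h | h | h <;> norm_num [h]) h5)
    refine ⟨B, hB.trans (Finset.filter_subset _ _), hs, fun i hi j hj => Or.inr (Or.inr ⟨?_, ?_⟩)⟩
    · simpa [inv_neg] using (Finset.mem_filter.1 (hB hi)).2
    · simpa [inv_neg] using (Finset.mem_filter.1 (hB hj)).2

/-- First `B` is exchanged for `B'`, while the singletons remain those outside `B`. The singletons
of `B' \ B` are then traded for those of `B \ B'`, which is possible because small weights outside
`B` divide those in `B`. From `B'` and the singletons outside it, merging leads to `τ`. -/
theorem mem_downSet (h : ChainSplit s a D N) (hn : 0 < n) {π τ : Setoid (Fin n)} (hBN : B ⊆ N)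
    (hBs : ∑ i ∈ B, s i = a) (hB : ∀ i ∈ B, ∀ j ∈ N \ B, s j ∣ s i)
    (hπ : ∀ i j, π i j ↔ i = j ∨ i ∈ B ∧ j ∈ B) {B' : Finset (Fin n)} (hBN' : B' ⊆ N)
    (hBs' : ∑ i ∈ B', s i = a) (hτ : ∀ i ∈ B', ∀ j ∈ B', τ i j) :
    τ ∈ downSet π (tCut hn s D) := by
  have hsd : ∑ i ∈ B \ B', s i = ∑ i ∈ B' \ B, s i := by
    have h1 := Finset.sum_sdiff (f := s) (Finset.inter_subset_left (s₁ := B) (s₂ := B'))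
    have h2 := Finset.sum_sdiff (f := s) (Finset.inter_subset_right (s₁ := B) (s₂ := B'))
    rw [Finset.sdiff_inter_self_left] at h1
    rw [Finset.sdiff_inter_self_right] at h2
    omega
  have h0 : Down (tCut hn s D) (blocks π) (B.val ::ₘ singles Bᶜ) := by
    rw [← blocks_of_block (h.nonempty_of_sum hBs) hπ]
    exact Down.refl
  have h1 : Down (tCut hn s D) (blocks π) (B'.val ::ₘ singles Bᶜ) :=
    h0.swap_block (h.signVec_mem hn (Finset.sdiff_subset.trans hBN)
      (Finset.sdiff_subset.trans hBN') disjoint_sdiff_sdiff hsd)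
  have hsplit : ∀ U V : Finset (Fin n), singles Uᶜ = singles (V \ U) + singles (U ∪ V)ᶜ := by
    intro U V
    rw [← singles_union]
    · congr 1
      ext i
      simp only [Finset.mem_compl, Finset.mem_union, Finset.mem_sdiff]
      tauto
    · refine Finset.disjoint_left.2 fun i hi hi' => ?_
      exact Finset.mem_compl.1 hi' (Finset.mem_union_right _ (Finset.mem_sdiff.1 hi).1)
  refine Down.of_block (h.nonempty_of_sum hBs') hτ ?_
  rw [hsplit B B', ← Multiset.add_cons] at h1
  rw [hsplit B' B, ← Multiset.add_cons, Finset.union_comm]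
  refine Down.swap_singles h.small_pos h.chain (fun P hP Q hQ hd hs => h.signVec_mem hn hP hQ hd hs)
    (B \ B') (B' \ B) _ (Finset.sdiff_subset.trans hBN') (Finset.sdiff_subset.trans hBN)
    disjoint_sdiff_sdiff hsd.symm (fun i hi j hj => ?_) h1
  exact hB j (Finset.mem_sdiff.1 hj).1 i
    (Finset.mem_sdiff.2 ⟨hBN' (Finset.mem_sdiff.1 hi).1, (Finset.mem_sdiff.1 hi).2⟩)

/-- The sum of the quotients ⌊weight/a⌋ is at least |D| + 1 at the start: one for each large index
and one for the block. If no class of `τ` contained small weights of sum `a`, the small weights in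
each class would total less than `a`, and the sum for `τ` would be only |D|. -/
theorem exists_subset_of_mem_downSet (h : ChainSplit s a D N) (hn : 0 < n) {π τ : Setoid (Fin n)}
    (hBN : B ⊆ N) (hBs : ∑ i ∈ B, s i = a) (hπ : ∀ i j, π i j ↔ i = j ∨ i ∈ B ∧ j ∈ B)
    (hτ : τ ∈ downSet π (sCut hn s)) :
    ∃ B' ⊆ N, ∑ i ∈ B', s i = a ∧ ∀ i ∈ B', ∀ j ∈ B', τ i j := by
  have hbal : ∀ x ∈ (sCut hn s).elems, ∑ i ∈ plusSet x, s i = ∑ i ∈ minusSet x, s i := by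
    rintro x ⟨hx, hx', -⟩
    rw [sum_mul_of_mem_signCube hx, sub_eq_zero] at hx'
    exact_mod_cast hx'
  have h1 := Down.le_sum_div s a hbal hτ
  rw [blocks_of_block (h.nonempty_of_sum hBs) hπ, blocks_eq τ, Multiset.map_map] at h1
  have h2 : D.card + 1 ≤ ((B.val ::ₘ singles Bᶜ).map fun β => (β.map s).sum / a).sum := by
    rw [Multiset.map_cons, Multiset.sum_cons, singles, Multiset.map_map, add_comm]
    refine Nat.add_le_add ?_ ?_
    · have : (B.val.map s).sum = a := hBs
      rw [this, Nat.div_self h.pos]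
    · have h3 : D ⊆ Bᶜ := fun i hi => Finset.mem_compl.2
        fun hi' => Finset.disjoint_left.1 h.disj hi (hBN hi')
      calc D.card = ∑ i ∈ D, s i / a := by
            rw [Finset.card_eq_sum_ones]
            exact Finset.sum_congr rfl fun i hi => by rw [h.big i hi, Nat.div_self h.pos]
        _ ≤ ∑ i ∈ Bᶜ, s i / a := Finset.sum_le_sum_of_subset h3
        _ = _ := by
            rw [Finset.sum]
            simp
  by_contra hcon
  push Not at hcon
  have h3 : ∀ C ∈ classes τ, ((C.val.map s).sum) / a = ∑ i ∈ C, if i ∈ D then 1 else 0 := by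
    intro C hC
    obtain ⟨k, hk⟩ := exists_of_mem_classes hC
    have h4 : ∑ i ∈ C ∩ N, s i < a := by
      by_contra h5
      obtain ⟨B', hB', hs⟩ := h.exists_subset Finset.inter_subset_right (not_lt.1 h5)
      obtain ⟨i, hi, j, hj, hij⟩ := hcon B' (hB'.trans Finset.inter_subset_right) hs
      exact hij (τ.trans (τ.symm ((hk i).1 (Finset.mem_inter.1 (hB' hi)).1))
        ((hk j).1 (Finset.mem_inter.1 (hB' hj)).1))
    have h5 : ∑ i ∈ C, s i = a * (∑ i ∈ C, if i ∈ D then 1 else 0) + ∑ i ∈ C ∩ N, s i := by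
      rw [Finset.mul_sum, ← Finset.filter_mem_eq_inter, Finset.sum_filter, ← Finset.sum_add_distrib]
      refine Finset.sum_congr rfl fun i _ => ?_
      by_cases hD : i ∈ D
      · rw [if_pos hD, if_neg (Finset.disjoint_left.1 h.disj hD), h.big i hD, mul_one, add_zero]
      · by_cases hN : i ∈ N
        · rw [if_neg hD, if_pos hN, mul_zero, zero_add]
        · rw [if_neg hD, if_neg hN, h.zero i hD hN, mul_zero, add_zero]
    have h6 : (C.val.map s).sum = ∑ i ∈ C, s i := rfl
    rw [h6, h5, Nat.mul_add_div h.pos, Nat.div_eq_of_lt h4, add_zero]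
  have h4 : ((classes τ).val.map ((fun β => (β.map s).sum / a) ∘ Finset.val)).sum = D.card := by
    refine Eq.trans (?_ : _ = ∑ C ∈ classes τ, (C.val.map s).sum / a) ?_
    · rfl
    rw [Finset.sum_congr rfl h3, sum_classes]
    simp
  rw [h4] at h1
  omega

/-- Separating the large weights does not change the quotient by a merged block of the largest
small weights with the sum of a large weight. -/
theorem collapse_phequiv {F : ResCat ⥤ PSpace.{u}} (hF : IsResonanceFunctor F)
    (h : ChainSplit s a D N) (hn : 0 < n) (hBN : B ⊆ N)
    (hBs : ∑ i ∈ B, s i = a) (hB : ∀ i ∈ B, ∀ j ∈ N \ B, s j ∣ s i) {m : ℕ} (f : Fin n → Fin m)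
    (hf : Function.Surjective f) (hfB : ∀ i j, f i = f j ↔ i = j ∨ i ∈ B ∧ j ∈ B) :
    PHEquiv (collapse (F.obj ⟨n, sCut hn s⟩) (imIncl F (sCut hn s) f hf))
      (collapse (F.obj ⟨n, tCut hn s D⟩) (imIncl F (tCut hn s D) f hf)) := by
  -- Either set consists of the partitions with a class containing small weights of sum `a`.
  have hdown : downSet (Setoid.ker f) (sCut hn s) = downSet (Setoid.ker f) (tCut hn s D) := by
    ext τ
    refine ⟨fun hτ => ?_, fun hτ => Down.mono (h.tCut_subset hn) hτ⟩
    obtain ⟨B', hB', hs, hτ'⟩ := h.exists_subset_of_mem_downSet (π := Setoid.ker f) hn hBN hBs hfB hτ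
    exact h.mem_downSet (π := Setoid.ker f) hn hBN hBs hB hfB hB' hs hτ'
  have hS := hF.quot (sCut hn s) f hf
  have hT := hF.quot (tCut hn s D) f hf
  rw [hdown] at hS
  refine (hS.trans ?_).trans hT.symm
  refine hF.rel _ _ _ _ (hdown ▸ sClosed_downSet _ _) (sClosed_downSet _ _)
    ⟨1, fun x => ?_, fun π => Iff.rfl⟩
  -- An element of the larger cut outside the smaller one has a sign class containing small weights
  -- of sum `a`, so its partition is at infinity.
  change x ∈ surviving _ _ ↔ x ∈ surviving _ _
  constructor
  · rintro ⟨h1, h2⟩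
    have h3 : signPart x ∉ downSet (Setoid.ker f) (tCut hn s D) := fun h3 => h2 ⟨h1, h3⟩
    refine ⟨?_, fun h4 => h3 h4.2⟩
    by_contra h4
    obtain ⟨B', hB', hs, hx⟩ := h.exists_subset_of_notMem hn h1 h4
    exact h3 (h.mem_downSet (π := Setoid.ker f) hn hBN hBs hB hfB hB' hs hx)
  · rintro ⟨h1, h2⟩
    exact ⟨h.tCut_subset hn h1, fun h3 => h2 ⟨h1, h3.2⟩⟩

end ChainSplit

/-! ### Merging a block, at the level of multisets of weights -/

theorem exists_merge {n : ℕ} (B : Finset (Fin n)) :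
    ∃ (m : ℕ) (f : Fin n → Fin m), Function.Surjective f ∧
      ∀ i j, f i = f j ↔ i = j ∨ i ∈ B ∧ j ∈ B := by
  classical
  let r : Setoid (Fin n) :=
    { r := fun i j => i = j ∨ i ∈ B ∧ j ∈ B
      iseqv := ⟨fun _ => Or.inl rfl, by
        rintro i j (h | h)
        · exact Or.inl h.symm
        · exact Or.inr h.symm, by
        rintro i j k (rfl | h) (rfl | h')
        · exact Or.inl rfl
        · exact Or.inr h'
        · exact Or.inr h
        · exact Or.inr ⟨h.1, h'.2⟩⟩ }
  refine ⟨Fintype.card (Quotient r), fun i => Fintype.equivFin _ (Quotient.mk r i),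
    (Fintype.equivFin _).surjective.comp Quotient.mk_surjective, fun i j => ?_⟩
  rw [EmbeddingLike.apply_eq_iff_eq, Quotient.eq]
  rfl

theorem univ_map_fiber_sum {n m : ℕ} {B : Finset (Fin n)} (hB : B.Nonempty) {f : Fin n → Fin m}
    (hf : Function.Surjective f) (hfB : ∀ i j, f i = f j ↔ i = j ∨ i ∈ B ∧ j ∈ B)
    (w : Fin n → ℕ × ℕ) :
    (Finset.univ.val.map fun j => ∑ i with f i = j, w i) =
      (∑ i ∈ B, w i) ::ₘ Bᶜ.val.map w := by
  obtain ⟨b, hb⟩ := hB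
  have hinj : Set.InjOn f (Bᶜ : Finset (Fin n)) := by
    intro i hi j hj hij
    rcases (hfB i j).1 hij with h | h
    · exact h
    · exact absurd h.1 (Finset.mem_compl.1 hi)
  have hnot : f b ∉ Bᶜ.image f := by
    intro h
    obtain ⟨i, hi, h⟩ := Finset.mem_image.1 h
    rcases (hfB i b).1 h with rfl | h
    · exact Finset.mem_compl.1 hi hb
    · exact Finset.mem_compl.1 hi h.1
  have huniv : (Finset.univ : Finset (Fin m)) = Finset.cons (f b) (Bᶜ.image f) hnot := by
    symm
    rw [Finset.eq_univ_iff_forall]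
    intro j
    obtain ⟨i, rfl⟩ := hf j
    rw [Finset.mem_cons]
    by_cases hi : i ∈ B
    · exact Or.inl ((hfB i b).2 (Or.inr ⟨hi, hb⟩))
    · exact Or.inr (Finset.mem_image_of_mem f (Finset.mem_compl.2 hi))
  rw [huniv, Finset.cons_val, Multiset.map_cons, Finset.image_val_of_injOn hinj, Multiset.map_map]
  congr 1
  · refine Finset.sum_congr ?_ fun _ _ => rfl
    ext i
    rw [Finset.mem_filter, hfB]
    refine ⟨fun h => ?_, fun h => ⟨Finset.mem_univ _, Or.inr ⟨h, hb⟩⟩⟩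
    rcases h.2 with rfl | h
    · exact hb
    · exact h.1
  · refine Multiset.map_congr rfl fun k hk => ?_
    have hk' : k ∉ B := Finset.mem_compl.1 hk
    rw [Function.comp_apply]
    have h1 : (Finset.univ.filter fun i => f i = f k) = {k} := by
      ext i
      rw [Finset.mem_filter, hfB, Finset.mem_singleton]
      exact ⟨fun h => h.2.resolve_right fun h => hk' h.2, fun h => ⟨Finset.mem_univ _, Or.inl h⟩⟩
    rw [h1, Finset.sum_singleton]

theorem univ_filter_map {n : ℕ} {α β : Type} {w : Fin n → α} {L : Multiset α}
    (hw : Finset.univ.val.map w = L) (q : α → Prop) [DecidablePred q] (g : α → β) :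
    (Finset.univ.filter fun i => q (w i)).val.map (fun i => g (w i)) = (L.filter q).map g := by
  rw [← hw, Multiset.filter_map, Multiset.map_map, Finset.filter_val]
  rfl

theorem Multiset.filter_map_of_forall {α β : Type} (M : Multiset α) (p : α → β) (q : β → Prop)
    [DecidablePred q] (h : ∀ x, q (p x)) : (M.map p).filter q = M.map p :=
  Multiset.filter_eq_self.2 fun y hy => by
    obtain ⟨x, -, rfl⟩ := Multiset.mem_map.1 hy
    exact h x

theorem Multiset.filter_map_of_forall_not {α β : Type} (M : Multiset α) (p : α → β) (q : β → Prop)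
    [DecidablePred q] (h : ∀ x, ¬ q (p x)) : (M.map p).filter q = 0 :=
  Multiset.filter_eq_nil.2 fun y hy => by
    obtain ⟨x, -, rfl⟩ := Multiset.mem_map.1 hy
    exact h x

/-- The coarser merging is performed in two stages, through the finer one `g`. If F is contractible
at the intermediate cut, the inclusion given by `f` is therefore null-homotopic. -/
theorem exists_merge_factor {n m m' : ℕ} (T : Cut n) (f : Fin n → Fin m)
    (hf : Function.Surjective f) (g : Fin n → Fin m') (hg : Function.Surjective g)
    (h : ∀ i j, g i = g j → f i = f j) :
    ∃ φ : (⟨m, T.act f hf⟩ : ResCat) ⟶ ⟨m', T.act g hg⟩, φ ≫ inclHom T g hg = inclHom T f hf := by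
  have h1 : ∀ i, f (Function.surjInv hg (g i)) = f i := fun i =>
    h _ _ (Function.surjInv_eq hg (g i))
  refine ⟨ResCat.Hom.mk (fun k => f (Function.surjInv hg k)) (fun k => ?_) fun t ht => ?_, ?_⟩
  · obtain ⟨i, rfl⟩ := hf k
    exact ⟨g i, h1 i⟩
  · refine ⟨ht.1, fun i => ht.1 _, ?_⟩
    have h2 := ht.2
    convert h2 using 1
    funext i
    exact congrArg t (h1 i)
  · refine ResCat.Hom.ext (funext h1)

theorem IsResonanceFunctor.act_phequiv_FW {F : ResCat ⥤ PSpace.{u}} (hF : IsResonanceFunctor F)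
    {n m : ℕ} (hn : 0 < n) (w : Fin n → ℕ × ℕ) {B : Finset (Fin n)} (hB : B.Nonempty)
    {f : Fin n → Fin m} (hf : Function.Surjective f)
    (hfB : ∀ i j, f i = f j ↔ i = j ∨ i ∈ B ∧ j ∈ B) (hw : ∀ i ∈ B, w i ≠ 0)
    {M : Multiset (ℕ × ℕ)} (hM : (∑ i ∈ B, w i) ::ₘ Bᶜ.val.map w = M) :
    PHEquiv (F.obj ⟨m, (wCut hn w).act f hf⟩) (FW F M) :=
  hF.phequiv_FW_of_eq (f hB.choose).pos (wCut_act hn _ w f hf fun i j hi hij =>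
    ((hfB i j).1 hij).resolve_right fun h => hw i h.1 hi)
    ((univ_map_fiber_sum hB hf hfB w).trans hM)

/-- Weights with a label: `0` for zero weights, `1` for the large ones, `2` and `3` for the block
to be merged and `4` for the others. -/
def labelled (a j k : ℕ) (σ ρ ν : Multiset ℕ) : Multiset (ℕ × Fin 5) :=
  Multiset.replicate j (0, 0) + Multiset.replicate k (a, 1) + σ.map (fun x => (x, 2)) +
    ρ.map (fun x => (x, 3)) + ν.map (fun x => (x, 4))

/-- The weight with the large weights separated from the others. -/
def splitWeight (p : ℕ × Fin 5) : ℕ × ℕ := if p.2 = 1 then (0, 1) else (p.1, 0)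

/-- Zero weights `j` times, the large weight `a` separated from the others `k` times, and the
small weights `ν`. -/
def split (j k : ℕ) (ν : Multiset ℕ) : Multiset (ℕ × ℕ) :=
  Multiset.replicate j 0 + Multiset.replicate k (0, 1) + ν.map fun x => (x, 0)

/-- Zero weights `j` times, and the weights `ν`. -/
def plain (j : ℕ) (ν : Multiset ℕ) : Multiset (ℕ × ℕ) :=
  Multiset.replicate j 0 + ν.map fun x => (x, 0)

/-- The comparison of quotients in terms of multisets: `i` merges the block `σ + ρ` in the given
cut, `i'` merges it in the separated cut. The block is given in two parts because `i'` factors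
through the cut in which only `σ` is merged. -/
theorem exists_cofibers {F : ResCat ⥤ PSpace.{u}} (hF : IsResonanceFunctor F) {a : ℕ} (ha : 0 < a)
    (j k : ℕ) (σ ρ ν : Multiset ℕ) (hpos : ∀ x ∈ σ + ρ + ν, 0 < x) (hdvd : ∀ x ∈ σ + ρ + ν, x ∣ a)
    (hchain : ∀ x ∈ σ + ρ + ν, ∀ y ∈ σ + ρ + ν, x ∣ y ∨ y ∣ x)
    (hlt : ∀ x ∈ σ + ρ, ∀ y ∈ ν, y ∣ x) (hsum : (σ + ρ).sum = a) :
    ∃ (A X A' X' : PSpace.{u}) (i : PSpace.Hom A X) (i' : PSpace.Hom A' X'),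
      IsClosedCofibration i.map ∧ IsClosedCofibration i'.map ∧
      PHEquiv (collapse X (Set.range i.map)) (collapse X' (Set.range i'.map)) ∧
      PHEquiv A (FW F (plain j (Multiset.replicate (k + 1) a + ν))) ∧
      PHEquiv X (FW F (plain j (Multiset.replicate k a + (σ + ρ + ν)))) ∧
      PHEquiv A' (FW F (split j k (a ::ₘ ν))) ∧
      PHEquiv X' (FW F (split j k (σ + ρ + ν))) ∧
      (σ ≠ 0 → PContractible (FW F (split j k (σ.sum ::ₘ (ρ + ν)))) →
        PHomotopic i' (PSpace.Hom.const A' X')) := by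
  classical
  -- The labels tell members of the block from equal weights outside it, so all index sets are read
  -- off from `w`.
  obtain ⟨n, w, hw⟩ := exists_fin_map_eq (labelled a j k σ ρ ν)
  have hmem : ∀ i, w i = (0, 0) ∨ w i = (a, 1) ∨ (w i).1 ∈ σ ∧ (w i).2 = 2 ∨
      (w i).1 ∈ ρ ∧ (w i).2 = 3 ∨ (w i).1 ∈ ν ∧ (w i).2 = 4 := by
    intro i
    have h1 : w i ∈ labelled a j k σ ρ ν := by
      rw [← hw]
      exact Multiset.mem_map_of_mem w (Finset.mem_univ_val i)
    simp only [labelled, Multiset.mem_add, Multiset.mem_map] at h1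
    rcases h1 with (((h | h) | ⟨x, h, h'⟩) | ⟨x, h, h'⟩) | ⟨x, h, h'⟩
    · exact Or.inl (Multiset.eq_of_mem_replicate h)
    · exact Or.inr (Or.inl (Multiset.eq_of_mem_replicate h))
    · simp [← h', h]
    · simp [← h', h]
    · simp [← h', h]
  have hfil : ∀ (q : Fin 5 → Prop) [DecidablePred q] (g : ℕ × Fin 5 → ℕ × ℕ),
      (Finset.univ.filter fun i => q (w i).2).val.map (fun i => g (w i)) =
      (if q 0 then Multiset.replicate j (g (0, 0)) else 0) +
      (if q 1 then Multiset.replicate k (g (a, 1)) else 0) +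
      (if q 2 then σ.map (fun x => g (x, 2)) else 0) +
      (if q 3 then ρ.map (fun x => g (x, 3)) else 0) +
      (if q 4 then ν.map (fun x => g (x, 4)) else 0) := by
    intro q _ g
    refine (univ_filter_map hw (fun p : ℕ × Fin 5 => q p.2) g).trans ?_
    have h1 : ∀ (c : Fin 5) (M : Multiset ℕ), Multiset.map g (Multiset.filter
        (fun p : ℕ × Fin 5 => q p.2) (M.map fun x => (x, c))) =
        if q c then M.map (fun x => g (x, c)) else 0 := by
      intro c M
      split_ifs with hc
      · rw [Multiset.filter_map_of_forall M (fun x => (x, c)) (fun p => q p.2) fun _ => hc,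
          Multiset.map_map]
        rfl
      · rw [Multiset.filter_map_of_forall_not M (fun x => (x, c)) (fun p => q p.2) fun _ => hc,
          Multiset.map_zero]
    have h2 : ∀ (c : Fin 5) (k x : ℕ), Multiset.map g (Multiset.filter
        (fun p : ℕ × Fin 5 => q p.2) (Multiset.replicate k (x, c))) =
        if q c then Multiset.replicate k (g (x, c)) else 0 := by
      intro c k x
      rw [← Multiset.map_replicate (fun x : ℕ => (x, c)), h1, Multiset.map_replicate]
    rw [labelled, Multiset.filter_add, Multiset.filter_add, Multiset.filter_add,
      Multiset.filter_add, Multiset.map_add, Multiset.map_add, Multiset.map_add, Multiset.map_add,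
      h1, h1, h1, h2, h2]
  have hall : ∀ g : ℕ × Fin 5 → ℕ × ℕ, Finset.univ.val.map (fun i => g (w i)) =
      Multiset.replicate j (g (0, 0)) + Multiset.replicate k (g (a, 1)) +
      σ.map (fun x => g (x, 2)) + ρ.map (fun x => g (x, 3)) + ν.map (fun x => g (x, 4)) := by
    intro g
    simpa using hfil (fun _ => True) g
  -- D carries the large weights, N all small ones, B the block to be merged and C its part `σ`.
  set s : Fin n → ℕ := fun i => (w i).1 with hs
  set D : Finset (Fin n) := Finset.univ.filter fun i => (w i).2 = 1 with hD
  set N : Finset (Fin n) := Finset.univ.filter fun i => 2 ≤ (w i).2 with hN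
  set B : Finset (Fin n) := Finset.univ.filter fun i => (w i).2 = 2 ∨ (w i).2 = 3 with hB
  set C : Finset (Fin n) := Finset.univ.filter fun i => (w i).2 = 2 with hC
  have hNmem : ∀ i ∈ N, s i ∈ σ + ρ + ν := by
    intro i hi
    have hi := (Finset.mem_filter.1 hi).2
    simp only [Multiset.mem_add, hs]
    rcases hmem i with h | h | h | h | h
    · rw [show (w i).2 = 0 from congrArg Prod.snd h] at hi
      exact absurd hi (by decide)
    · rw [show (w i).2 = 1 from congrArg Prod.snd h] at hi
      exact absurd hi (by decide)
    · exact Or.inl (Or.inl h.1)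
    · exact Or.inl (Or.inr h.1)
    · exact Or.inr h.1
  have hBmem : ∀ i ∈ B, s i ∈ σ + ρ := by
    intro i hi
    have hi := (Finset.mem_filter.1 hi).2
    simp only [Multiset.mem_add, hs]
    rcases hmem i with h | h | h | h | h
    · rw [show (w i).2 = 0 from congrArg Prod.snd h] at hi
      exact absurd hi (by decide)
    · rw [show (w i).2 = 1 from congrArg Prod.snd h] at hi
      exact absurd hi (by decide)
    · exact Or.inl h.1
    · exact Or.inr h.1
    · rw [h.2] at hi
      exact absurd hi (by decide)
  have hNBmem : ∀ i ∈ N \ B, s i ∈ ν := by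
    intro i hi
    have hi' := (Finset.mem_sdiff.1 hi).2
    have hi := (Finset.mem_filter.1 (Finset.mem_sdiff.1 hi).1).2
    simp only [hB, Finset.mem_filter, Finset.mem_univ, true_and] at hi'
    rcases hmem i with h | h | h | h | h
    · rw [show (w i).2 = 0 from congrArg Prod.snd h] at hi
      exact absurd hi (by decide)
    · rw [show (w i).2 = 1 from congrArg Prod.snd h] at hi
      exact absurd hi (by decide)
    · exact absurd (Or.inl h.2) hi'
    · exact absurd (Or.inr h.2) hi'
    · exact h.1
  have hzero : ∀ i, s i = 0 → i ∉ B := fun i hi hi' =>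
    (hpos _ (Multiset.mem_add.2 (Or.inl (hBmem i hi')))).ne' hi
  have hCB : C ⊆ B := fun i hi =>
    Finset.mem_filter.2 ⟨Finset.mem_univ i, Or.inl (Finset.mem_filter.1 hi).2⟩
  have hBD : Disjoint B D := by
    refine Finset.disjoint_left.2 fun i hi hi' => ?_
    have h1 := (Finset.mem_filter.1 hi).2
    rw [(Finset.mem_filter.1 hi').2] at h1
    exact absurd h1 (by decide)
  have hsplit : ChainSplit s a D N := by
    refine ⟨ha, ?_, fun i hi => ?_, fun i hi => hpos _ (hNmem i hi),
      fun i hi => hdvd _ (hNmem i hi), fun i hi hi' => ?_,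
      fun i hi j hj => hchain _ (hNmem i hi) _ (hNmem j hj)⟩
    · refine Finset.disjoint_left.2 fun i hi hi' => ?_
      have h1 := (Finset.mem_filter.1 hi').2
      rw [(Finset.mem_filter.1 hi).2] at h1
      exact absurd h1 (by decide)
    · have hi := (Finset.mem_filter.1 hi).2
      rcases hmem i with h | h | h | h | h
      · rw [congrArg Prod.snd h] at hi
        exact absurd hi (by decide)
      · exact congrArg Prod.fst h
      all_goals
        rw [h.2] at hi
        exact absurd hi (by decide)
    · simp only [hD, hN, Finset.mem_filter, Finset.mem_univ, true_and] at hi hi'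
      rcases hmem i with h | h | h | h | h
      · exact congrArg Prod.fst h
      · exact absurd (congrArg Prod.snd h) hi
      all_goals
        rw [h.2] at hi'
        exact absurd (by decide) hi'
  have hsumB : ∀ g : ℕ × Fin 5 → ℕ × ℕ, ∑ i ∈ B, g (w i) =
      (σ.map fun x => g (x, 2)).sum + (ρ.map fun x => g (x, 3)).sum := by
    intro g
    refine (congrArg Multiset.sum (hfil (fun c => c = 2 ∨ c = 3) g)).trans ?_
    simp
  have hsumC : ∀ g : ℕ × Fin 5 → ℕ × ℕ, ∑ i ∈ C, g (w i) = (σ.map fun x => g (x, 2)).sum := by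
    intro g
    refine (congrArg Multiset.sum (hfil (fun c => c = 2) g)).trans ?_
    simp
  have hms : ∀ M : Multiset ℕ, (M.map fun x => ((x, 0) : ℕ × ℕ)).sum = (M.sum, 0) := by
    intro M
    induction M using Multiset.induction with
    | empty => rfl
    | cons x M ih => simp [ih]
  have hsumBs : ∑ i ∈ B, ((s i, 0) : ℕ × ℕ) = (a, 0) := by
    rw [hsumB fun p => (p.1, 0), hms, hms, ← hsum, Multiset.sum_add]
    rfl
  have hBs : ∑ i ∈ B, s i = a := by
    have := congrArg Prod.fst hsumBs
    rwa [Prod.fst_sum] at this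
  have hcompl : ∀ (q : Fin 5 → Prop) [DecidablePred q],
      (Finset.univ.filter fun i => q (w i).2)ᶜ = Finset.univ.filter fun i => ¬ q (w i).2 := by
    intro q _
    ext i
    simp
  have htw : (fun i => if i ∈ D then ((0, 1) : ℕ × ℕ) else (s i, 0)) =
      fun i => splitWeight (w i) := by
    funext i
    simp only [hD, Finset.mem_filter, Finset.mem_univ, true_and, hs, splitWeight]
  have htB : ∀ i ∈ B, (fun i => if i ∈ D then ((0, 1) : ℕ × ℕ) else (s i, 0)) i = (s i, 0) :=
    fun i hi => if_neg (Finset.disjoint_left.1 hBD hi)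
  have hBne : B.Nonempty := hsplit.nonempty_of_sum hBs
  have hn : 0 < n := (hBne.choose).pos
  obtain ⟨m, f, hf, hfB⟩ := exists_merge B
  refine ⟨_, _, _, _, F.map (inclHom (sCut hn s) f hf), F.map (inclHom (tCut hn s D) f hf),
    hF.incl _ _ _, hF.incl _ _ _, hsplit.collapse_phequiv hF hn ?_ hBs ?_ f hf hfB, ?_, ?_, ?_, ?_,
    fun hσ hcon => ?_⟩
  · intro i hi
    refine Finset.mem_filter.2 ⟨Finset.mem_univ i, ?_⟩
    rcases (Finset.mem_filter.1 hi).2 with h | h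
    · exact h.ge
    · rw [h]
      decide
  · exact fun i hi j hj => hlt _ (hBmem i hi) _ (hNBmem j hj)
  · refine hF.act_phequiv_FW hn _ hBne hf hfB
      (fun i hi h => hzero i (congrArg Prod.fst h) hi) ?_
    rw [hsumBs, hB, hcompl fun c => c = 2 ∨ c = 3]
    refine (congrArg _ (hfil (fun c => ¬ (c = 2 ∨ c = 3)) fun p => (p.1, 0))).trans ?_
    simp [plain, Multiset.replicate_succ, add_assoc, Prod.mk_zero_zero]
  · refine hF.phequiv_FW hn ?_
    refine (hall fun p => (p.1, 0)).trans ?_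
    simp [plain, add_assoc, Prod.mk_zero_zero]
  · refine hF.act_phequiv_FW hn _ hBne hf hfB (fun i hi h => ?_) ?_
    · have h := (htB i hi).symm.trans h
      exact hzero i (congrArg Prod.fst h) hi
    rw [Finset.sum_congr rfl htB, hsumBs, htw, hB, hcompl fun c => c = 2 ∨ c = 3]
    refine (congrArg _ (hfil (fun c => ¬ (c = 2 ∨ c = 3)) splitWeight)).trans ?_
    simp [split, splitWeight, add_assoc, Prod.mk_zero_zero]
  · refine hF.phequiv_FW hn ?_
    rw [htw]
    refine (hall splitWeight).trans ?_
    simp [split, splitWeight, add_assoc, Prod.mk_zero_zero]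
  · obtain ⟨m', g, hg, hgC⟩ := exists_merge C
    obtain ⟨φ, hφ⟩ := exists_merge_factor (tCut hn s D) f hf g hg fun i j hij =>
      (hfB i j).2 (((hgC i j).1 hij).imp_right fun h => ⟨hCB h.1, hCB h.2⟩)
    rw [← hφ, F.map_comp]
    refine PContractible.null (PContractible.phequiv hcon (PHEquiv.symm ?_)) _ _
    have hCne : C.Nonempty := by
      obtain ⟨x, hx⟩ := Multiset.exists_mem_of_ne_zero hσ
      have h1 : (x, 2) ∈ labelled a j k σ ρ ν := by simp [labelled, hx]
      rw [← hw] at h1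
      obtain ⟨i, -, hi⟩ := Multiset.mem_map.1 h1
      exact ⟨i, Finset.mem_filter.2 ⟨Finset.mem_univ i, by rw [hi]⟩⟩
    refine hF.act_phequiv_FW hn _ hCne hg hgC (fun i hi h => ?_) ?_
    · have h := (htB i (hCB hi)).symm.trans h
      exact hzero i (congrArg Prod.fst h) (hCB hi)
    rw [Finset.sum_congr rfl fun i hi => htB i (hCB hi), hsumC fun p => (p.1, 0), hms, htw, hC,
      hcompl fun c => c = 2]
    refine (congrArg _ (hfil (fun c => ¬ c = 2) splitWeight)).trans ?_
    simp [split, splitWeight, add_assoc, Prod.mk_zero_zero]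

/-! ### Cuts with a single large weight, or with small weights of small sum -/

theorem plain_eq_map (j k a : ℕ) (ν : Multiset ℕ) :
    plain j (Multiset.replicate k a + ν) =
      (Multiset.replicate j (0, false) + Multiset.replicate k (a, true) +
        ν.map fun x => (x, false)).map fun p : ℕ × Bool => (p.1, 0) := by
  simp [plain, add_assoc, Prod.mk_zero_zero]

theorem split_eq_map (j k a : ℕ) (ν : Multiset ℕ) :
    split j k ν =
      (Multiset.replicate j (0, false) + Multiset.replicate k (a, true) +
        ν.map fun x => (x, false)).map fun p : ℕ × Bool => if p.2 then (0, 1) else (p.1, 0) := by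
  simp [split, add_assoc, Prod.mk_zero_zero]

theorem plain_succ_eq_map (j a : ℕ) (ν : Multiset ℕ) :
    plain (j + 1) ν =
      (Multiset.replicate j (0, false) + Multiset.replicate 1 (a, true) +
        ν.map fun x => (x, false)).map fun p : ℕ × Bool => if p.2 then (0, 0) else (p.1, 0) := by
  simp [plain, Multiset.replicate_succ, add_assoc, Prod.mk_zero_zero]

/-- A resonance between large and small weights would require small weights of sum `a`. -/
theorem sCut_eq_tCut {n : ℕ} {s : Fin n → ℕ} {a : ℕ} {D N : Finset (Fin n)}
    (h : ChainSplit s a D N) (hn : 0 < n) (hlt : ∑ i ∈ N, s i < a) :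
    sCut hn s = tCut hn s D := by
  refine Cut.ext_elems fun x => ⟨fun hx => ?_, fun hx => h.tCut_subset hn hx⟩
  by_contra hx'
  obtain ⟨B, hB, hs, -⟩ := h.exists_subset_of_notMem hn hx hx'
  exact absurd (Finset.sum_le_sum_of_subset (f := s) hB) (by omega)

namespace IsResonanceFunctor

variable {F : ResCat ⥤ PSpace.{u}}

theorem FW_plain_phequiv_split (hF : IsResonanceFunctor F) {a : ℕ} (ha : 0 < a) (j k : ℕ)
    (hk : 0 < k) (ν : Multiset ℕ) (hpos : ∀ x ∈ ν, 0 < x) (hdvd : ∀ x ∈ ν, x ∣ a)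
    (hchain : ∀ x ∈ ν, ∀ y ∈ ν, x ∣ y ∨ y ∣ x) (hlt : ν.sum < a) :
    PHEquiv (FW F (plain j (Multiset.replicate k a + ν))) (FW F (split j k ν)) := by
  rw [plain_eq_map, split_eq_map j k a]
  refine hF.FW_congr (fun h => ?_) fun n hn w hw => ?_
  · have := congrArg Multiset.card h
    simp at this
    omega
  have hmem : ∀ i, w i = (0, false) ∨ w i = (a, true) ∨ (w i).1 ∈ ν ∧ (w i).2 = false := by
    intro i
    have h1 : w i ∈ Finset.univ.val.map w := Multiset.mem_map_of_mem w (Finset.mem_univ_val i)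
    rw [hw] at h1
    simp only [Multiset.mem_add, Multiset.mem_map] at h1
    rcases h1 with (h | h) | ⟨x, h, h'⟩
    · exact Or.inl (Multiset.eq_of_mem_replicate h)
    · exact Or.inr (Or.inl (Multiset.eq_of_mem_replicate h))
    · simp [← h', h]
  have hN : ∀ i ∈ Finset.univ.filter (fun i => (w i).2 = false ∧ (w i).1 ≠ 0), (w i).1 ∈ ν := by
    intro i hi
    have hi := (Finset.mem_filter.1 hi).2
    rcases hmem i with h | h | h
    · exact absurd (congrArg Prod.fst h) hi.2
    · rw [h] at hi
      exact absurd hi.1 (by simp)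
    · exact h.1
  have h : ChainSplit (fun i => (w i).1) a (Finset.univ.filter fun i => (w i).2 = true)
      (Finset.univ.filter fun i => (w i).2 = false ∧ (w i).1 ≠ 0) := by
    refine ⟨ha, ?_, fun i hi => ?_, fun i hi => hpos _ (hN i hi), fun i hi => hdvd _ (hN i hi),
      fun i hi hi' => ?_, fun i hi j hj => hchain _ (hN i hi) _ (hN j hj)⟩
    · refine Finset.disjoint_left.2 fun i hi hi' => ?_
      have h1 := (Finset.mem_filter.1 hi).2
      rw [(Finset.mem_filter.1 hi').2.1] at h1
      exact absurd h1 (by simp)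
    · have hi := (Finset.mem_filter.1 hi).2
      rcases hmem i with h | h | h
      · rw [h] at hi
        exact absurd hi (by simp)
      · exact congrArg Prod.fst h
      · rw [h.2] at hi
        exact absurd hi (by simp)
    · simp only [Finset.mem_filter, Finset.mem_univ, true_and, not_and, not_not,
        Bool.not_eq_true] at hi hi'
      exact hi' hi
  have hsum : ∑ i ∈ Finset.univ.filter (fun i => (w i).2 = false ∧ (w i).1 ≠ 0), (w i).1 = ν.sum := by
    have h1 : ∑ i ∈ Finset.univ.filter (fun i => (w i).2 = false ∧ (w i).1 ≠ 0), (w i).1 =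
        ∑ i, if (w i).2 then 0 else (w i).1 := by
      rw [Finset.sum_filter]
      refine Finset.sum_congr rfl fun i _ => ?_
      by_cases h2 : (w i).2 <;> by_cases h3 : (w i).1 = 0 <;> simp [h2, h3]
    rw [h1]
    refine (congrArg Multiset.sum ((Multiset.map_map (fun p : ℕ × Bool => if p.2 then 0 else p.1)
      w _).symm.trans (congrArg _ hw))).trans ?_
    simp
  have h2 := sCut_eq_tCut h hn (hsum.trans_lt hlt)
  refine Eq.trans h2 ?_
  unfold tCut
  congr 1
  funext i
  simp

/-- The second equation of the cut involves only the coordinate of the single weight (0, 1) and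
makes it vanish, as a zero weight would. -/
theorem FW_split_one_phequiv (hF : IsResonanceFunctor F) (j : ℕ) (ν : Multiset ℕ) :
    PHEquiv (FW F (split j 1 ν)) (FW F (plain (j + 1) ν)) := by
  rw [plain_succ_eq_map j 0, split_eq_map j 1 0]
  refine hF.FW_congr (fun h => ?_) fun n hn w hw => ?_
  · have := congrArg Multiset.card h
    simp at this
  have hcard : (Finset.univ.filter fun i => (w i).2 = true).card = 1 := by
    have h1 := congrArg Multiset.card (univ_filter_map hw (fun p => p.2 = true) id)
    rw [Multiset.card_map] at h1
    refine h1.trans ?_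
    rw [Multiset.filter_add, Multiset.filter_add, Multiset.filter_map_of_forall_not ν
      (fun x => (x, false)) (fun p => p.2 = true) (by simp)]
    have h2 : ∀ x ∈ Multiset.replicate j ((0 : ℕ), false), ¬ x.2 = true := fun x hx => by
      simp [Multiset.eq_of_mem_replicate hx]
    rw [Multiset.filter_eq_nil.2 h2, Multiset.filter_eq_self.2 fun x hx => by
      rw [Multiset.eq_of_mem_replicate hx]]
    simp
  obtain ⟨d, hd⟩ := Finset.card_eq_one.1 hcard
  have hd' : ∀ i, (w i).2 = true ↔ i = d := fun i => by
    have h1 := Finset.ext_iff.1 hd i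
    rwa [Finset.mem_filter, Finset.mem_singleton, and_iff_right (Finset.mem_univ i)] at h1
  refine Cut.ext_elems fun x => ?_
  have h1 : ∑ i, x i * ((((fun p : ℕ × Bool => if p.2 then ((0, 1) : ℕ × ℕ) else (p.1, 0)) ∘ w)
      i).2 : ℝ) = x d := by
    rw [Finset.sum_eq_single d]
    · simp [(hd' d).2 rfl]
    · intro i _ hi
      have : (w i).2 = false := by simpa using (hd' i).not.2 hi
      simp [this]
    · simp
  have h2 : ∑ i, x i * ((((fun p : ℕ × Bool => if p.2 then ((0, 1) : ℕ × ℕ) else (p.1, 0)) ∘ w)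
      i).1 : ℝ) = ∑ i, x i * ((((fun p : ℕ × Bool => if p.2 then ((0, 0) : ℕ × ℕ) else (p.1, 0)) ∘
      w) i).1 : ℝ) := by
    refine Finset.sum_congr rfl fun i _ => ?_
    by_cases h : (w i).2 <;> simp [h]
  have h3 : ∑ i, x i * ((((fun p : ℕ × Bool => if p.2 then ((0, 0) : ℕ × ℕ) else (p.1, 0)) ∘ w)
      i).2 : ℝ) = 0 := by
    refine Finset.sum_eq_zero fun i _ => ?_
    by_cases h : (w i).2 <;> simp [h]
  constructor
  · rintro ⟨hc, h4, h5, h6⟩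
    refine ⟨hc, h2.symm.trans h4, h3, fun i hi => ?_⟩
    by_cases h : (w i).2
    · rw [(hd' i).1 h, ← h1, h5]
    · refine h6 i ?_
      simpa [h] using hi
  · rintro ⟨hc, h4, h5, h6⟩
    refine ⟨hc, h2.trans h4, h1.trans (h6 d ?_), fun i hi => ?_⟩
    · simp [(hd' d).2 rfl]
    · by_cases h : (w i).2
      · simp [h] at hi
      · refine h6 i ?_
        simpa [h] using hi

end IsResonanceFunctor

theorem PContractible.FW_split {F : ResCat ⥤ PSpace.{u}} (hF : IsResonanceFunctor F)
    (hcontr : ∀ (l : ℕ) (hl : 0 < l), 2 ≤ l →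
      ContractibleSpace (F.obj (resOf hl fun _ : Fin l => 1))) (j : ℕ) {k : ℕ} (hk : 2 ≤ k)
    (ν : Multiset ℕ) : PContractible (FW F (split j k ν)) := by
  have h := hF.pcontractible_FW_of_ones hcontr hk (Multiset.replicate j 0 + ν)
  rw [Multiset.map_add, Multiset.map_replicate, ← add_assoc, add_comm (Multiset.replicate k _)] at h
  exact h

/-! ### Chains of divisors -/

/-- A list of positive integers each of which is divisible by all the later ones. -/
structure IsDvdChain (l : List ℕ) : Prop where
  pos : ∀ x ∈ l, 0 < x
  pairwise : l.Pairwise fun x y => y ∣ x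

namespace IsDvdChain

theorem of_sublist {l l' : List ℕ} (h : IsDvdChain l) (hl : l'.Sublist l) : IsDvdChain l' :=
  ⟨fun x hx => h.pos x (hl.subset hx), h.pairwise.sublist hl⟩

theorem dvd_head {a : ℕ} {l : List ℕ} (h : IsDvdChain (a :: l)) : ∀ x ∈ l, x ∣ a :=
  (List.pairwise_cons.1 h.pairwise).1

theorem tail {a : ℕ} {l : List ℕ} (h : IsDvdChain (a :: l)) : IsDvdChain l :=
  h.of_sublist (List.sublist_cons_self a l)

theorem total {l : List ℕ} (h : IsDvdChain l) : ∀ x ∈ l, ∀ y ∈ l, x ∣ y ∨ y ∣ x := by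
  induction l with
  | nil => simp
  | cons a l ih =>
    intro x hx y hy
    rcases List.mem_cons.1 hx with hxa | hx
    · subst hxa
      rcases List.mem_cons.1 hy with hy | hy
      · exact Or.inl hy.symm.dvd
      · exact Or.inr (h.dvd_head y hy)
    · rcases List.mem_cons.1 hy with hy | hy
      · exact Or.inl (hy.symm ▸ h.dvd_head x hx)
      · exact ih h.tail x hx y hy

/-- The head c divides `a`, so c ≤ `a`, and every later entry divides both `a` and c, hence `a` - c.
-/
theorem exists_prefix {l : List ℕ} (h : IsDvdChain l) {a : ℕ} (ha : ∀ x ∈ l, x ∣ a)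
    (hle : a ≤ l.sum) : ∃ p q, l = p ++ q ∧ p.sum = a := by
  induction l generalizing a with
  | nil => exact ⟨[], [], rfl, by simpa [eq_comm] using hle⟩
  | cons c l ih =>
    rcases Nat.eq_zero_or_pos a with rfl | hpos
    · exact ⟨[], c :: l, rfl, rfl⟩
    have hca : c ≤ a := Nat.le_of_dvd hpos (ha c List.mem_cons_self)
    obtain ⟨p, q, rfl, hp⟩ := ih h.tail (a := a - c) (fun x hx =>
      Nat.dvd_sub (ha x (List.mem_cons_of_mem c hx)) (h.dvd_head x hx))
      (by rw [List.sum_cons] at hle; omega)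
    exact ⟨c :: p, q, rfl, by rw [List.sum_cons, hp]; omega⟩

end IsDvdChain

/-- The list version of `exists_cofibers`. -/
theorem IsDvdChain.exists_cofibers_list {F : ResCat ⥤ PSpace.{u}} (hF : IsResonanceFunctor F) {a : ℕ}
    {σ ρ : List ℕ} {p q : List ℕ} (h : IsDvdChain (a :: (p ++ q))) (hperm : (σ ++ ρ).Perm p)
    (hsum : p.sum = a) (j k : ℕ) :
    ∃ (A X A' X' : PSpace.{u}) (i : PSpace.Hom A X) (i' : PSpace.Hom A' X'),
      IsClosedCofibration i.map ∧ IsClosedCofibration i'.map ∧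
      PHEquiv (collapse X (Set.range i.map)) (collapse X' (Set.range i'.map)) ∧
      PHEquiv A (FW F (plain j (Multiset.replicate (k + 1) a + q))) ∧
      PHEquiv X (FW F (plain j (Multiset.replicate k a + (p ++ q : List ℕ)))) ∧
      PHEquiv A' (FW F (split j k (a :: q : List ℕ))) ∧
      PHEquiv X' (FW F (split j k (p ++ q : List ℕ))) ∧
      (σ ≠ [] → PContractible (FW F (split j k (σ.sum :: (ρ ++ q) : List ℕ))) →
        PHomotopic i' (PSpace.Hom.const A' X')) := by
  have hp : (σ + ρ : Multiset ℕ) = p := by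
    rw [Multiset.coe_add]
    exact Multiset.coe_eq_coe.2 hperm
  have hpq : (σ + ρ + q : Multiset ℕ) = (p ++ q : List ℕ) := by rw [hp, Multiset.coe_add]
  have h1 := exists_cofibers hF (h.pos a List.mem_cons_self) j k σ ρ q
    (by rw [hpq]; exact fun x hx => h.pos x (List.mem_cons_of_mem a hx))
    (by rw [hpq]; exact fun x hx => h.dvd_head x hx)
    (by rw [hpq]; exact h.tail.total)
    (by rw [hp]; exact (List.pairwise_append.1 h.tail.pairwise).2.2)
    (by rw [hp]; exact hsum)
  rw [hpq] at h1
  simpa [Multiset.coe_add] using h1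

/-- Cuts with a repeated large weight give contractible spaces. -/
theorem IsDvdChain.pcontractible {F : ResCat ⥤ PSpace.{u}} (hF : IsResonanceFunctor F)
    (hcontr : ∀ (l : ℕ) (hl : 0 < l), 2 ≤ l →
      ContractibleSpace (F.obj (resOf hl fun _ : Fin l => 1))) {a : ℕ} {μ : List ℕ}
    (h : IsDvdChain (a :: μ)) (j : ℕ) {k : ℕ} (hk : 2 ≤ k) :
    PContractible (FW F (plain j (Multiset.replicate k a + μ))) := by
  rcases lt_or_ge μ.sum a with hlt | hge
  · exact (PContractible.FW_split hF hcontr j hk _).phequiv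
      (hF.FW_plain_phequiv_split (h.pos a List.mem_cons_self) j k (by omega) _ h.tail.pos
        h.dvd_head h.tail.total (by simpa using hlt)).symm
  · obtain ⟨p, q, rfl, hp⟩ := h.tail.exists_prefix h.dvd_head hge
    -- `σ` is empty because the null-homotopy is not needed: source and target of `i'` are
    -- contractible.
    obtain ⟨A, X, A', X', i, i', hi, hi', he, hA, hX, hA', hX', -⟩ :=
      h.exists_cofibers_list hF (σ := []) (List.Perm.refl p) hp j k
    have hp0 : p ≠ [] := by
      rintro rfl
      exact (h.pos a List.mem_cons_self).ne hp
    have hlen : q.length < (p ++ q).length := by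
      have := List.length_pos_iff.2 hp0
      rw [List.length_append]
      omega
    -- The merged subspace has one more copy of `a` and a shorter list of small weights.
    have hAc := (IsDvdChain.pcontractible hF hcontr (h.of_sublist
      ((List.sublist_append_right p q).cons_cons a)) j (k := k + 1) (by omega)).phequiv hA.symm
    have hA'c := (PContractible.FW_split hF hcontr j hk _).phequiv hA'.symm
    have hX'c := (PContractible.FW_split hF hcontr j hk _).phequiv hX'.symm
    exact hX'c.phequiv (((collapse_phequiv_of_pcontractible hi' hA'c).symm.trans
      (he.symm.trans (collapse_phequiv_of_pcontractible hi hAc))).trans hX)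
termination_by μ.length

/-! ### Wedge decompositions -/

/-- The pointed space `Y` is a wedge of the spaces `X^l ∧ S^w`, for `(l, w)` in `M`. -/
def HasDecomp (X Y : PSpace.{u}) (M : Multiset (ℕ × ℕ)) : Prop :=
  ∃ (ι : Type) (_ : Fintype ι) (p : ι → ℕ × ℕ), Finset.univ.val.map p = M ∧
    PHEquiv Y (wedge fun i => smash (smashPow X (p i).1) (sphere (p i).2))

namespace HasDecomp

variable {X Y Z : PSpace.{u}} {M N : Multiset (ℕ × ℕ)}

theorem congr (h : HasDecomp X Y M) (e : PHEquiv Z Y) : HasDecomp X Z M := by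
  obtain ⟨ι, hι, p, hp, h⟩ := h
  exact ⟨ι, hι, p, hp, e.trans h⟩

theorem of_pcontractible (h : PContractible Y) : HasDecomp X Y 0 :=
  ⟨Empty, inferInstance, Empty.elim, rfl, h.phequiv_of (pcontractible_wedge_of_isEmpty _)⟩

theorem of_phequiv {l : ℕ} (h : PHEquiv Y (smashPow X l)) : HasDecomp X Y {(l, 0)} :=
  ⟨Unit, inferInstance, fun _ => (l, 0), rfl,
    h.trans ((smash_sphere_zero _).symm.trans (wedge_unit _).symm)⟩

theorem bwedge (hY : HasDecomp X Y M) (hZ : HasDecomp X Z N) :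
    HasDecomp X (bwedge Y Z) (M + N) := by
  obtain ⟨ι, hι, p, rfl, hY⟩ := hY
  obtain ⟨κ, hκ, q, rfl, hZ⟩ := hZ
  refine ⟨ι ⊕ κ, inferInstance, Sum.elim p q, ?_,
    ((PHEquiv.bwedge hY hZ).trans (bwedge_wedge _ _)).trans (PHEquiv.wedge ?_)⟩
  · rw [← Finset.univ_disjSum_univ, Finset.val_disjSum, Multiset.disjSum, Multiset.map_add,
      Multiset.map_map, Multiset.map_map]
    rfl
  · rintro (i | i)
    · exact PHEquiv.refl _
    · exact PHEquiv.refl _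

theorem susp (hY : HasDecomp X Y M) :
    HasDecomp X (susp Y) (M.map fun p => (p.1, p.2 + 1)) := by
  obtain ⟨ι, hι, p, rfl, hY⟩ := hY
  refine ⟨ι, hι, fun i => ((p i).1, (p i).2 + 1), by rw [Multiset.map_map]; rfl,
    ((PHEquiv.susp hY).trans (susp_wedge _)).trans (PHEquiv.wedge fun i => ?_)⟩
  exact (smash_sphere_succ _ _).symm

end HasDecomp

/-- The multiset of the pairs of the length and the weight of the ways to cut a list into pieces
each of which but the last consists of an entry followed by entries with a sum that is a multiple
of it, with no repetition between the first two entries of what remains; the weight is the sum of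
the quotients. -/
def cutData : List ℕ → Multiset (ℕ × ℕ)
  | [] => {(0, 0)}
  | a :: μ =>
    if μ.head? = some a then 0 else
      ∑ k ∈ Finset.range (μ.length + 1), if a ∣ (μ.take k).sum then
        (cutData (μ.drop k)).map fun p => (p.1 + 1, p.2 + (μ.take k).sum / a) else 0
termination_by l => l.length
decreasing_by
  simp only [List.length_drop, List.length_cons]
  omega

theorem cutData_nil : cutData [] = {(0, 0)} := by rw [cutData]

theorem cutData_cons (a : ℕ) (μ : List ℕ) (h : μ.head? ≠ some a) :
    cutData (a :: μ) = ∑ k ∈ Finset.range (μ.length + 1), if a ∣ (μ.take k).sum then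
      (cutData (μ.drop k)).map fun p => (p.1 + 1, p.2 + (μ.take k).sum / a) else 0 := by
  rw [cutData, if_neg h]

theorem cutData_repeat (a : ℕ) (μ : List ℕ) : cutData (a :: a :: μ) = 0 := by
  rw [cutData, if_pos (by rfl)]

/-! ### Recursions for the ways to cut a list -/

theorem not_dvd_sum_take {l : List ℕ} (hpos : ∀ x ∈ l, 0 < x) {a k : ℕ} (hk : 0 < k)
    (hl : 0 < l.length) (hlt : (l.take k).sum < a) : ¬ a ∣ (l.take k).sum := by
  refine Nat.not_dvd_of_pos_of_lt ?_ hlt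
  refine List.sum_pos _ (fun x hx => hpos x (List.mem_of_mem_take hx)) ?_
  rw [← List.length_pos_iff, List.length_take]
  omega

theorem sum_take_le (l : List ℕ) (k : ℕ) : (l.take k).sum ≤ l.sum := by
  conv_rhs => rw [← List.take_append_drop k l, List.sum_append]
  exact Nat.le_add_right _ _

/-- A nonempty initial segment has positive sum less than `a`, so only `a` alone can be the first
piece. -/
theorem cutData_cons_of_sum_lt {a : ℕ} {μ : List ℕ} (hpos : ∀ x ∈ μ, 0 < x) (hlt : μ.sum < a) :
    cutData (a :: μ) = (cutData μ).map fun p => (p.1 + 1, p.2) := by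
  have hh : μ.head? ≠ some a := by
    cases μ with
    | nil => simp
    | cons c μ =>
      rw [List.sum_cons] at hlt
      simp only [List.head?_cons, ne_eq, Option.some.injEq]
      omega
  rw [cutData_cons a μ hh, Finset.sum_eq_single_of_mem 0 (by simp)]
  · simp
  · intro k hk hk0
    rw [Finset.mem_range] at hk
    exact if_neg (not_dvd_sum_take hpos (by omega) (by omega) ((sum_take_le μ k).trans_lt hlt))

/-- A cut strictly inside `p` would give a sum between 0 and `a`. So either the first piece is `a`
alone, or it contains all of `p`; in the second case deleting `p` gives a cutting of `a :: q` whose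
first quotient is smaller by one. -/
theorem cutData_cons_append {a : ℕ} {p q : List ℕ} (hpos : ∀ x ∈ p, 0 < x) (ha : 0 < a)
    (hp : p.sum = a) (hh : (p ++ q).head? ≠ some a) (hh' : q.head? ≠ some a) :
    cutData (a :: (p ++ q)) = ((cutData (p ++ q)).map fun x => (x.1 + 1, x.2)) +
      (cutData (a :: q)).map fun x => (x.1, x.2 + 1) := by
  have hp0 : p ≠ [] := by
    rintro rfl
    exact ha.ne hp
  have hl := List.length_pos_iff.2 hp0
  have hlen : (p ++ q).length + 1 = p.length + (q.length + 1) := by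
    rw [List.length_append, add_assoc]
  rw [cutData_cons a _ hh, cutData_cons a _ hh', hlen, Finset.sum_range_add]
  congr 1
  · rw [Finset.sum_eq_single_of_mem 0 (Finset.mem_range.2 hl)]
    · simp
    · intro k hk hk0
      rw [Finset.mem_range] at hk
      refine if_neg ?_
      rw [List.take_append_of_le_length hk.le]
      refine not_dvd_sum_take hpos (by omega) hl ?_
      have h1 : (p.take k).sum + (p.drop k).sum = a := by
        rw [← List.sum_append, List.take_append_drop, hp]
      have h2 : 0 < (p.drop k).sum := by
        refine List.sum_pos _ (fun x hx => hpos x (List.mem_of_mem_drop hx)) ?_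
        rw [← List.length_pos_iff, List.length_drop]
        omega
      omega
  · have h0 := map_sum (Multiset.mapAddMonoidHom fun x : ℕ × ℕ => (x.1, x.2 + 1))
      (fun k => if a ∣ (q.take k).sum then
        (cutData (q.drop k)).map fun p => (p.1 + 1, p.2 + (q.take k).sum / a) else 0)
      (Finset.range (q.length + 1))
    refine Eq.trans (Finset.sum_congr rfl fun k _ => ?_) h0.symm
    have h1 : ((p ++ q).take (p.length + k)).sum = a + (q.take k).sum := by
      rw [List.take_length_add_append, List.sum_append, hp]
    have h2 : (p ++ q).drop (p.length + k) = q.drop k := List.drop_length_add_append k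
    rw [h1, h2, Nat.add_div_left _ ha]
    simp only [Multiset.coe_mapAddMonoidHom, Nat.dvd_add_right dvd_rfl]
    split_ifs
    · rw [Multiset.map_map]
      rfl
    · rfl

/-- The decomposition for a chain of divisors with extra zero weights. -/
theorem hasDecomp_plain {F : ResCat ⥤ PSpace.{u}} (hF : IsResonanceFunctor F)
    (hcontr : ∀ (l : ℕ) (hl : 0 < l), 2 ≤ l →
      ContractibleSpace (F.obj (resOf hl fun _ : Fin l => 1))) {μ : List ℕ}
    (h : IsDvdChain μ) (j : ℕ) (hj : 0 < j + μ.length) :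
    HasDecomp (F.obj (resOf Nat.one_pos fun _ : Fin 1 => 1)) (FW F (plain j μ))
      ((cutData μ).map fun p => (j + p.1 + p.2, p.2)) := by
  have hone : ∀ (a : ℕ) (μ : List ℕ), ((a :: μ : List ℕ) : Multiset ℕ) =
      Multiset.replicate 1 a + μ := fun a μ => by
    rw [Multiset.replicate_one, Multiset.singleton_add, Multiset.cons_coe]
  have htwo : ∀ (a : ℕ) (μ : List ℕ), ((a :: a :: μ : List ℕ) : Multiset ℕ) =
      Multiset.replicate 2 a + μ := fun a μ => by
    rw [Multiset.replicate_succ, Multiset.replicate_one, Multiset.cons_add,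
      Multiset.singleton_add, Multiset.cons_coe, Multiset.cons_coe]
  induction hL : μ.length using Nat.strong_induction_on generalizing μ j with
  | _ L ih =>
  subst hL
  obtain _ | ⟨a, μ⟩ := μ
  · obtain ⟨j, rfl⟩ := Nat.exists_eq_succ_of_ne_zero (show j ≠ 0 by simpa using hj.ne')
    rw [cutData_nil]
    refine HasDecomp.of_phequiv ?_
    simpa [plain] using hF.FW_zero_phequiv j
  have ha := h.pos a List.mem_cons_self
  have ih' : ∀ {μ' : List ℕ}, IsDvdChain μ' → μ'.length ≤ μ.length →
      HasDecomp (F.obj (resOf Nat.one_pos fun _ : Fin 1 => 1)) (FW F (plain (j + 1) μ'))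
        ((cutData μ').map fun p => (j + 1 + p.1 + p.2, p.2)) := fun h' hl =>
    ih _ (Nat.lt_succ_of_le hl) h' (j + 1) (by omega) rfl
  rcases lt_or_ge μ.sum a with hlt | hge
  · rw [cutData_cons_of_sum_lt h.tail.pos hlt, Multiset.map_map, hone]
    have h2 := hF.FW_plain_phequiv_split ha j 1 one_pos μ h.tail.pos
      h.dvd_head h.tail.total (by simpa using hlt)
    have h3 := (ih' h.tail le_rfl).congr (h2.trans (hF.FW_split_one_phequiv j μ))
    have h4 : ((fun p : ℕ × ℕ => (j + p.1 + p.2, p.2)) ∘ fun p : ℕ × ℕ => (p.1 + 1, p.2)) =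
        fun p : ℕ × ℕ => (j + 1 + p.1 + p.2, p.2) := by
      funext p
      exact Prod.ext (by simp only [Function.comp_apply]; omega) rfl
    rw [h4]
    exact h3
  obtain ⟨p, q, rfl, hp⟩ := h.tail.exists_prefix h.dvd_head hge
  obtain _ | ⟨c, p⟩ := p
  · exact absurd hp ha.ne
  by_cases hca : c = a
  · subst hca
    rw [List.cons_append, cutData_repeat, htwo]
    exact HasDecomp.of_pcontractible (h.tail.pcontractible hF hcontr j le_rfl)
  have hc := h.pos c (by simp)
  have hcdvd : c ∣ a := h.dvd_head c (by simp)
  have hclt : c < a := lt_of_le_of_ne (Nat.le_of_dvd ha hcdvd) hca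
  have hq : q.head? ≠ some a := by
    cases q with
    | nil => simp
    | cons d q =>
      have := Nat.le_of_dvd hc (h.tail.dvd_head d (by simp))
      simp only [List.head?_cons, ne_eq, Option.some.injEq]
      omega
  have hchain := h.tail.of_sublist (List.sublist_append_left (c :: p) q)
  -- The entries of the block after c have sum `a` - c, a positive multiple of c, so an initial part
  -- of them has sum c.
  obtain ⟨σ, ρ, rfl, hσ⟩ := hchain.tail.exists_prefix hchain.dvd_head (by
    have h1 := Nat.le_of_dvd (Nat.sub_pos_of_lt hclt) (Nat.dvd_sub hcdvd dvd_rfl)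
    rw [List.sum_cons] at hp
    omega)
  have hσ0 : σ ≠ [] := by
    rintro rfl
    exact hc.ne hσ
  obtain ⟨A, X, A', X', i, i', hi, hi', he, hA, hX, hA', hX', hnull⟩ :=
    h.exists_cofibers_list hF (σ := σ) (ρ := c :: ρ) List.perm_middle hp j 1
  rw [← hone] at hX
  have haq := h.of_sublist ((List.sublist_append_right (c :: (σ ++ ρ)) q).cons_cons a)
  have hAc : PContractible A := (haq.pcontractible hF hcontr j le_rfl).phequiv hA.symm
  have hccq : IsDvdChain (c :: (ρ ++ q)) := by
    refine h.tail.of_sublist ?_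
    rw [List.cons_append, List.append_assoc]
    exact (List.sublist_append_right σ (ρ ++ q)).cons_cons c
  -- Merging `σ` produces a second weight c, which makes c a repeated largest small weight.
  have hnull := hnull hσ0 (by
    rw [hσ]
    refine PContractible.phequiv ?_ (hF.FW_split_one_phequiv j _).symm
    rw [List.cons_append, htwo]
    exact hccq.pcontractible hF hcontr (j + 1) le_rfl)
  have h1 := ih' h.tail le_rfl
  have h2 := ih' haq (by simp only [List.length_append, List.length_cons]; omega)
  -- The subspace with weights a, a, q is contractible, and in the separated cut the inclusion is
  -- null-homotopic, so the quotient splits as a wedge with a suspension.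
  have hE := (collapse_phequiv_of_pcontractible hi hAc).symm.trans
    (he.trans (collapse_phequiv_of_null hi' hnull))
  have h3 := (h1.congr (hX'.trans (hF.FW_split_one_phequiv j _))).bwedge
    (h2.congr (hA'.trans (hF.FW_split_one_phequiv j _))).susp
  have h4 := h3.congr (hX.symm.trans hE)
  rw [cutData_cons_append hchain.pos ha hp (by simpa using hca) hq, Multiset.map_add,
    Multiset.map_map, Multiset.map_map]
  rw [Multiset.map_map] at h4
  -- An extra zero weight accounts for one more piece in the first summand, and in the second for
  -- the weight added by the suspension.
  convert h4 using 3
  · exact Prod.ext (by simp only [Function.comp_apply]; omega) rfl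
  · exact Prod.ext (by simp only [Function.comp_apply]; omega) rfl

/-! ### Paths in the weighted graph -/

section Paths

variable (b m : ℕ → ℕ)

/-- The list of the entries `b i`, for `1 ≤ i ≤ x`, with multiplicities `m i`, in decreasing
order. -/
def fullList : ℕ → List ℕ
  | 0 => []
  | x + 1 => List.replicate (m (x + 1)) (b (x + 1)) ++ fullList x

/-- The list with one entry `b x` and the entries of smaller index with multiplicities. -/
def topList : ℕ → List ℕ
  | 0 => []
  | x + 1 => b (x + 1) :: fullList b m x

theorem edgeSum_self_succ (x : ℕ) : edgeSum b m x (x + 1) = b x * (mult m x - 1) := by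
  have h : Finset.Ioo x (x + 1) = ∅ := by
    ext i
    simp only [Finset.mem_Ioo, Finset.notMem_empty, iff_false]
    omega
  rw [edgeSum, h, Finset.sum_empty, zero_add]

theorem edgeSum_succ {x y : ℕ} (h : x < y) :
    edgeSum b m x (y + 1) = b y * m y + edgeSum b m x y := by
  have h1 : Finset.Ioo x (y + 1) = insert y (Finset.Ioo x y) := by
    ext i
    simp only [Finset.mem_Ioo, Finset.mem_insert]
    omega
  rw [edgeSum, edgeSum, h1, Finset.sum_insert (by simp), mult, if_neg (by omega), add_assoc]

/-- A cut contributes only if what remains is empty or does not begin with a repeated entry. It then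
begins with the last copy of some `b y`, so it is `topList b m y`, and the removed entries have sum
`edgeSum b m y (z + 1)`. The offset `s` carries what was removed earlier in the induction. -/
theorem sum_range_fullList {M : Type} [AddCommMonoid M] (z : ℕ)
    (hm : ∀ i, 1 ≤ i → i ≤ z → 1 ≤ m i) (G : ℕ → List ℕ → M)
    (hG : ∀ s a l, G s (a :: a :: l) = 0) (s : ℕ) :
    ∑ k ∈ Finset.range ((fullList b m z).length + 1),
      G (s + ((fullList b m z).take k).sum) ((fullList b m z).drop k) =
    ∑ y ∈ Finset.range (z + 1), G (s + edgeSum b m y (z + 1)) (topList b m y) := by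
  induction z generalizing s with
  | zero => simp [fullList, topList, edgeSum_self_succ, mult]
  | succ z ih =>
    have hlen : (fullList b m (z + 1)).length + 1 =
        m (z + 1) + ((fullList b m z).length + 1) := by
      rw [fullList, List.length_append, List.length_replicate, add_assoc]
    have hm1 := hm (z + 1) (by omega) le_rfl
    rw [hlen, Finset.sum_range_add, Finset.sum_range_succ _ (z + 1), add_comm]
    congr 1
    · have h1 := ih (fun i hi hi' => hm i hi (by omega)) (s + b (z + 1) * m (z + 1))
      refine (Finset.sum_congr rfl fun k _ => ?_).trans
        (h1.trans (Finset.sum_congr rfl fun y hy => ?_))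
      · have h2 : m (z + 1) + k = (List.replicate (m (z + 1)) (b (z + 1))).length + k := by
          rw [List.length_replicate]
        rw [fullList, h2, List.take_length_add_append, List.drop_length_add_append,
          List.sum_append, List.sum_replicate, smul_eq_mul, mul_comm, add_assoc]
      · rw [edgeSum_succ b m (Finset.mem_range.1 hy), add_assoc]
    -- Among the cuts within the copies of `b (z + 1)`, only the one that leaves a single copy
    -- contributes.
    · rw [Finset.sum_eq_single_of_mem (m (z + 1) - 1) (Finset.mem_range.2 (by omega))]
      · have h2 : m (z + 1) = (m (z + 1) - 1) + 1 := by omega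
        rw [edgeSum_self_succ, fullList, topList, mult, if_neg (by omega),
          List.take_append_of_le_length (by rw [List.length_replicate]; omega),
          List.drop_append_of_le_length (by rw [List.length_replicate]; omega),
          List.take_replicate, List.drop_replicate, List.sum_replicate, smul_eq_mul,
          min_eq_left (by omega), mul_comm]
        have h3 : m (z + 1) - (m (z + 1) - 1) = 1 := by omega
        rw [h3]
        rfl
      · intro k hk hk'
        have hk := Finset.mem_range.1 hk
        obtain ⟨d, hd⟩ : ∃ d, m (z + 1) - k = d + 1 + 1 := ⟨m (z + 1) - k - 2, by omega⟩
        rw [fullList, List.drop_append_of_le_length (by rw [List.length_replicate]; omega),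
          List.drop_replicate, hd, List.replicate_succ, List.replicate_succ]
        exact hG _ _ _

/-- The first piece of the list becomes an edge that ends at z + 1. Strict growth of `b` excludes
the vanishing case of `cutData`. -/
theorem cutData_topList_succ (z : ℕ) (hm : ∀ i, 1 ≤ i → i ≤ z → 1 ≤ m i)
    (hlt : 1 ≤ z → b z < b (z + 1)) :
    cutData (topList b m (z + 1)) = ∑ y ∈ Finset.range (z + 1),
      if b (z + 1) ∣ edgeSum b m y (z + 1) then (cutData (topList b m y)).map fun p =>
        (p.1 + 1, p.2 + edgeSum b m y (z + 1) / b (z + 1)) else 0 := by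
  have hh : (fullList b m z).head? ≠ some (b (z + 1)) := by
    cases z with
    | zero => simp [fullList]
    | succ z =>
      have h1 : m (z + 1) = (m (z + 1) - 1) + 1 := by
        have := hm (z + 1) (by omega) le_rfl
        omega
      rw [fullList, h1, List.replicate_succ, List.cons_append, List.head?_cons]
      have := hlt (by omega)
      simp only [ne_eq, Option.some.injEq]
      omega
  have h := sum_range_fullList b m z hm (fun t l => if b (z + 1) ∣ t then
    (cutData l).map fun p => (p.1 + 1, p.2 + t / b (z + 1)) else 0)
    (fun s a l => by rw [cutData_repeat]; simp) 0
  simp only [zero_add] at h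
  rw [topList, cutData_cons _ _ hh, h]

variable {b m}

theorem cons_bijective {n : ℕ} {x : Fin (n + 1)} (hx : x ≠ 0) :
    Function.Bijective fun p : Σ y : {y : Fin (n + 1) // y < x ∧ b x ∣ edgeSum b m y x},
      Quiver.Path (⟨0⟩ : Gam b m n) ⟨y.1⟩ =>
      (p.2.cons (⟨p.1.2⟩ : (⟨p.1.1⟩ : Gam b m n) ⟶ ⟨x⟩)) := by
  constructor
  · rintro ⟨⟨y, hy⟩, γ⟩ ⟨⟨y', hy'⟩, γ'⟩ h
    have h1 := Quiver.Path.obj_eq_of_cons_eq_cons h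
    obtain rfl : y = y' := congrArg Gam.idx h1
    have h2 := Quiver.Path.heq_of_cons_eq_cons h
    exact congrArg (Sigma.mk _) (eq_of_heq h2)
  · intro γ
    cases γ with
    | nil => exact absurd rfl hx
    | cons γ e => exact ⟨⟨⟨_, e.down⟩, γ⟩, rfl⟩

theorem path_zero_eq_nil {n : ℕ} (γ : Quiver.Path (⟨0⟩ : Gam b m n) ⟨0⟩) :
    γ = Quiver.Path.nil := by
  cases γ with
  | nil => rfl
  | cons γ e => exact absurd e.down.1 (Fin.not_lt_zero _)

theorem finite_path {n : ℕ} (x : Fin (n + 1)) : Finite (Quiver.Path (⟨0⟩ : Gam b m n) ⟨x⟩) := by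
  induction x using WellFoundedLT.induction with
  | ind x ih =>
    by_cases hx : x = 0
    · subst hx
      have : Subsingleton (Quiver.Path (⟨0⟩ : Gam b m n) ⟨0⟩) :=
        ⟨fun γ γ' => (path_zero_eq_nil γ).trans (path_zero_eq_nil γ').symm⟩
      infer_instance
    · have h : ∀ y : {y : Fin (n + 1) // y < x ∧ b x ∣ edgeSum b m y x},
          Finite (Quiver.Path (⟨0⟩ : Gam b m n) ⟨y.1⟩) := fun y => ih y.1 y.2.1
      exact Finite.of_surjective _ (cons_bijective hx).2

instance {n : ℕ} (x : Fin (n + 1)) : Fintype (Quiver.Path (⟨0⟩ : Gam b m n) ⟨x⟩) :=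
  have := finite_path (b := b) (m := m) x
  Fintype.ofFinite _

/-- Removing the last edge of a path gives the same recursion as removing the first piece of the
list, because the list starts at the largest weight. -/
theorem sum_path {n : ℕ} (hm : ∀ i, 1 ≤ i → i ≤ n → 1 ≤ m i)
    (hlt : ∀ i, 1 ≤ i → i < n → b i < b (i + 1)) (x : Fin (n + 1)) :
    ∑ γ : Quiver.Path (⟨0⟩ : Gam b m n) ⟨x⟩,
      ({(γ.length, γ.addWeightOfEPs (edgeWeight b m n))} : Multiset (ℕ × ℕ)) =
    cutData (topList b m x) := by
  classical
  induction x using WellFoundedLT.induction with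
  | ind x ih =>
    by_cases hx : x = 0
    · subst hx
      rw [Fintype.sum_eq_single Quiver.Path.nil fun γ hγ => absurd (path_zero_eq_nil γ) hγ]
      rw [Quiver.Path.addWeightOfEPs_nil]
      simp [topList, cutData_nil]
    · obtain ⟨z, hz⟩ := Nat.exists_eq_succ_of_ne_zero (show (x : ℕ) ≠ 0 from fun h => hx (Fin.ext h))
      have hzn : z < n := by
        have := x.2
        omega
      rw [hz, cutData_topList_succ b m z (fun i hi hi' => hm i hi (by omega))
        fun h => hlt z h hzn]
      rw [← (Equiv.ofBijective _ (cons_bijective hx)).sum_comp, Fintype.sum_sigma]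
      have h1 : ∀ y : {y : Fin (n + 1) // y < x ∧ b x ∣ edgeSum b m y x},
          ∑ γ : Quiver.Path (⟨0⟩ : Gam b m n) ⟨y.1⟩,
            ({(((Equiv.ofBijective _ (cons_bijective hx)) ⟨y, γ⟩).length,
              ((Equiv.ofBijective _ (cons_bijective hx)) ⟨y, γ⟩).addWeightOfEPs
                (edgeWeight b m n))} : Multiset (ℕ × ℕ)) =
          (cutData (topList b m y.1)).map fun p =>
            (p.1 + 1, p.2 + edgeSum b m y.1 x / b x) := by
        intro y
        rw [← ih y.1 y.2.1]
        refine Eq.trans ?_ (map_sum (Multiset.mapAddMonoidHom fun p : ℕ × ℕ =>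
          (p.1 + 1, p.2 + edgeSum b m y.1 x / b x)) _ _).symm
        refine Finset.sum_congr rfl fun γ _ => ?_
        rw [Equiv.ofBijective_apply, Quiver.Path.addWeightOfEPs_cons, Quiver.Path.length_cons]
        rfl
      rw [Finset.sum_congr rfl fun y _ => h1 y,
        ← Finset.sum_subtype (Finset.univ.filter fun y => y < x ∧ b x ∣ edgeSum b m y x)
          (fun y => by simp) fun y : Fin (n + 1) => (cutData (topList b m y)).map fun p =>
            (p.1 + 1, p.2 + edgeSum b m y x / b x), Finset.sum_filter]
      refine (Fin.sum_univ_eq_sum_range (fun y => if y < x ∧ b x ∣ edgeSum b m y x then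
        (cutData (topList b m y)).map fun p => (p.1 + 1, p.2 + edgeSum b m y x / b x) else 0)
        (n + 1)).trans ?_
      rw [hz]
      refine Eq.trans (Finset.sum_subset (Finset.range_mono (by omega)) fun y _ hy => ?_).symm
        (Finset.sum_congr rfl fun y hy => ?_)
      · rw [Finset.mem_range] at hy
        exact if_neg fun h => hy h.1
      · rw [Finset.mem_range] at hy
        simp only [hy, true_and, Nat.succ_eq_add_one]

/-! ### The list of all weights as a chain of divisors -/

theorem mem_fullList {x c : ℕ} (h : c ∈ fullList b m x) : ∃ i, 1 ≤ i ∧ i ≤ x ∧ c = b i := by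
  induction x with
  | zero => simp [fullList] at h
  | succ x ih =>
    rcases List.mem_append.1 h with h | h
    · exact ⟨x + 1, by omega, le_rfl, (List.mem_replicate.1 h).2⟩
    · obtain ⟨i, h1, h2, h3⟩ := ih h
      exact ⟨i, h1, by omega, h3⟩

theorem isDvdChain_fullList {x : ℕ} (hpos : ∀ i, 1 ≤ i → i ≤ x → 0 < b i)
    (hdvd : ∀ i j, 1 ≤ i → i ≤ j → j ≤ x → b i ∣ b j) : IsDvdChain (fullList b m x) := by
  induction x with
  | zero => exact ⟨by simp [fullList], List.Pairwise.nil⟩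
  | succ x ih =>
    have h := ih (fun i hi hi' => hpos i hi (by omega))
      fun i j hi hij hj => hdvd i j hi hij (by omega)
    refine ⟨fun c hc => ?_, List.pairwise_append.2 ⟨?_, h.pairwise, fun c hc d hd => ?_⟩⟩
    · obtain ⟨i, h1, h2, rfl⟩ := mem_fullList hc
      exact hpos i h1 h2
    · exact List.pairwise_replicate.2 (Or.inr dvd_rfl)
    · obtain ⟨i, h1, h2, rfl⟩ := mem_fullList hd
      rw [(List.mem_replicate.1 hc).2]
      exact hdvd i (x + 1) h1 (by omega) le_rfl

theorem coe_fullList (x : ℕ) : (fullList b m x : Multiset ℕ) =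
    ∑ i ∈ Finset.Icc 1 x, Multiset.replicate (m i) (b i) := by
  induction x with
  | zero => simp [fullList]
  | succ x ih =>
    rw [Finset.sum_Icc_succ_top (by omega), ← ih, fullList, ← Multiset.coe_add,
      Multiset.coe_replicate, add_comm]

end Paths

end

theorem theorem4p15
    (F : ResCat ⥤ PSpace.{u}) (hF : IsResonanceFunctor F)
    (hcontr : ∀ (l : ℕ) (hl : 0 < l), 2 ≤ l →
      ContractibleSpace (F.obj (resOf hl fun _ : Fin l => 1)))
    (n : ℕ) (hn : 1 ≤ n) (b m : ℕ → ℕ)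
    (hb : 1 ≤ b 1)
    (hlt : ∀ i, 1 ≤ i → i < n → b i < b (i + 1))
    (hdvd : ∀ i, 1 ≤ i → i < n → b i ∣ b (i + 1))
    (hm : ∀ i, 1 ≤ i → i ≤ n → 1 ≤ m i)
    (hmn : m n = 1)
    (N : ℕ) (hN : 0 < N) (v : Fin N → ℕ+)
    (hv : (Finset.univ.val.map fun j => (v j : ℕ)) =
      ∑ i ∈ Finset.Icc 1 n, Multiset.replicate (m i) (b i)) :
    PHEquiv (F.obj (resOf hN v))
      (wedge fun γ : CompletePath b m n =>
        smash (smashPow (F.obj (resOf Nat.one_pos fun _ : Fin 1 => 1))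
          (γ.length + pathWeight γ)) (sphere (pathWeight γ))) := by
  have hpos : ∀ i, 1 ≤ i → i ≤ n → 0 < b i := by
    intro i hi
    induction i, hi using Nat.le_induction with
    | base => exact fun _ => hb
    | succ i hi ih => exact fun hin => (Nat.zero_le _).trans_lt (hlt i hi hin)
  have hdvd' : ∀ i j, 1 ≤ i → i ≤ j → j ≤ n → b i ∣ b j := by
    intro i j hi hij
    induction j, hij using Nat.le_induction with
    | base => exact fun _ => dvd_rfl
    | succ j hij ih => exact fun hjn => (ih (by omega)).trans (hdvd j (by omega) hjn)
  -- As m n = 1, the largest weight occurs once, so the list of all weights is the one attached to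
  -- the vertex n.
  have htop : topList b m n = fullList b m n := by
    obtain ⟨n, rfl⟩ := Nat.exists_eq_succ_of_ne_zero (show n ≠ 0 by omega)
    rw [Nat.succ_eq_add_one] at hmn ⊢
    rw [topList, fullList, hmn]
    rfl
  have hlen : (fullList b m n).length = N := by
    rw [← coe_fullList] at hv
    simpa using (congrArg Multiset.card hv).symm
  have hFv : PHEquiv (F.obj (resOf hN v)) (FW F (plain 0 (fullList b m n))) := by
    refine hF.phequiv_FW_of_eq hN (ofVec_eq_wCut hN v) ?_
    rw [coe_fullList, ← hv, plain, Multiset.replicate_zero, zero_add, Multiset.map_map]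
    rfl
  have hdec := (hasDecomp_plain hF hcontr (isDvdChain_fullList hpos hdvd') 0
    (by rw [hlen]; omega)).congr hFv
  obtain ⟨ι, hι, p, hp, h⟩ := hdec
  -- Both wedges are indexed by families with the same multiset of exponents, so a bijection of the
  -- indices matches the summands.
  have hpath : Finset.univ.val.map (fun γ : CompletePath b m n =>
      (γ.length + pathWeight γ, pathWeight γ)) = Finset.univ.val.map p := by
    rw [hp, ← htop]
    have h1 := sum_path hm hlt (Fin.last n)
    rw [Fin.val_last] at h1
    rw [← h1]
    refine Eq.trans ?_ (map_sum (Multiset.mapAddMonoidHom fun p : ℕ × ℕ =>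
      (0 + p.1 + p.2, p.2)) _ _).symm
    refine (Multiset.sum_map_singleton _).symm.trans ?_
    rw [Multiset.map_map]
    refine Finset.sum_congr rfl fun γ _ => ?_
    simp [pathWeight]
  obtain ⟨e, he⟩ := exists_equiv_of_map_eq hpath
  refine h.trans ((wedge_reindex e _).symm.trans (PHEquiv.wedge fun γ => ?_))
  rw [he]
  exact PHEquiv.refl _
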